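/- Let $(\mathcal A F)(x)=\int_{x-1/2}^{x+1/2}F(s)\,ds$, $\mathcal M F=\mathcal A^2F-c^2F$ and $\triangle_1F(x)=F(x+1)-2F(x)+F(x-1)$. Let $a(k)=\frac{\sin(k/2)}{k/2}$ (with $a(0)=1$) and $m(k)=a(k)^2-c^2$. Fix $0<c_0<c_1<1$ such that for every $c\in[c_0,c_1]$ the function $m$ has exactly one positive root $k_c$ (then $a(k_c)=c$ and $m'(k_c)\neq0$), and put $Y_1(x)=\frac{\sqrt{2\pi}}{m'(k_c)}\cos(k_cx)\,\mathrm{sgn}(x)$, $Y_2(x)=\frac{\sqrt{2\pi}}{m'(k_c)}\sin(k_cx)\,\mathrm{sgn}(x)$. Potentials. Let $(\Psi_\delta)_{\delta>0}$ be $C^2$ functions on $\mathbb R$ and $C_\Psi$ a constant such that, for all $\delta>0$, $\Psi_\delta(0)=0$, $\Psi_\delta'=\mathrm{sgn}$ outside $(-\delta,\delta)$, $|\Psi_\delta'|\le C_\Psi$ and $|\Psi_\delta''|\le C_\Psi/\delta$. Assume $I_\delta:=\frac12\int_{\mathbb R}(\Psi_\delta'(r)-\mathrm{sgn}(r))\,dr=0$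 for all $\delta>0$. Anchor waves. Let $x_0,r_0,d_0,D_0>0$ be fixed. For $c\in[c_0,c_1]$, an anchor wave with speed $c$ is a function $R_0\in W^{2,\infty}(\mathbb R)$ with $R_0(0)=0$ and $c^2R_0''=\triangle_1(R_0-\mathrm{sgn}(R_0))$, of the form $R_0=\bar R_0+\alpha(\cos(k_c\cdot)-1)+\beta\sin(k_c\cdot)$ with $\alpha,\beta\in\mathbb R$, where $\bar R_0\in W^{2,\infty}(\mathbb R)$ solves the same equation, $\bar R_0(0)=0$, $\bar R_0(x)$ converges as $x\to+\infty$, and $\bar R_0(x)-\alpha^-(\cos(k_cx)-1)-\beta^-\sin(k_cx)$ converges as $x\to-\infty$ for some $\alpha^-,\beta^-\in\mathbb R$; moreover $\|R_0\|_\infty\le D_0(1-c^2)^{-1}$, $R_0(x)>r_0$ for $x>x_0$, $R_0(x)<-r_0$ for $x<-x_0$, and $R_0'(x)>d_0$ for $|x|<x_0$. Spaces. Let $X=\{S\in W^{2,\infty}(\mathbb R): S(0)=0,\ \lim_{x\to+\infty}S(x)\text{ exists}\}$ and, for constants $C_0,C_1,C_2$, let $X_\delta=\{S\in X:\|S\|_\infty\le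 C_0\delta^2,\ \|S'\|_\infty\le C_1\delta,\ \|S''\|_\infty\le C_2\}$. Given $R_0$, a function $S\in X$ is called $\delta$-admissible if there are $x_-<0<x_+$ with $(R_0+S)(x_\pm)=\pm\delta$, $R_0+S<-\delta$ on $(-\infty,x_-)$, $R_0+S>\delta$ on $(x_+,\infty)$ and $\frac12R_0'(0)<R_0'+S'<2R_0'(0)$ on $(x_-,x_+)$. Let $\mathcal G(S)=\Psi_\delta'(R_0+S)-\mathrm{sgn}(R_0)$, and let $\mathcal T(S)=\tilde S$, where $(\tilde S,\eta)\in X\times\mathbb R$ is the solution of $\mathcal M\tilde S=\mathcal A^2\mathcal G(S)+\eta$. Proposition. There exist $\delta_0>0$ and constants $C_0,C_1,C_2,C>0$ (independent of $\delta$, $c$ and $R_0$) such that for all $0<\delta<\delta_0$, all $c\in[c_0,c_1]$ and every anchor wave $R_0$ with speed $c$ the following holds. For every $S\in X_\delta$ the pair $(\tilde S,\eta)\in X\times\mathbb R$ exists and is unique, so that $\mathcal T$ is well defined on $X_\delta$; $\mathcal T$ maps $X_\delta$ into itself and is a contraction there for the norm $\|S\|_\#=\|S\|_\infty+\|S'\|_\infty+\delta\|S''\|_\infty$.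 There is a fixed point $S=\mathcal T(S)$ that is $\delta$-admissible and satisfies $$S\in X_\delta\cap\Big(L^2(\mathbb R)\oplus\mathrm{span}\Big\{1,\ Y_1-\tfrac{\sqrt{2\pi}}{m'(k_c)}\cos(k_c\cdot),\ Y_2-\tfrac{\sqrt{2\pi}}{m'(k_c)}\sin(k_c\cdot)\Big\}\Big),$$ and $R=R_0+S$ solves $\mathcal M R=\mathcal A^2\Psi_\delta'(R)+\mu$ for some $\mu\in\mathbb R$. Moreover $R(0)=0$; there are $\alpha_-,\beta_-\in\mathbb R$ such that $\lim_{x\to-\infty}\big(R(x)-\alpha_-\cos(k_cx)-\beta_-\sin(k_cx)\big)$ exists; $\lim_{x\to+\infty}(R(x)-R_0(x))$ exists; and $R(x)\le-\delta$ for $x\le-C\delta$, $R(x)\ge\delta$ for $x\ge C\delta$. -/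

import Mathlib

open MeasureTheory Filter Topology Set
open scoped ENNReal

noncomputable section

namespace PhaseTransition

/-- The `L^∞(ℝ)`-norm (essential supremum), with values in `[0, ∞]`. -/
def linf (f : ℝ → ℝ) : ℝ≥0∞ := eLpNorm f ∞ volume

/-- `W^{2,∞}(ℝ)`. Its elements are identified with their `C¹` representatives: these are the bounded
`C¹` functions whose derivative is bounded and Lipschitz. The weak second derivative then exists in
`L^∞(ℝ)` and coincides almost everywhere with `deriv (deriv f)`. -/
structure MemW2inf (f : ℝ → ℝ) : Prop where
  differentiable : Differentiable ℝ f
  bounded : ∃ B : ℝ, ∀ x, |f x| ≤ B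
  deriv_bounded : ∃ B : ℝ, ∀ x, |deriv f x| ≤ B
  deriv_lipschitz : ∃ K : NNReal, LipschitzWith K (deriv f)

/-- The averaging operator `(A F)(x) = ∫_{x-1/2}^{x+1/2} F(s) ds`. -/
def opA (F : ℝ → ℝ) (x : ℝ) : ℝ := ∫ s in (x - 1 / 2)..(x + 1 / 2), F s

/-- The operator `M F = A² F - c² F`. -/
def opM (c : ℝ) (F : ℝ → ℝ) (x : ℝ) : ℝ := opA (opA F) x - c ^ 2 * F x

/-- The discrete Laplacian `(Δ₁ F)(x) = F(x+1) - 2 F(x) + F(x-1)`. -/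
def lap1 (F : ℝ → ℝ) (x : ℝ) : ℝ := F (x + 1) - 2 * F x + F (x - 1)

/-- The symbol `a(k) = sin(k/2)/(k/2)` of `A`, with `a(0) = 1`. -/
def symA (k : ℝ) : ℝ := Real.sinc (k / 2)

/-- The symbol `m(k) = a(k)² - c²` of `M`. -/
def symM (c k : ℝ) : ℝ := symA k ^ 2 - c ^ 2

/-- The factor `√(2π) / m'(k)`. -/
def poleCoeff (c k : ℝ) : ℝ := Real.sqrt (2 * Real.pi) / deriv (symM c) k

def Y1 (c k x : ℝ) : ℝ := poleCoeff c k * Real.cos (k * x) * Real.sign x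

def Y2 (c k x : ℝ) : ℝ := poleCoeff c k * Real.sin (k * x) * Real.sign x

/-- The assumptions on the potentials `Ψ_δ`, `δ > 0`. -/
structure IsPotentialFamily (Ψ : ℝ → ℝ → ℝ) (CΨ : ℝ) : Prop where
  contDiff : ∀ δ > 0, ContDiff ℝ 2 (Ψ δ)
  map_zero : ∀ δ > 0, Ψ δ 0 = 0
  deriv_eq_sign : ∀ δ > 0, ∀ r : ℝ, r ∉ Ioo (-δ) δ → deriv (Ψ δ) r = Real.sign r
  deriv_le : ∀ δ > 0, ∀ r : ℝ, |deriv (Ψ δ) r| ≤ CΨ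
  deriv_deriv_le : ∀ δ > 0, ∀ r : ℝ, |deriv (deriv (Ψ δ)) r| ≤ CΨ / δ

/-- `I_δ = ½ ∫ (Ψ_δ'(r) - sgn r) dr`, for a single potential `P = Ψ_δ`. -/
def energyGap (P : ℝ → ℝ) : ℝ := (1 / 2) * ∫ r : ℝ, (deriv P r - Real.sign r)

/-- `R ∈ W^{2,∞}(ℝ)` solves the unperturbed travelling wave equation `c² R'' = Δ₁ (R - sgn R)`
in `L^∞(ℝ)`, that is, almost everywhere. -/
def IsUnperturbedWave (c : ℝ) (R : ℝ → ℝ) : Prop :=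
  MemW2inf R ∧
    ∀ᵐ x : ℝ, c ^ 2 * deriv (deriv R) x = lap1 (fun y => R y - Real.sign (R y)) x

/-- The unperturbed waves `R₀` with speed `c`, wave number `k` and constants `x₀, r₀, d₀, D₀`:
normalised members `R₀ = R̄₀ + α (cos (k ·) - 1) + β sin (k ·)` of the family generated by a wave
`R̄₀` that converges at `+∞` and has a harmonic tail at `-∞`, with the three uniform bounds. -/
structure IsAnchorWave (c k x₀ r₀ d₀ D₀ : ℝ) (R₀ : ℝ → ℝ) : Prop where
  wave : IsUnperturbedWave c R₀
  map_zero : R₀ 0 = 0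
  family : ∃ (Rbar : ℝ → ℝ) (α β : ℝ),
    IsUnperturbedWave c Rbar ∧ Rbar 0 = 0 ∧
    (∃ rp : ℝ, Tendsto Rbar atTop (𝓝 rp)) ∧
    (∃ αm βm rm : ℝ,
      Tendsto (fun x => Rbar x - αm * (Real.cos (k * x) - 1) - βm * Real.sin (k * x))
        atBot (𝓝 rm)) ∧
    ∀ x, R₀ x = Rbar x + α * (Real.cos (k * x) - 1) + β * Real.sin (k * x)
  norm_le : linf R₀ ≤ ENNReal.ofReal (D₀ * (1 - c ^ 2)⁻¹)
  gt_of_gt : ∀ x, x₀ < x → r₀ < R₀ x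
  lt_of_lt : ∀ x, x < -x₀ → R₀ x < -r₀
  deriv_gt : ∀ x, |x| < x₀ → d₀ < deriv R₀ x

/-- The space `X` of functions `S ∈ W^{2,∞}(ℝ)` with `S(0) = 0` that converge at `+∞`. -/
structure MemX (S : ℝ → ℝ) : Prop where
  memW2inf : MemW2inf S
  map_zero : S 0 = 0
  tendsto : ∃ σ : ℝ, Tendsto S atTop (𝓝 σ)

/-- The set `X_δ`, with constants `C₀, C₁, C₂`. -/
structure MemXdelta (C₀ C₁ C₂ δ : ℝ) (S : ℝ → ℝ) : Prop where
  memX : MemX S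
  norm_le : linf S ≤ ENNReal.ofReal (C₀ * δ ^ 2)
  norm_deriv_le : linf (deriv S) ≤ ENNReal.ofReal (C₁ * δ)
  norm_deriv_deriv_le : linf (deriv (deriv S)) ≤ ENNReal.ofReal C₂

/-- `S` is `δ`-admissible with respect to `R₀`. -/
def IsAdmissible (R₀ : ℝ → ℝ) (δ : ℝ) (S : ℝ → ℝ) : Prop :=
  MemX S ∧ ∃ xm xp : ℝ, xm < 0 ∧ 0 < xp ∧
    R₀ xm + S xm = -δ ∧ R₀ xp + S xp = δ ∧
    (∀ x, x < xm → R₀ x + S x < -δ) ∧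
    (∀ x, xp < x → δ < R₀ x + S x) ∧
    ∀ x, xm < x → x < xp →
      (1 / 2) * deriv R₀ 0 < deriv R₀ x + deriv S x ∧ deriv R₀ x + deriv S x < 2 * deriv R₀ 0

/-- Membership in
`L²(ℝ) ⊕ span {1, Y₁ - (√(2π)/m'(k)) cos (k ·), Y₂ - (√(2π)/m'(k)) sin (k ·)}`. -/
def MemTailSpace (c k : ℝ) (S : ℝ → ℝ) : Prop :=
  ∃ (Z : ℝ → ℝ) (l f₁ f₂ : ℝ), MemLp Z 2 volume ∧
    ∀ x, S x = Z x + l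
      + f₁ * (Y1 c k x - poleCoeff c k * Real.cos (k * x))
      + f₂ * (Y2 c k x - poleCoeff c k * Real.sin (k * x))

/-- `(R, μ)` solves the integrated travelling wave equation `M R = A² P'(R) + μ` for `P = Ψ_δ`. -/
def SolvesIntegratedTW (c : ℝ) (P : ℝ → ℝ) (R : ℝ → ℝ) (μ : ℝ) : Prop :=
  ∀ x, opM c R x = opA (opA fun y => deriv P (R y)) x + μ

/-- The superposition operator `G(S) = P'(R₀ + S) - sgn(R₀)` for `P = Ψ_δ`. -/
def opG (P R₀ S : ℝ → ℝ) (x : ℝ) : ℝ := deriv P (R₀ x + S x) - Real.sign (R₀ x)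

/-- `p = (S, η) ∈ X × ℝ` solves the affine problem `M S = A² G + η`. -/
def IsAffineSolution (c : ℝ) (G : ℝ → ℝ) (p : (ℝ → ℝ) × ℝ) : Prop :=
  MemX p.1 ∧ ∀ x, opM c p.1 x = opA (opA G) x + p.2

/-- The solution operator `L`: it selects the solution `(S, η) ∈ X × ℝ` of `M S = A² G + η`
(meaningful when this solution exists and is unique). -/
def opL (c : ℝ) (G : ℝ → ℝ) : (ℝ → ℝ) × ℝ := Classical.epsilon (IsAffineSolution c G)

/-- The fixed point operator `T = P_S ∘ L ∘ G`. -/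
def opT (c : ℝ) (P R₀ S : ℝ → ℝ) : ℝ → ℝ := (opL c (opG P R₀ S)).1

/-- The norm `‖S‖_# = ‖S‖_∞ + ‖S'‖_∞ + δ ‖S''‖_∞`. -/
def hashNorm (δ : ℝ) (S : ℝ → ℝ) : ℝ≥0∞ :=
  linf S + linf (deriv S) + ENNReal.ofReal δ * linf (deriv (deriv S))

end PhaseTransition

end

namespace PhaseTransition

/-! Everything rests on one linear estimate, `exists_linear_theory`. If `G` is bounded by `B` and
supported in `[-ε, ε]` with `ε ≤ 1`, then `M S = A² G + η` is uniquely solvable in `X × ℝ`, and `S`,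
`S'`, `S''` are at most of the sizes `|∫ G| + ε² B`, `ε B` and `B`, up to a factor that does not
depend on the speed.

Linear theory. `A²` is convolution with the tent `(1 - |x|)₊`, and the symbol `m` of `M` vanishes
only at `±k`, to first order. These zeros are divided out in physical space: the even kernel `u = uK
k`, supported in `[-1, 1]`, satisfies `u'' + k² u = tent - c² δ₀`, so `M S = u * (S'' + k² S)`
formally. Moreover `(1 - ∂²) u = c² δ₀ + ρ` with a continuous `ρ = rhoK k`, and the symbol `nK` of
this operator equals `(1 + ω²) m(ω) / (k² - ω²)` away from `±k`. It is positive, also at `±k`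
because the roots are simple, and by compactness it is bounded below uniformly in the speed
(`exists_symbolBounds`). The inverse operator is `c⁻² δ₀ + s`, where `s = sK k` decays like `1 / (1
+ x²)` (`SymbolBounds.abs_sK_le`, `SymbolBounds.resolvent`).

Given a source `G`, let `P = helm k G` solve `P'' + k² P = G` and vanish to the right of the
support. It suffices to solve `u * S = A² P`, and applying `1 - ∂²` turns this into `(c² δ₀ + ρ) * S
= (1 + k²) A² P - A² G`, which the resolvent inverts. To the left of the support `P` is a pure
oscillation, which produces the harmonic tail of `S` at `-∞`. For uniqueness, a homogeneous solution
`F` that tends to zero at `+∞` makes `u * F` a harmonic oscillation tending to zero, hence zero, and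
then the resolvent gives `F = 0` (`HasResolvent.affine_unique`).

Nonlinear part. For a small perturbation `V` with `V(0) = 0`, the wave `R₀ + V` leaves `(-δ, δ)`
within distance `2δ/d₀` of the origin and has the sign of `R₀`. Therefore `G(V)` is a bounded source
of width `O(δ)`. Its mean is `O(δ²)`: the integral of `g(R) R'` with `g = Ψ_δ' - sgn` is the energy
gap, which is zero, while `R'` differs from `R'(0)` by `O(δ)` on the support
(`AnchorData.abs_integral_opG_le`). The linear estimate now gives the scaling of `X_δ`. For two
perturbations, `|V - W| ≤ |x| ‖V' - W'‖_∞` compensates the factor `1/δ` in the Lipschitz constant of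
`Ψ_δ'`, so the difference of the sources has width `O(δ)` and height `O(‖V' - W'‖_∞)`. Thus `T`
contracts with a factor `O(δ)` (`FixedPointSetting.opT_sub`). -/

/-- Bounded measurable functions on the real line. -/
structure BddMeas (F : ℝ → ℝ) : Prop where
  meas : Measurable F
  bdd : ∃ B : ℝ, ∀ x, |F x| ≤ B

/-- Bounded functions that are continuous away from the origin. -/
structure ContOffZero (F : ℝ → ℝ) : Prop where
  cont : ∀ x ≠ 0, ContinuousAt F x
  bdd : ∃ B : ℝ, ∀ x, |F x| ≤ B

lemma ContOffZero.bddMeas {F : ℝ → ℝ} (h : ContOffZero F) : BddMeas F :=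
  ⟨measurable_of_continuousOn_compl_singleton 0
    (fun _ hx => (h.cont _ hx).continuousWithinAt), h.bdd⟩

lemma ContOffZero.of_continuous {F : ℝ → ℝ} (h : Continuous F) (hb : ∃ B : ℝ, ∀ x, |F x| ≤ B) :
    ContOffZero F := ⟨fun _ _ => h.continuousAt, hb⟩

lemma ContOffZero.sub {F G : ℝ → ℝ} (hF : ContOffZero F) (hG : ContOffZero G) :
    ContOffZero (fun x => F x - G x) := by
  refine ⟨fun x hx => (hF.cont x hx).sub (hG.cont x hx), ?_⟩
  obtain ⟨B, hB⟩ := hF.bdd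
  obtain ⟨B', hB'⟩ := hG.bdd
  exact ⟨B + B', fun x => (abs_sub _ _).trans (add_le_add (hB x) (hB' x))⟩

lemma BddMeas.of_continuous {F : ℝ → ℝ} (h : Continuous F) (hb : ∃ B : ℝ, ∀ x, |F x| ≤ B) :
    BddMeas F := ⟨h.measurable, hb⟩

lemma BddMeas.sub {F G : ℝ → ℝ} (hF : BddMeas F) (hG : BddMeas G) :
    BddMeas (fun x => F x - G x) := by
  refine ⟨hF.meas.sub hG.meas, ?_⟩
  obtain ⟨B, hB⟩ := hF.bdd
  obtain ⟨B', hB'⟩ := hG.bdd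
  exact ⟨B + B', fun x => (abs_sub _ _).trans (add_le_add (hB x) (hB' x))⟩

lemma BddMeas.add {F G : ℝ → ℝ} (hF : BddMeas F) (hG : BddMeas G) :
    BddMeas (fun x => F x + G x) := by
  refine ⟨hF.meas.add hG.meas, ?_⟩
  obtain ⟨B, hB⟩ := hF.bdd
  obtain ⟨B', hB'⟩ := hG.bdd
  exact ⟨B + B', fun x => (abs_add_le _ _).trans (add_le_add (hB x) (hB' x))⟩

lemma BddMeas.mul {F G : ℝ → ℝ} (hF : BddMeas F) (hG : BddMeas G) :
    BddMeas (fun x => F x * G x) := by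
  refine ⟨hF.meas.mul hG.meas, ?_⟩
  obtain ⟨B, hB⟩ := hF.bdd
  obtain ⟨B', hB'⟩ := hG.bdd
  refine ⟨B * B', fun x => ?_⟩
  rw [abs_mul]
  exact mul_le_mul (hB x) (hB' x) (abs_nonneg _) ((abs_nonneg _).trans (hB x))

lemma BddMeas.const (a : ℝ) : BddMeas (fun _ => a) := ⟨measurable_const, |a|, fun _ => le_rfl⟩

lemma BddMeas.comp {F φ : ℝ → ℝ} (hF : BddMeas F) (hφ : Measurable φ) :
    BddMeas (fun x => F (φ x)) :=
  ⟨hF.meas.comp hφ, hF.bdd.imp fun _ h x => h (φ x)⟩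

lemma BddMeas.comp_add_right {F : ℝ → ℝ} (hF : BddMeas F) (a : ℝ) : BddMeas (fun x => F (x + a)) :=
  hF.comp (measurable_id.add_const a)

lemma BddMeas.comp_add_left {F : ℝ → ℝ} (hF : BddMeas F) (a : ℝ) : BddMeas (fun x => F (a + x)) :=
  hF.comp (measurable_id.const_add a)

lemma BddMeas.comp_sub_left {F : ℝ → ℝ} (hF : BddMeas F) (a : ℝ) : BddMeas (fun x => F (a - x)) :=
  hF.comp (measurable_id.const_sub a)

lemma BddMeas.intervalIntegrable {F : ℝ → ℝ} (hF : BddMeas F) (a b : ℝ) :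
    IntervalIntegrable F volume a b := by
  obtain ⟨B, hB⟩ := hF.bdd
  refine (intervalIntegrable_const (c := B) (μ := volume) (a := a) (b := b)).mono_fun
    hF.meas.aestronglyMeasurable (Eventually.of_forall fun x => ?_)
  exact (hB x).trans (le_abs_self B)

lemma BddMeas.mul_intervalIntegrable {F r : ℝ → ℝ} (hF : BddMeas F) (hr : Continuous r) (a b : ℝ) :
    IntervalIntegrable (fun y => r y * F y) volume a b :=
  (hF.intervalIntegrable a b).continuousOn_mul hr.continuousOn

lemma abs_intervalIntegral_le {F : ℝ → ℝ} {B : ℝ} (hB : ∀ x, |F x| ≤ B) (a b : ℝ) :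
    |∫ s in a..b, F s| ≤ B * |b - a| :=
  intervalIntegral.norm_integral_le_of_norm_le_const (f := F) (fun x _ => hB x)

/-! ### The averaging operator -/

lemma abs_opA_le {F : ℝ → ℝ} {B : ℝ} (hB : ∀ x, |F x| ≤ B) (x : ℝ) : |opA F x| ≤ B := by
  have := abs_intervalIntegral_le hB (x - 1 / 2) (x + 1 / 2)
  have h1 : |x + 1 / 2 - (x - 1 / 2)| = 1 := by norm_num
  rwa [h1, mul_one] at this

lemma abs_opA_sub_le {F : ℝ → ℝ} (hF : BddMeas F) {B : ℝ} (hB : ∀ x, |F x| ≤ B) (x y : ℝ) :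
    |opA F x - opA F y| ≤ 2 * B * |x - y| := by
  have h : opA F x - opA F y
      = (∫ s in (y + 1 / 2)..(x + 1 / 2), F s) - ∫ s in (y - 1 / 2)..(x - 1 / 2), F s := by
    unfold opA
    have e1 := intervalIntegral.integral_interval_sub_interval_comm
      (hF.intervalIntegrable (x - 1 / 2) (x + 1 / 2))
      (hF.intervalIntegrable (y - 1 / 2) (y + 1 / 2))
      (hF.intervalIntegrable (x - 1 / 2) (y - 1 / 2))
    rw [e1, intervalIntegral.integral_symm (x - 1 / 2), intervalIntegral.integral_symm (x + 1 / 2)]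
    ring
  rw [h]
  refine (abs_sub _ _).trans ?_
  have h1 := abs_intervalIntegral_le hB (y + 1 / 2) (x + 1 / 2)
  have h2 := abs_intervalIntegral_le hB (y - 1 / 2) (x - 1 / 2)
  rw [show x + 1 / 2 - (y + 1 / 2) = x - y by ring] at h1
  rw [show x - 1 / 2 - (y - 1 / 2) = x - y by ring] at h2
  linarith

lemma continuous_of_abs_sub_le {f : ℝ → ℝ} {K : ℝ} (h : ∀ x y, |f x - f y| ≤ K * |x - y|) :
    Continuous f := by
  have hK : 0 ≤ K := by
    have := (abs_nonneg _).trans (h 1 0)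
    simpa using this
  refine (LipschitzWith.of_dist_le_mul (K := K.toNNReal) fun x y => ?_).continuous
  rw [Real.dist_eq, Real.dist_eq, Real.coe_toNNReal _ hK]
  exact h x y

lemma continuous_opA {F : ℝ → ℝ} (hF : BddMeas F) : Continuous (opA F) := by
  obtain ⟨B, hB⟩ := hF.bdd
  exact continuous_of_abs_sub_le (abs_opA_sub_le hF hB)

lemma bddMeas_opA {F : ℝ → ℝ} (hF : BddMeas F) : BddMeas (opA F) :=
  .of_continuous (continuous_opA hF) (hF.bdd.imp fun _ h => abs_opA_le h)

lemma opA_sub {F G : ℝ → ℝ} (hF : BddMeas F) (hG : BddMeas G) :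
    opA (fun x => F x - G x) = fun x => opA F x - opA G x := by
  ext x
  exact intervalIntegral.integral_sub (hF.intervalIntegrable _ _) (hG.intervalIntegrable _ _)

lemma opA_add {F G : ℝ → ℝ} (hF : BddMeas F) (hG : BddMeas G) :
    opA (fun x => F x + G x) = fun x => opA F x + opA G x := by
  ext x
  exact intervalIntegral.integral_add (hF.intervalIntegrable _ _) (hG.intervalIntegrable _ _)

lemma opA_const (a : ℝ) : opA (fun _ => a) = fun _ => a := by
  ext x
  simp only [opA, intervalIntegral.integral_const, smul_eq_mul]
  ring

lemma hasDerivAt_opA {F : ℝ → ℝ} (hF : BddMeas F) {x : ℝ} (h1 : ContinuousAt F (x + 1 / 2))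
    (h2 : ContinuousAt F (x - 1 / 2)) :
    HasDerivAt (opA F) (F (x + 1 / 2) - F (x - 1 / 2)) x := by
  have e : opA F = fun x => (∫ s in (0 : ℝ)..(x + 1 / 2), F s) - ∫ s in (0 : ℝ)..(x - 1 / 2), F s := by
    ext y
    rw [intervalIntegral.integral_interval_sub_left (hF.intervalIntegrable _ _)
      (hF.intervalIntegrable _ _)]
    rfl
  rw [e]
  have d1 := (intervalIntegral.integral_hasDerivAt_right (hF.intervalIntegrable 0 (x + 1 / 2))
    (hF.meas.stronglyMeasurable.stronglyMeasurableAtFilter) h1)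
  have d2 := (intervalIntegral.integral_hasDerivAt_right (hF.intervalIntegrable 0 (x - 1 / 2))
    (hF.meas.stronglyMeasurable.stronglyMeasurableAtFilter) h2)
  have d1' := d1.comp x ((hasDerivAt_id x).add_const (1 / 2))
  have d2' := d2.comp x ((hasDerivAt_id x).sub_const (1 / 2))
  simp only [mul_one] at d1' d2'
  exact d1'.sub d2'

lemma hasDerivAt_opA_opA {F : ℝ → ℝ} (hF : BddMeas F) (x : ℝ) :
    HasDerivAt (opA (opA F)) (opA F (x + 1 / 2) - opA F (x - 1 / 2)) x :=
  hasDerivAt_opA (bddMeas_opA hF) (continuous_opA hF).continuousAt (continuous_opA hF).continuousAt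

/-- If `c² F = A² H + a` with `H` bounded, then `F ∈ W^{2,∞}` with explicit bounds. -/
lemma hasDerivAt_of_eq_opA_opA {F H : ℝ → ℝ} {a b : ℝ} (hH : BddMeas H)
    (hF : ∀ x, F x = b * (opA (opA H) x + a)) (x : ℝ) :
    HasDerivAt F (b * (opA H (x + 1 / 2) - opA H (x - 1 / 2))) x := by
  have : F = fun x => b * (opA (opA H) x + a) := funext hF
  rw [this]
  exact ((hasDerivAt_opA_opA hH x).add_const a).const_mul b

/-! ### Even kernels supported in the unit interval -/

/-- Convolution with the even kernel that equals `r` on `[0,1]` and vanishes outside `[-1,1]`. -/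
noncomputable def Cv (r F : ℝ → ℝ) (x : ℝ) : ℝ := ∫ y in (0 : ℝ)..1, r y * (F (x - y) + F (x + y))

lemma Cv_intervalIntegrable {r F : ℝ → ℝ} (hr : Continuous r)
    (hF : ∀ a b, IntervalIntegrable F volume a b) (x : ℝ) :
    IntervalIntegrable (fun y => r y * (F (x - y) + F (x + y))) volume 0 1 := by
  have h1 : IntervalIntegrable (fun y => F (x - y)) volume 0 1 := by
    simpa using (hF (x - 0) (x - 1)).comp_sub_left x
  have h2 : IntervalIntegrable (fun y => F (x + y)) volume 0 1 := by
    simpa using (hF (x + 0) (x + 1)).comp_add_left x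
  exact (h1.add h2).continuousOn_mul hr.continuousOn

lemma abs_Cv_le {r F : ℝ → ℝ} {a B : ℝ} (hr : ∀ y ∈ Icc (0 : ℝ) 1, |r y| ≤ a)
    (hB : ∀ x, |F x| ≤ B) (x : ℝ) : |Cv r F x| ≤ 2 * a * B := by
  have : ‖Cv r F x‖ ≤ (2 * a * B) * |(1 : ℝ) - 0| := by
    refine intervalIntegral.norm_integral_le_of_norm_le_const fun y hy => ?_
    rw [uIoc_of_le zero_le_one] at hy
    rw [Real.norm_eq_abs, abs_mul]
    have h1 := hr y ⟨hy.1.le, hy.2⟩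
    have h2 := abs_add_le (F (x - y)) (F (x + y))
    have h3 : |F (x - y) + F (x + y)| ≤ 2 * B := by linarith [hB (x - y), hB (x + y)]
    calc |r y| * |F (x - y) + F (x + y)| ≤ a * (2 * B) :=
          mul_le_mul h1 h3 (abs_nonneg _) ((abs_nonneg _).trans h1)
      _ = 2 * a * B := by ring
  simpa using this

lemma Cv_congr {r F G : ℝ → ℝ} {x : ℝ} (h : ∀ y ∈ Icc (x - 1) (x + 1), F y = G y) :
    Cv r F x = Cv r G x := by
  refine intervalIntegral.integral_congr fun y hy => ?_
  rw [uIcc_of_le zero_le_one] at hy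
  rw [h (x - y) ⟨by linarith [hy.2], by linarith [hy.1]⟩,
    h (x + y) ⟨by linarith [hy.1], by linarith [hy.2]⟩]

lemma Cv_sub {r F G : ℝ → ℝ} (hr : Continuous r)
    (hF : ∀ a b, IntervalIntegrable F volume a b)
    (hG : ∀ a b, IntervalIntegrable G volume a b) (x : ℝ) :
    Cv r (fun x => F x - G x) x = Cv r F x - Cv r G x := by
  unfold Cv
  rw [← intervalIntegral.integral_sub (Cv_intervalIntegrable hr hF x)
    (Cv_intervalIntegrable hr hG x)]
  congr 1; ext y; ring

lemma Cv_add {r F G : ℝ → ℝ} (hr : Continuous r)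
    (hF : ∀ a b, IntervalIntegrable F volume a b)
    (hG : ∀ a b, IntervalIntegrable G volume a b) (x : ℝ) :
    Cv r (fun x => F x + G x) x = Cv r F x + Cv r G x := by
  unfold Cv
  rw [← intervalIntegral.integral_add (Cv_intervalIntegrable hr hF x)
    (Cv_intervalIntegrable hr hG x)]
  congr 1; ext y; ring

lemma Cv_const_mul {r F : ℝ → ℝ} (a : ℝ) (x : ℝ) :
    Cv r (fun x => a * F x) x = a * Cv r F x := by
  unfold Cv
  rw [← intervalIntegral.integral_const_mul]
  congr 1; ext y; ring

lemma measurable_Cv_aux {r F : ℝ → ℝ} (hr : Continuous r) (hF : Measurable F) :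
    Measurable (fun p : ℝ × ℝ => r p.2 * (F (p.1 - p.2) + F (p.1 + p.2))) :=
  (hr.measurable.comp measurable_snd).mul
    ((hF.comp (measurable_fst.sub measurable_snd)).add (hF.comp (measurable_fst.add measurable_snd)))

lemma bddMeas_Cv {r F : ℝ → ℝ} (hr : Continuous r) (hF : BddMeas F) : BddMeas (Cv r F) := by
  constructor
  · have : Cv r F = fun x => ∫ y in Ioc (0 : ℝ) 1, r y * (F (x - y) + F (x + y)) := by
      ext x; exact intervalIntegral.integral_of_le zero_le_one
    rw [this]
    exact ((measurable_Cv_aux hr hF.meas).stronglyMeasurable.integral_prod_right').measurable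
  · obtain ⟨B, hB⟩ := hF.bdd
    obtain ⟨a, ha⟩ := isCompact_Icc.exists_bound_of_continuousOn (s := Icc (0 : ℝ) 1) hr.continuousOn
    exact ⟨2 * a * B, abs_Cv_le ha hB⟩

/-- Lipschitz functions stay Lipschitz under convolution. -/
lemma abs_Cv_sub_le {r F : ℝ → ℝ} {a L : ℝ} (hrc : Continuous r) (hF : BddMeas F)
    (hr : ∀ y ∈ Icc (0 : ℝ) 1, |r y| ≤ a)
    (hL : ∀ x y, |F x - F y| ≤ L * |x - y|) (x x' : ℝ) :
    |Cv r F x - Cv r F x'| ≤ 2 * a * L * |x - x'| := by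
  have e : Cv r F x - Cv r F x' = Cv r (fun z => F (z + (x - x')) - F z) x' := by
    rw [Cv_sub hrc (hF.comp_add_right _).intervalIntegrable hF.intervalIntegrable]
    congr 1
    unfold Cv
    congr 1; ext y
    beta_reduce
    rw [show x' - y + (x - x') = x - y by ring, show x' + y + (x - x') = x + y by ring]
  rw [e]
  have := abs_Cv_le (r := r) (F := fun z => F (z + (x - x')) - F z) (a := a) (B := L * |x - x'|) hr
    (fun z => by
      have := hL (z + (x - x')) z
      rwa [show z + (x - x') - z = x - x' by ring] at this) x'
  calc _ ≤ _ := this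
    _ = _ := by ring

/-- The even extension of a kernel given on `[0,1]`. -/
noncomputable def evenExt (r : ℝ → ℝ) (z : ℝ) : ℝ := (Icc (-1 : ℝ) 1).indicator (fun z => r |z|) z

lemma integral_evenExt_mul {r F : ℝ → ℝ} (hr : Continuous r) (hF : BddMeas F) (x : ℝ) :
    ∫ z, evenExt r z * F (x - z) = Cv r F x := by
  have h1 : (fun z => evenExt r z * F (x - z))
      = (Icc (-1 : ℝ) 1).indicator (fun z => r |z| * F (x - z)) := by
    ext z
    unfold evenExt
    by_cases hz : z ∈ Icc (-1 : ℝ) 1 <;> simp [hz]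
  have hFx : BddMeas fun z => F (x - z) := hF.comp_sub_left x
  have hint : ∀ a b : ℝ, IntervalIntegrable (fun z => r |z| * F (x - z)) volume a b :=
    fun a b => hFx.mul_intervalIntegrable (hr.comp continuous_abs) a b
  rw [h1, integral_indicator measurableSet_Icc, integral_Icc_eq_integral_Ioc,
    ← intervalIntegral.integral_of_le (by norm_num),
    ← intervalIntegral.integral_add_adjacent_intervals (hint (-1) 0) (hint 0 1)]
  have h2 : ∫ z in (-1 : ℝ)..0, r |z| * F (x - z) = ∫ z in (0 : ℝ)..1, r |z| * F (x + z) := by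
    have := intervalIntegral.integral_comp_neg (a := (0 : ℝ)) (b := 1)
      (fun z => r |z| * F (x - z))
    simp only [abs_neg, sub_neg_eq_add, neg_zero] at this
    exact this.symm
  rw [h2, ← intervalIntegral.integral_add]
  · refine intervalIntegral.integral_congr fun y hy => ?_
    rw [uIcc_of_le zero_le_one] at hy
    rw [abs_of_nonneg hy.1]; ring
  · exact (hF.comp_add_left x).mul_intervalIntegrable
      (hr.comp continuous_abs) 0 1
  · exact hint 0 1

lemma integral_evenExt_mul' {r F : ℝ → ℝ} (hr : Continuous r) (hF : BddMeas F) (x : ℝ) :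
    ∫ z, evenExt r (x - z) * F z = Cv r F x := by
  rw [← integral_evenExt_mul hr hF, ← integral_sub_left_eq_self _ volume x]
  simp

/-- Fundamental theorem of calculus for functions that are continuous away from the origin. -/
lemma ContOffZero.hasDerivAt_primitive {F : ℝ → ℝ} (hF : ContOffZero F) {x : ℝ} (hx : x ≠ 0) :
    HasDerivAt (fun x => ∫ s in (0 : ℝ)..x, F s) (F x) x :=
  intervalIntegral.integral_hasDerivAt_right (hF.bddMeas.intervalIntegrable 0 x)
    (hF.bddMeas.meas.stronglyMeasurable.stronglyMeasurableAtFilter) (hF.cont x hx)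

/-- Two averagings of `F` give the difference of the integrals of its primitive `Φ` over `[x, x+1]`
and `[x-1, x]`. One integration by parts against the tent gives the same, since `Φ' = F` fails at
most at the origin. -/
lemma opA_opA_eq_Cv {F : ℝ → ℝ} (hF : ContOffZero F) (x : ℝ) :
    opA (opA F) x = Cv (fun y => 1 - y) F x := by
  have hI := hF.bddMeas.intervalIntegrable
  set Φ : ℝ → ℝ := fun x => ∫ s in (0 : ℝ)..x, F s with hΦ
  have hΦc : Continuous Φ := intervalIntegral.continuous_primitive (fun a b => hI a b) 0
  have hA : opA F = fun s => Φ (s + 1 / 2) - Φ (s - 1 / 2) := by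
    ext y
    exact (intervalIntegral.integral_interval_sub_left (hI _ _) (hI _ _)).symm
  have hi : ∀ a b : ℝ, IntervalIntegrable Φ volume a b := fun a b => hΦc.intervalIntegrable a b
  have e1 : opA (opA F) x = (∫ s in x..(x + 1), Φ s) - ∫ s in (x - 1)..x, Φ s := by
    rw [hA]
    unfold opA
    have i1 : ∀ a b : ℝ, IntervalIntegrable (fun s => Φ (s + 1 / 2)) volume a b :=
      fun a b => Continuous.intervalIntegrable (by fun_prop) a b
    have i2 : ∀ a b : ℝ, IntervalIntegrable (fun s => Φ (s - 1 / 2)) volume a b :=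
      fun a b => Continuous.intervalIntegrable (by fun_prop) a b
    rw [intervalIntegral.integral_sub (i1 _ _) (i2 _ _),
      intervalIntegral.integral_comp_add_right Φ, intervalIntegral.integral_comp_sub_right Φ]
    congr 2 <;> ring_nf
  have hcount : ∀ g : ℝ → ℝ, Function.Injective g → (g ⁻¹' {0}).Countable := fun g hg =>
    ((countable_singleton (0 : ℝ)).preimage hg)
  have j1 : IntervalIntegrable (fun y => (1 - y) * F (x + y)) volume 0 1 :=
    (hF.bddMeas.comp_add_left x).mul_intervalIntegrable (by fun_prop) 0 1
  have j2 : IntervalIntegrable (fun y => (1 - y) * F (x - y)) volume 0 1 :=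
    (hF.bddMeas.comp_sub_left x).mul_intervalIntegrable (by fun_prop) 0 1
  have j3 : IntervalIntegrable (fun y => Φ (x + y)) volume 0 1 :=
    Continuous.intervalIntegrable (by fun_prop) 0 1
  have j4 : IntervalIntegrable (fun y => Φ (x - y)) volume 0 1 :=
    Continuous.intervalIntegrable (by fun_prop) 0 1
  have e2 : ∫ y in (0 : ℝ)..1, (1 - y) * F (x + y) = -Φ x + ∫ s in x..(x + 1), Φ s := by
    have hsum := MeasureTheory.integral_eq_of_hasDerivAt_off_countable
      (fun y => (1 - y) * Φ (x + y)) (fun y => (1 - y) * F (x + y) - Φ (x + y)) (a := 0) (b := 1)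
      (hcount (fun y => x + y) (add_right_injective x))
      (by fun_prop) (fun y hy => by
        have d := (hF.hasDerivAt_primitive (x := x + y) (fun h => hy.2 h)).comp_const_add x y
        refine (((hasDerivAt_id' y).const_sub 1).fun_mul d).congr_deriv ?_
        ring) (j1.sub j3)
    rw [intervalIntegral.integral_sub j1 j3, intervalIntegral.integral_comp_add_left Φ] at hsum
    simp only [add_zero] at hsum
    linarith
  have e5 : ∫ y in (0 : ℝ)..1, (1 - y) * F (x - y) = Φ x - ∫ s in (x - 1)..x, Φ s := by
    have hsum := MeasureTheory.integral_eq_of_hasDerivAt_off_countable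
      (fun y => -((1 - y) * Φ (x - y))) (fun y => (1 - y) * F (x - y) + Φ (x - y)) (a := 0) (b := 1)
      (hcount (fun y => x - y) (sub_right_injective))
      (by fun_prop) (fun y hy => by
        have d := (hF.hasDerivAt_primitive (x := x - y) (fun h => hy.2 h)).comp_const_sub x y
        refine (((hasDerivAt_id' y).const_sub 1).fun_mul d).fun_neg.congr_deriv ?_
        ring) (j2.add j4)
    rw [intervalIntegral.integral_add j2 j4, intervalIntegral.integral_comp_sub_left Φ] at hsum
    simp only [sub_zero] at hsum
    linarith
  have e6 : Cv (fun y => 1 - y) F x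
      = (∫ y in (0 : ℝ)..1, (1 - y) * F (x - y)) + ∫ y in (0 : ℝ)..1, (1 - y) * F (x + y) := by
    rw [← intervalIntegral.integral_add j2 j1]
    unfold Cv; congr 1; ext y; ring
  rw [e1, e6, e2, e5]
  ring

/-- Integration by parts against an even `C²` kernel. -/
lemma integral_kernel_ibp {r r' r'' P P' H : ℝ → ℝ}
    (hr : ∀ y, HasDerivAt r (r' y) y) (hr' : ∀ y, HasDerivAt r' (r'' y) y) (hr'' : Continuous r'')
    (hP : ∀ x, HasDerivAt P (P' x) x) (hP'c : Continuous P')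
    (hP' : ∀ x ≠ 0, HasDerivAt P' (H x) x) (hH : ∀ a b, IntervalIntegrable H volume a b) (x : ℝ) :
    Cv r H x - Cv r'' P x = r 1 * (P' (x + 1) - P' (x - 1)) - r' 1 * (P (x + 1) + P (x - 1))
      + 2 * r' 0 * P x := by
  have hrc : Continuous r := continuous_iff_continuousAt.2 fun y => (hr y).continuousAt
  have hr'c : Continuous r' := continuous_iff_continuousAt.2 fun y => (hr' y).continuousAt
  have hPc : Continuous P := continuous_iff_continuousAt.2 fun y => (hP y).continuousAt
  have i1 := Cv_intervalIntegrable hrc hH x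
  have i2 := Cv_intervalIntegrable hr'' (fun a b => hPc.intervalIntegrable (μ := volume) a b) x
  -- The antiderivative comes from two integrations by parts. The values `y = ±x`, where `x ± y` may
  -- hit the origin, are exempt because `P'` need not be differentiable there.
  have key := MeasureTheory.integral_eq_of_hasDerivAt_off_countable
    (fun y => r y * (P' (x + y) - P' (x - y)) - r' y * (P (x + y) + P (x - y)))
    (fun y => r y * (H (x - y) + H (x + y)) - r'' y * (P (x - y) + P (x + y))) (a := 0) (b := 1)
    (s := {-x, x}) (by simp) (by fun_prop) (fun y hy => by
      have hy2 := hy.2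
      simp only [mem_insert_iff, mem_singleton_iff, not_or] at hy2
      have n1 : x + y ≠ 0 := fun h => hy2.1 (by linarith)
      have n2 : x - y ≠ 0 := fun h => hy2.2 (by linarith)
      have d1 := (hP' _ n1).comp_const_add x y
      have d2 := (hP' _ n2).comp_const_sub x y
      have d3 := (hP (x + y)).comp_const_add x y
      have d4 := (hP (x - y)).comp_const_sub x y
      refine (((hr y).fun_mul (d1.fun_sub d2)).fun_sub
        ((hr' y).fun_mul (d3.fun_add d4))).congr_deriv ?_
      ring) (i1.sub i2)
  rw [intervalIntegral.integral_sub i1 i2] at key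
  unfold Cv
  rw [key]
  simp only [add_zero, sub_zero]
  ring

lemma hasDerivAt_Cv {r Φ Φ' : ℝ → ℝ} (hr : Continuous r) (hΦ : ∀ x, HasDerivAt Φ (Φ' x) x)
    (hΦ' : Continuous Φ') (x : ℝ) : HasDerivAt (Cv r Φ) (Cv r Φ' x) x := by
  have hΦc : Continuous Φ := continuous_iff_continuousAt.2 fun y => (hΦ y).continuousAt
  obtain ⟨B, hB⟩ := (isCompact_Icc (a := x - 2) (b := x + 2)).exists_bound_of_continuousOn
    hΦ'.continuousOn
  refine (intervalIntegral.hasDerivAt_integral_of_dominated_loc_of_deriv_le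
    (F := fun x y => r y * (Φ (x - y) + Φ (x + y)))
    (F' := fun x y => r y * (Φ' (x - y) + Φ' (x + y)))
    (bound := fun y => |r y| * (B + B)) (Metric.ball_mem_nhds x one_pos)
    (Eventually.of_forall fun z => Continuous.aestronglyMeasurable (by fun_prop))
    (Continuous.intervalIntegrable (by fun_prop) 0 1)
    (Continuous.aestronglyMeasurable (by fun_prop))
    (Eventually.of_forall fun y hy z hz => ?_)
    (Continuous.intervalIntegrable (by fun_prop) 0 1)
    (Eventually.of_forall fun y _ z _ => ?_)).2
  · rw [uIoc_of_le zero_le_one] at hy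
    rw [Metric.mem_ball, Real.dist_eq, abs_lt] at hz
    rw [norm_mul, Real.norm_eq_abs]
    refine mul_le_mul_of_nonneg_left ((norm_add_le _ _).trans (add_le_add ?_ ?_)) (abs_nonneg _)
    · exact hB _ ⟨by linarith [hy.2], by linarith [hy.1]⟩
    · exact hB _ ⟨by linarith [hy.1], by linarith [hy.2]⟩
  · exact ((((hΦ (z - y)).comp_sub_const z y).fun_add
      ((hΦ (z + y)).comp_add_const z y)).const_mul (r y))

/-- The kernel `u` with `u'' + k² u = (1 - |·|)₊ - symA k ^ 2 δ₀`. -/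
noncomputable def uK (k y : ℝ) : ℝ := (k * (1 - y) - Real.sin (k * (1 - y))) / k ^ 3

/-- The derivative of `uK`. -/
noncomputable def uK' (k y : ℝ) : ℝ := -(1 - Real.cos (k * (1 - y))) / k ^ 2

/-- The regular part of `(1 - ∂²) u`. -/
noncomputable def rhoK (k y : ℝ) : ℝ := (1 + k ^ 2) * uK k y - (1 - y)

lemma continuous_uK (k : ℝ) : Continuous (uK k) := by unfold uK; fun_prop

lemma continuous_rhoK (k : ℝ) : Continuous (rhoK k) := by unfold rhoK uK; fun_prop

lemma continuous_tent : Continuous (fun y : ℝ => 1 - y) := by fun_prop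

lemma hasDerivAt_uK {k : ℝ} (hk : k ≠ 0) (y : ℝ) : HasDerivAt (uK k) (uK' k y) y := by
  have d1 : HasDerivAt (fun y : ℝ => k * (1 - y)) (-k) y :=
    (((hasDerivAt_id' y).const_sub 1).const_mul k).congr_deriv (by ring)
  refine ((d1.fun_sub d1.sin).div_const (k ^ 3)).congr_deriv ?_
  unfold uK'
  field_simp
  ring

lemma hasDerivAt_uK' {k : ℝ} (hk : k ≠ 0) (y : ℝ) :
    HasDerivAt (uK' k) ((1 - y) - k ^ 2 * uK k y) y := by
  have d1 : HasDerivAt (fun y : ℝ => k * (1 - y)) (-k) y :=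
    (((hasDerivAt_id' y).const_sub 1).const_mul k).congr_deriv (by ring)
  refine ((d1.cos.const_sub 1).fun_neg.div_const (k ^ 2)).congr_deriv ?_
  unfold uK
  field_simp
  ring

lemma symA_sq {k : ℝ} (hk : k ≠ 0) : symA k ^ 2 = 2 * (1 - Real.cos k) / k ^ 2 := by
  have h : k / 2 ≠ 0 := by positivity
  rw [symA, Real.sinc_of_ne_zero h, div_pow, Real.sin_sq_eq_half_sub,
    show 2 * (k / 2) = k by ring]
  field_simp

/-- The jump at the origin of the derivative of the even extension; it is the source of the Dirac
term in `u'' + k² u`. -/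
lemma uK'_zero {k : ℝ} (hk : k ≠ 0) : 2 * uK' k 0 = -symA k ^ 2 := by
  rw [symA_sq hk, uK']
  simp only [sub_zero, mul_one]
  field_simp

/-- `u * (∂² + k²) P = A² P - symA k ^ 2 P`. -/
lemma Cv_uK_eq {k : ℝ} (hk : k ≠ 0) {P P' G : ℝ → ℝ}
    (hP : ∀ x, HasDerivAt P (P' x) x) (hP'c : Continuous P')
    (hP' : ∀ x ≠ 0, HasDerivAt P' (G x - k ^ 2 * P x) x)
    (hG : ∀ a b, IntervalIntegrable G volume a b) (x : ℝ) :
    Cv (uK k) G x = Cv (fun y => 1 - y) P x - symA k ^ 2 * P x := by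
  have hPc : Continuous P := continuous_iff_continuousAt.2 fun y => (hP y).continuousAt
  have hPi : ∀ a b, IntervalIntegrable P volume a b := fun a b => hPc.intervalIntegrable a b
  have hPi' : ∀ a b, IntervalIntegrable (fun x => k ^ 2 * P x) volume a b :=
    fun a b => (hPi a b).const_mul _
  have key := integral_kernel_ibp (hasDerivAt_uK hk) (hasDerivAt_uK' hk)
    (by have := continuous_uK k; fun_prop) hP hP'c hP' (fun a b => (hG a b).sub (hPi' a b)) x
  rw [Cv_sub (continuous_uK k) hG hPi', Cv_const_mul] at key
  have e : Cv (fun y => (1 - y) - k ^ 2 * uK k y) P x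
      = Cv (fun y => 1 - y) P x - k ^ 2 * Cv (uK k) P x := by
    unfold Cv
    rw [← intervalIntegral.integral_const_mul, ← intervalIntegral.integral_sub
      (Cv_intervalIntegrable continuous_tent hPi x)
      ((Cv_intervalIntegrable (continuous_uK k) hPi x).const_mul _)]
    congr 1; ext y; ring
  have e1 : uK k 1 = 0 := by simp [uK]
  have e2 : uK' k 1 = 0 := by simp [uK']
  rw [e, e1, e2, uK'_zero hk] at key
  linarith

/-- `A² P'' = Δ₁ P`. -/
lemma Cv_tent_eq {P P' H : ℝ → ℝ}
    (hP : ∀ x, HasDerivAt P (P' x) x) (hP'c : Continuous P')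
    (hP' : ∀ x ≠ 0, HasDerivAt P' (H x) x)
    (hH : ∀ a b, IntervalIntegrable H volume a b) (x : ℝ) :
    Cv (fun y => 1 - y) H x = P (x + 1) - 2 * P x + P (x - 1) := by
  have key := integral_kernel_ibp (r := fun y => 1 - y) (r' := fun _ => -1) (r'' := fun _ => 0)
    (fun y => (hasDerivAt_id' y).const_sub 1) (fun y => hasDerivAt_const y _) continuous_const
    hP hP'c hP' hH x
  have e : Cv (fun _ => 0) P x = 0 := by simp [Cv]
  rw [e] at key
  linarith

/-- The second derivative of `u * F` for continuous `F`. -/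
lemma exists_hasDerivAt_Cv_uK {k : ℝ} (hk : k ≠ 0) {F : ℝ → ℝ} (hF : Continuous F) :
    ∃ v : ℝ → ℝ, (∀ x, HasDerivAt (Cv (uK k) F) (v x) x) ∧
      ∀ x, HasDerivAt v (Cv (fun y => 1 - y) F x - symA k ^ 2 * F x - k ^ 2 * Cv (uK k) F x) x := by
  -- As `F` is only continuous, `u * F` is expressed through a second primitive `Φ`: `Cv_uK_eq` with
  -- `(∂² + k²) Φ = F + k² Φ` leaves only terms that can be differentiated twice.
  set Φ' : ℝ → ℝ := fun x => ∫ s in (0 : ℝ)..x, F s with hΦ'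
  set Φ : ℝ → ℝ := fun x => ∫ s in (0 : ℝ)..x, Φ' s with hΦ
  have d1 : ∀ x, HasDerivAt Φ' (F x) x := fun x => hF.integral_hasStrictDerivAt 0 x |>.hasDerivAt
  have c1 : Continuous Φ' := continuous_iff_continuousAt.2 fun y => (d1 y).continuousAt
  have d2 : ∀ x, HasDerivAt Φ (Φ' x) x := fun x => c1.integral_hasStrictDerivAt 0 x |>.hasDerivAt
  have c2 : Continuous Φ := continuous_iff_continuousAt.2 fun y => (d2 y).continuousAt
  have hFi : ∀ a b, IntervalIntegrable F volume a b := fun a b => hF.intervalIntegrable a b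
  have hΦi : ∀ a b, IntervalIntegrable (fun x => k ^ 2 * Φ x) volume a b :=
    fun a b => (c2.intervalIntegrable a b).const_mul _
  have e : Cv (uK k) F = fun x =>
      Cv (fun y => 1 - y) Φ x - symA k ^ 2 * Φ x - k ^ 2 * Cv (uK k) Φ x := by
    ext x
    have := Cv_uK_eq hk (G := fun x => F x + k ^ 2 * Φ x) d2 c1
      (fun x _ => (d1 x).congr_deriv (by ring)) (fun a b => (hFi a b).add (hΦi a b)) x
    rw [Cv_add (continuous_uK k) hFi hΦi, Cv_const_mul] at this
    linarith
  refine ⟨fun x => Cv (fun y => 1 - y) Φ' x - symA k ^ 2 * Φ' x - k ^ 2 * Cv (uK k) Φ' x, ?_, ?_⟩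
  · intro x
    rw [e]
    exact ((hasDerivAt_Cv continuous_tent d2 c1 x).fun_sub ((d2 x).const_mul _)).fun_sub
      ((hasDerivAt_Cv (continuous_uK k) d2 c1 x).const_mul _)
  · intro x
    exact ((hasDerivAt_Cv continuous_tent d1 hF x).fun_sub ((d1 x).const_mul _)).fun_sub
      ((hasDerivAt_Cv (continuous_uK k) d1 hF x).const_mul _)

lemma Cv_rhoK {k : ℝ} {F : ℝ → ℝ} (hF : ∀ a b, IntervalIntegrable F volume a b) (x : ℝ) :
    Cv (rhoK k) F x = (1 + k ^ 2) * Cv (uK k) F x - Cv (fun y => 1 - y) F x := by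
  unfold Cv
  rw [← intervalIntegral.integral_const_mul, ← intervalIntegral.integral_sub
    ((Cv_intervalIntegrable (continuous_uK k) hF x).const_mul _)
    (Cv_intervalIntegrable continuous_tent hF x)]
  congr 1; ext y; unfold rhoK; ring

/-! ### Finite cosine and sine transforms -/

noncomputable def cosT (r : ℝ → ℝ) (ω : ℝ) : ℝ := ∫ y in (0 : ℝ)..1, r y * Real.cos (ω * y)

noncomputable def sinT (r : ℝ → ℝ) (ω : ℝ) : ℝ := ∫ y in (0 : ℝ)..1, r y * Real.sin (ω * y)

/-- Trigonometric functions are eigenfunctions of even kernels; the eigenvalue `2 * cosT r ω` is the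
Fourier transform of the even extension. -/
lemma Cv_cos (r : ℝ → ℝ) (ω x : ℝ) :
    Cv r (fun x => Real.cos (ω * x)) x = 2 * cosT r ω * Real.cos (ω * x) := by
  unfold Cv cosT
  rw [← intervalIntegral.integral_const_mul, ← intervalIntegral.integral_mul_const]
  congr 1; ext y
  beta_reduce
  rw [mul_sub ω, mul_add ω, Real.cos_sub, Real.cos_add]
  ring

lemma Cv_sin (r : ℝ → ℝ) (ω x : ℝ) :
    Cv r (fun x => Real.sin (ω * x)) x = 2 * cosT r ω * Real.sin (ω * x) := by
  unfold Cv cosT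
  rw [← intervalIntegral.integral_const_mul, ← intervalIntegral.integral_mul_const]
  congr 1; ext y
  beta_reduce
  rw [mul_sub ω, mul_add ω, Real.sin_sub, Real.sin_add]
  ring

lemma hasDerivAt_param_integral {f f' : ℝ → ℝ → ℝ} (hf : Continuous fun p : ℝ × ℝ => f p.1 p.2)
    (hf' : Continuous fun p : ℝ × ℝ => f' p.1 p.2)
    (h : ∀ ω y, HasDerivAt (fun ω => f ω y) (f' ω y) ω) (ω : ℝ) :
    HasDerivAt (fun ω => ∫ y in (0 : ℝ)..1, f ω y) (∫ y in (0 : ℝ)..1, f' ω y) ω := by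
  obtain ⟨B, hB⟩ := ((isCompact_Icc (a := ω - 1) (b := ω + 1)).prod
    (isCompact_Icc (a := (0 : ℝ)) (b := 1))).exists_bound_of_continuousOn hf'.continuousOn
  refine (intervalIntegral.hasDerivAt_integral_of_dominated_loc_of_deriv_le
    (bound := fun _ => B) (Metric.ball_mem_nhds ω one_pos)
    (Eventually.of_forall fun z => Continuous.aestronglyMeasurable (by fun_prop))
    (Continuous.intervalIntegrable (by fun_prop) 0 1)
    (Continuous.aestronglyMeasurable (by fun_prop))
    (Eventually.of_forall fun y hy z hz => ?_)
    (Continuous.intervalIntegrable (by fun_prop) 0 1)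
    (Eventually.of_forall fun y _ z _ => h z y)).2
  rw [uIoc_of_le zero_le_one] at hy
  rw [Metric.mem_ball, Real.dist_eq, abs_lt] at hz
  exact hB (z, y) ⟨⟨by linarith, by linarith⟩, ⟨hy.1.le, hy.2⟩⟩

lemma hasDerivAt_cosT {r : ℝ → ℝ} (hr : Continuous r) (ω : ℝ) :
    HasDerivAt (cosT r) (-sinT (fun y => y * r y) ω) ω := by
  refine (hasDerivAt_param_integral (f := fun ω y => r y * Real.cos (ω * y))
    (f' := fun ω y => -(y * r y * Real.sin (ω * y))) (by fun_prop) (by fun_prop)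
    (fun ω y => ?_) ω).congr_deriv ?_
  · refine (((hasDerivAt_id' ω).mul_const y).cos.const_mul (r y)).congr_deriv ?_
    ring
  · rw [intervalIntegral.integral_neg]; rfl

lemma hasDerivAt_sinT {r : ℝ → ℝ} (hr : Continuous r) (ω : ℝ) :
    HasDerivAt (sinT r) (cosT (fun y => y * r y) ω) ω := by
  refine (hasDerivAt_param_integral (f := fun ω y => r y * Real.sin (ω * y))
    (f' := fun ω y => y * r y * Real.cos (ω * y)) (by fun_prop) (by fun_prop)
    (fun ω y => ?_) ω)
  refine (((hasDerivAt_id' ω).mul_const y).sin.const_mul (r y)).congr_deriv ?_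
  ring

lemma abs_integral_unit_le {f : ℝ → ℝ} {B : ℝ} (h : ∀ y ∈ Icc (0 : ℝ) 1, |f y| ≤ B) :
    |∫ y in (0 : ℝ)..1, f y| ≤ B := by
  have := intervalIntegral.norm_integral_le_of_norm_le_const (f := f) (a := 0) (b := 1) (C := B)
    (fun y hy => by
      rw [uIoc_of_le zero_le_one] at hy
      exact h y ⟨hy.1.le, hy.2⟩)
  simpa using this

lemma abs_mul_le_of_abs_le_one {a b B : ℝ} (ha : |a| ≤ B) (hb : |b| ≤ 1) : |a * b| ≤ B := by
  rw [abs_mul]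
  exact (mul_le_of_le_one_right (abs_nonneg a) hb).trans ha

/-- Two integrations by parts gain `ω⁻²`. The boundary term of order `ω` disappears because `p 1 =
0` at one end and `sin 0 = 0` at the other. -/
lemma abs_cosT_le {p p' p'' : ℝ → ℝ} {B : ℝ} (hp : ∀ y, HasDerivAt p (p' y) y)
    (hp' : ∀ y, HasDerivAt p' (p'' y) y) (hp'' : Continuous p'')
    (b0 : ∀ y ∈ Icc (0 : ℝ) 1, |p y| ≤ B) (b1 : ∀ y ∈ Icc (0 : ℝ) 1, |p' y| ≤ B)
    (b2 : ∀ y ∈ Icc (0 : ℝ) 1, |p'' y| ≤ B) (h1 : p 1 = 0) (ω : ℝ) :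
    |cosT p ω| ≤ 4 * B / (1 + ω ^ 2) := by
  have hpc : Continuous p := continuous_iff_continuousAt.2 fun y => (hp y).continuousAt
  have hp'c : Continuous p' := continuous_iff_continuousAt.2 fun y => (hp' y).continuousAt
  have dlin : ∀ y, HasDerivAt (fun y => ω * y) ω y := fun y =>
    ((hasDerivAt_id' y).const_mul ω).congr_deriv (mul_one ω)
  have i1 : IntervalIntegrable (fun y => ω ^ 2 * (p y * Real.cos (ω * y))) volume 0 1 :=
    Continuous.intervalIntegrable (by fun_prop) 0 1
  have i2 : IntervalIntegrable (fun y => p'' y * Real.cos (ω * y)) volume 0 1 :=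
    Continuous.intervalIntegrable (by fun_prop) 0 1
  have key := intervalIntegral.integral_eq_sub_of_hasDerivAt (a := 0) (b := 1)
    (f := fun y => p y * (ω * Real.sin (ω * y)) + p' y * Real.cos (ω * y))
    (f' := fun y => ω ^ 2 * (p y * Real.cos (ω * y)) + p'' y * Real.cos (ω * y))
    (fun y _ => by
      refine (((hp y).fun_mul ((dlin y).sin.const_mul ω)).fun_add
        ((hp' y).fun_mul (dlin y).cos)).congr_deriv ?_
      ring) (i1.add i2)
  rw [intervalIntegral.integral_add i1 i2, intervalIntegral.integral_const_mul] at key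
  simp only [h1, mul_one, mul_zero, Real.sin_zero, Real.cos_zero, zero_mul, zero_add] at key
  have e1 : |∫ y in (0 : ℝ)..1, p'' y * Real.cos (ω * y)| ≤ B :=
    abs_integral_unit_le fun y hy => abs_mul_le_of_abs_le_one (b2 y hy) (Real.abs_cos_le_one _)
  have e0 : |cosT p ω| ≤ B :=
    abs_integral_unit_le fun y hy => abs_mul_le_of_abs_le_one (b0 y hy) (Real.abs_cos_le_one _)
  have e2 : |p' 1 * Real.cos ω| ≤ B :=
    abs_mul_le_of_abs_le_one (b1 1 (by simp)) (Real.abs_cos_le_one _)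
  have e3 : |p' 0| ≤ B := b1 0 (by simp)
  have e4 : ω ^ 2 * |cosT p ω| ≤ 3 * B := by
    rw [← abs_of_nonneg (sq_nonneg ω), ← abs_mul]
    have : ω ^ 2 * cosT p ω
        = p' 1 * Real.cos ω - p' 0 - ∫ y in (0 : ℝ)..1, p'' y * Real.cos (ω * y) := by
      unfold cosT; linarith
    rw [this]
    refine (abs_sub _ _).trans ?_
    linarith [abs_sub (p' 1 * Real.cos ω) (p' 0)]
  rw [le_div_iff₀ (by positivity)]
  linarith

/-- Here the boundary term at the origin carries `cos 0 = 1`, so `p 0 = 0` is needed too. It holds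
for `p = y ρ(y)`, the only case required. -/
lemma abs_sinT_le {p p' p'' : ℝ → ℝ} {B : ℝ} (hp : ∀ y, HasDerivAt p (p' y) y)
    (hp' : ∀ y, HasDerivAt p' (p'' y) y) (hp'' : Continuous p'')
    (b0 : ∀ y ∈ Icc (0 : ℝ) 1, |p y| ≤ B) (b1 : ∀ y ∈ Icc (0 : ℝ) 1, |p' y| ≤ B)
    (b2 : ∀ y ∈ Icc (0 : ℝ) 1, |p'' y| ≤ B) (h0 : p 0 = 0) (h1 : p 1 = 0) (ω : ℝ) :
    |sinT p ω| ≤ 4 * B / (1 + ω ^ 2) := by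
  have hpc : Continuous p := continuous_iff_continuousAt.2 fun y => (hp y).continuousAt
  have hp'c : Continuous p' := continuous_iff_continuousAt.2 fun y => (hp' y).continuousAt
  have dlin : ∀ y, HasDerivAt (fun y => ω * y) ω y := fun y =>
    ((hasDerivAt_id' y).const_mul ω).congr_deriv (mul_one ω)
  have i1 : IntervalIntegrable (fun y => ω ^ 2 * (p y * Real.sin (ω * y))) volume 0 1 :=
    Continuous.intervalIntegrable (by fun_prop) 0 1
  have i2 : IntervalIntegrable (fun y => p'' y * Real.sin (ω * y)) volume 0 1 :=
    Continuous.intervalIntegrable (by fun_prop) 0 1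
  have key := intervalIntegral.integral_eq_sub_of_hasDerivAt (a := 0) (b := 1)
    (f := fun y => -(p y * (ω * Real.cos (ω * y))) + p' y * Real.sin (ω * y))
    (f' := fun y => ω ^ 2 * (p y * Real.sin (ω * y)) + p'' y * Real.sin (ω * y))
    (fun y _ => by
      refine (((hp y).fun_mul ((dlin y).cos.const_mul ω)).fun_neg.fun_add
        ((hp' y).fun_mul (dlin y).sin)).congr_deriv ?_
      ring) (i1.add i2)
  rw [intervalIntegral.integral_add i1 i2, intervalIntegral.integral_const_mul] at key
  simp only [h0, h1, mul_one, mul_zero, Real.sin_zero, zero_mul, add_zero, zero_add, neg_zero,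
    sub_zero] at key
  have e1 : |∫ y in (0 : ℝ)..1, p'' y * Real.sin (ω * y)| ≤ B :=
    abs_integral_unit_le fun y hy => abs_mul_le_of_abs_le_one (b2 y hy) (Real.abs_sin_le_one _)
  have e0 : |sinT p ω| ≤ B :=
    abs_integral_unit_le fun y hy => abs_mul_le_of_abs_le_one (b0 y hy) (Real.abs_sin_le_one _)
  have e2 : |p' 1 * Real.sin ω| ≤ B :=
    abs_mul_le_of_abs_le_one (b1 1 (by simp)) (Real.abs_sin_le_one _)
  have hB : 0 ≤ B := (abs_nonneg _).trans e0
  have e4 : ω ^ 2 * |sinT p ω| ≤ 2 * B := by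
    rw [← abs_of_nonneg (sq_nonneg ω), ← abs_mul]
    have : ω ^ 2 * sinT p ω
        = p' 1 * Real.sin ω - ∫ y in (0 : ℝ)..1, p'' y * Real.sin (ω * y) := by
      unfold sinT; linarith
    rw [this]
    refine (abs_sub _ _).trans ?_
    linarith
  rw [le_div_iff₀ (by positivity)]
  linarith

/-! ### The symbol of `symA k ^ 2 δ₀ + ρ` -/

/-- Equal to `(1 + ω²)` times the transform of `u`, hence to `(1 + ω²) m(ω) / (k² - ω²)` off `±k`:
the zeros of `m` are removed and the limit at infinity is `symA k ^ 2`, so the symbol can be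
inverted. -/
noncomputable def nK (k ω : ℝ) : ℝ := symA k ^ 2 + 2 * cosT (rhoK k) ω

lemma symA_zero : symA 0 = 1 := by simp [symA]

lemma symA_neg (ω : ℝ) : symA (-ω) = symA ω := by
  rw [symA, symA, neg_div, Real.sinc_neg]

lemma continuous_symA : Continuous symA := by
  unfold symA
  exact Real.continuous_sinc.comp (continuous_id.div_const 2)

/-- Obtained by testing `A² P'' = Δ₁ P` on `P = cos (ω ·)` at the origin. The case `ω = 0` is
separate because the identity then carries the factor `ω² = 0`. -/
lemma two_cosT_tent (ω : ℝ) : 2 * cosT (fun y => 1 - y) ω = symA ω ^ 2 := by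
  by_cases hω : ω = 0
  · subst hω
    simp only [cosT, zero_mul, Real.cos_zero, mul_one, symA_zero]
    rw [intervalIntegral.integral_sub (by simp) (by simp)]
    simp only [intervalIntegral.integral_const, integral_id, sub_zero, smul_eq_mul]
    norm_num
  · have dlin : ∀ y, HasDerivAt (fun y => ω * y) ω y := fun y =>
      ((hasDerivAt_id' y).const_mul ω).congr_deriv (mul_one ω)
    have key := Cv_tent_eq (P := fun x => Real.cos (ω * x)) (P' := fun x => -ω * Real.sin (ω * x))
      (H := fun x => -ω ^ 2 * Real.cos (ω * x))
      (fun x => (dlin x).cos.congr_deriv (by ring)) (by fun_prop)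
      (fun x _ => ((dlin x).sin.const_mul (-ω)).congr_deriv (by ring))
      (fun a b => Continuous.intervalIntegrable (by fun_prop) a b) 0
    rw [Cv_const_mul, Cv_cos] at key
    simp only [mul_zero, Real.cos_zero, zero_add, zero_sub, mul_neg, mul_one, Real.cos_neg] at key
    rw [symA_sq hω, eq_div_iff (pow_ne_zero 2 hω)]
    linarith

lemma two_cosT_uK {k : ℝ} (hk : k ≠ 0) (ω : ℝ) :
    (k ^ 2 - ω ^ 2) * (2 * cosT (uK k) ω) = symA ω ^ 2 - symA k ^ 2 := by
  have dlin : ∀ y, HasDerivAt (fun y => ω * y) ω y := fun y =>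
    ((hasDerivAt_id' y).const_mul ω).congr_deriv (mul_one ω)
  have key := Cv_uK_eq hk (P := fun x => Real.cos (ω * x)) (P' := fun x => -ω * Real.sin (ω * x))
    (G := fun x => (k ^ 2 - ω ^ 2) * Real.cos (ω * x))
    (fun x => (dlin x).cos.congr_deriv (by ring)) (by fun_prop)
    (fun x _ => ((dlin x).sin.const_mul (-ω)).congr_deriv (by ring))
    (fun a b => Continuous.intervalIntegrable (by fun_prop) a b) 0
  rw [Cv_const_mul, Cv_cos, Cv_cos, two_cosT_tent] at key
  simpa using key

lemma cosT_rhoK (k ω : ℝ) : 2 * cosT (rhoK k) ω = (1 + k ^ 2) * (2 * cosT (uK k) ω) - symA ω ^ 2 := by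
  have := Cv_rhoK (k := k) (F := fun x => Real.cos (ω * x))
    (fun a b => Continuous.intervalIntegrable (by fun_prop) a b) 0
  rw [Cv_cos, Cv_cos, Cv_cos, two_cosT_tent] at this
  simpa using this

lemma nK_mul {k : ℝ} (hk : k ≠ 0) (ω : ℝ) :
    nK k ω * (k ^ 2 - ω ^ 2) = (1 + ω ^ 2) * (symA ω ^ 2 - symA k ^ 2) := by
  rw [nK, cosT_rhoK]
  linear_combination (1 + k ^ 2) * two_cosT_uK hk ω

/-- At `ω = k` the factor `k² - ω²` in `two_cosT_uK` vanishes, so the value must be computed. The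
antiderivative uses `2 sin(k - ky) cos(ky) = sin k + sin(k - 2ky)`. -/
lemma cosT_uK_self {k : ℝ} (hk : k ≠ 0) :
    cosT (uK k) k = ((1 - Real.cos k) / k - Real.sin k / 2) / k ^ 3 := by
  have dlin : ∀ y, HasDerivAt (fun y => k * y) k y := fun y =>
    ((hasDerivAt_id' y).const_mul k).congr_deriv (mul_one k)
  have dlin2 : ∀ y, HasDerivAt (fun y => k - 2 * (k * y)) (-(2 * k)) y := fun y =>
    ((dlin y).const_mul 2).const_sub k
  have key := intervalIntegral.integral_eq_sub_of_hasDerivAt (a := 0) (b := 1)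
    (f := fun y => ((1 - y) * Real.sin (k * y) - Real.cos (k * y) / k
      - (y * Real.sin k + Real.cos (k - 2 * (k * y)) / (2 * k)) / 2) / k ^ 3)
    (f' := fun y => uK k y * Real.cos (k * y))
    (fun y _ => by
      refine ((((((hasDerivAt_id' y).const_sub 1).fun_mul (dlin y).sin).fun_sub
        ((dlin y).cos.div_const k)).fun_sub ((((hasDerivAt_id' y).mul_const (Real.sin k)).fun_add
          ((dlin2 y).cos.div_const (2 * k))).div_const 2)).div_const (k ^ 3)).congr_deriv ?_
      have e1 : Real.sin (k * (1 - y))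
          = Real.sin k * Real.cos (k * y) - Real.cos k * Real.sin (k * y) := by
        rw [mul_sub, mul_one, Real.sin_sub]
      unfold uK
      rw [e1, Real.sin_sub, Real.sin_two_mul, Real.cos_two_mul]
      field_simp
      ring)
    (Continuous.intervalIntegrable (by have := continuous_uK k; fun_prop) 0 1)
  unfold cosT
  rw [key]
  simp only [mul_one, mul_zero, sub_zero, Real.sin_zero, Real.cos_zero, sub_self, zero_mul,
    one_mul, zero_add, zero_sub]
  rw [show k - 2 * k = -k by ring, Real.cos_neg]
  field_simp
  ring

/-- With `x = k/2` the sign is that of `sin x (sin x - x cos x)` on `(0, π)`: below `π/2` the second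
factor is positive by `x < tan x`, beyond it because `cos x ≤ 0`. By `hasDerivAt_symM_root` this
says that the root of the symbol is simple. -/
lemma cosT_uK_self_pos {k : ℝ} (hk : 0 < k) (hk' : k < 2 * Real.pi) : 0 < cosT (uK k) k := by
  rw [cosT_uK_self hk.ne']
  refine div_pos ?_ (by positivity)
  set x := k / 2 with hx
  have hkx : k = 2 * x := by rw [hx]; ring
  have hx0 : 0 < x := by positivity
  have hxp : x < Real.pi := by rw [hx]; linarith
  have hs : 0 < Real.sin x := Real.sin_pos_of_pos_of_lt_pi hx0 hxp
  have main : x * Real.cos x < Real.sin x := by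
    rcases lt_or_ge x (Real.pi / 2) with h | h
    · have hc : 0 < Real.cos x := Real.cos_pos_of_mem_Ioo ⟨by linarith, h⟩
      have := Real.lt_tan hx0 h
      rwa [Real.tan_eq_sin_div_cos, lt_div_iff₀ hc] at this
    · have hc : Real.cos x ≤ 0 := Real.cos_nonpos_of_pi_div_two_le_of_le h (by linarith)
      nlinarith
  rw [hkx, Real.cos_two_mul, Real.sin_two_mul]
  have e : (1 - (2 * Real.cos x ^ 2 - 1)) / (2 * x) - 2 * Real.sin x * Real.cos x / 2
      = Real.sin x * (Real.sin x - x * Real.cos x) / x := by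
    have : Real.cos x ^ 2 = 1 - Real.sin x ^ 2 := by rw [← Real.sin_sq_add_cos_sq x]; ring
    rw [this]
    field_simp
    ring
  rw [e]
  exact div_pos (mul_pos hs (by linarith)) hx0

/-- The second factor in the derivative of the symbol at its root. -/
lemma hasDerivAt_symM_root {c k : ℝ} (hk : k ≠ 0) (hc : symA k = c) :
    HasDerivAt (symM c) (-(4 * k * cosT (uK k) k)) k := by
  have e : symM c = fun ω => (k ^ 2 - ω ^ 2) * (2 * cosT (uK k) ω) := by
    ext ω; rw [two_cosT_uK hk, symM, hc]
  rw [e]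
  refine (((hasDerivAt_pow 2 k).const_sub (k ^ 2)).fun_mul
    ((hasDerivAt_cosT (continuous_uK k) k).const_mul 2)).congr_deriv ?_
  push_cast
  ring

/-! ### Positivity of the regularised symbol, uniformly in the speed -/

/-- `k` is the only positive root of the symbol `symA ^ 2 - symA k ^ 2`. -/
structure IsOnlyRoot (k : ℝ) : Prop where
  pos : 0 < k
  symA_pos : 0 < symA k
  symA_lt : symA k < 1
  unique : ∀ ω, 0 < ω → symA ω ^ 2 = symA k ^ 2 → ω = k

/-- `symA` falls from `1` at `0` to `0` at `2π`, so it takes the value `symA k` in between, and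
uniqueness of the root forces that point to be `k`. -/
lemma IsOnlyRoot.lt_two_pi {k : ℝ} (h : IsOnlyRoot k) : k < 2 * Real.pi := by
  have e : symA (2 * Real.pi) = 0 := by
    rw [symA, show 2 * Real.pi / 2 = Real.pi by ring, Real.sinc_of_ne_zero Real.pi_ne_zero]
    simp
  have := intermediate_value_Icc' (a := 0) (b := 2 * Real.pi) (by positivity)
    continuous_symA.continuousOn
  rw [e, symA_zero] at this
  obtain ⟨ω, ⟨h0, h1⟩, h2⟩ := this ⟨h.symA_pos.le, h.symA_lt.le⟩
  have hω0 : ω ≠ 0 := by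
    rintro rfl
    rw [symA_zero] at h2
    linarith [h.symA_lt]
  have hω1 : ω ≠ 2 * Real.pi := by
    rintro rfl
    rw [e] at h2
    linarith [h.symA_pos]
  rw [← h.unique ω (lt_of_le_of_ne h0 hω0.symm) (by rw [h2])]
  exact lt_of_le_of_ne h1 hω1

/-- By `nK_mul` a zero would be a root of `m`, hence `±k`, since `m(0) ≠ 0`. There the product
formula is void, but the value is `2 (1 + k²) cosT (uK k) k`, which is positive because the root is
simple. -/
lemma IsOnlyRoot.nK_ne_zero {k : ℝ} (h : IsOnlyRoot k) (ω : ℝ) : nK k ω ≠ 0 := by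
  have hpos := cosT_uK_self_pos h.pos h.lt_two_pi
  have self : ∀ ω : ℝ, cosT (uK k) ω = cosT (uK k) k → symA ω ^ 2 = symA k ^ 2 → nK k ω ≠ 0 := by
    intro ω h1 h2
    rw [nK, cosT_rhoK, h1, h2]
    have : 0 < (1 + k ^ 2) * (2 * cosT (uK k) k) := by positivity
    intro h3
    linarith
  intro h0
  have := nK_mul h.pos.ne' ω
  rw [h0, zero_mul] at this
  have h2 : symA ω ^ 2 = symA k ^ 2 := by
    rcases mul_eq_zero.1 this.symm with h3 | h3
    · nlinarith [sq_nonneg ω]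
    · linarith
  rcases lt_trichotomy ω 0 with h3 | h3 | h3
  · have h4 := h.unique (-ω) (by linarith) (by rw [symA_neg, h2])
    refine self ω ?_ h2 h0
    rw [show ω = -k by linarith]
    unfold cosT
    simp
  · rw [h3, symA_zero] at h2
    nlinarith [h.symA_pos, h.symA_lt]
  · have h4 := h.unique ω h3 h2
    exact self ω (by rw [h4]) h2 h0

lemma isOnlyRoot_of_existsUnique {c k : ℝ} (hc0 : 0 < c) (hc1 : c < 1)
    (h : ∃! k : ℝ, 0 < k ∧ symM c k = 0) (hk : 0 < k) (hkc : symA k = c) : IsOnlyRoot k := by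
  refine ⟨hk, hkc ▸ hc0, hkc ▸ hc1, fun ω hω h2 => ?_⟩
  refine h.unique ⟨hω, ?_⟩ ⟨hk, ?_⟩
  · rw [symM, h2, hkc, sub_self]
  · rw [symM, hkc, sub_self]

/-- The wave numbers for speeds in `[c₀, c₁]`. -/
def waveNumbers (c₀ c₁ : ℝ) : Set ℝ := {k | 0 ≤ k ∧ k ≤ 2 * Real.pi ∧ symA k ∈ Icc c₀ c₁}

lemma isCompact_waveNumbers (c₀ c₁ : ℝ) : IsCompact (waveNumbers c₀ c₁) := by
  have : waveNumbers c₀ c₁ = Icc 0 (2 * Real.pi) ∩ symA ⁻¹' Icc c₀ c₁ := by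
    ext k; simp [waveNumbers, and_assoc]
  rw [this]
  exact isCompact_Icc.inter_right (isClosed_Icc.preimage continuous_symA)

lemma pos_of_mem_waveNumbers {c₀ c₁ k : ℝ} (hc₁ : c₁ < 1) (hk : k ∈ waveNumbers c₀ c₁) : 0 < k := by
  refine lt_of_le_of_ne hk.1 ?_
  rintro rfl
  have := hk.2.2.2
  rw [symA_zero] at this
  linarith

lemma exists_forall_le_waveNumbers (c₀ : ℝ) {c₁ : ℝ} (hc₁ : c₁ < 1) :
    ∃ κ > 0, ∀ k ∈ waveNumbers c₀ c₁, κ ≤ k := by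
  rcases (waveNumbers c₀ c₁).eq_empty_or_nonempty with h | h
  · exact ⟨1, one_pos, by simp [h]⟩
  · obtain ⟨κ, hκ, hmin⟩ := (isCompact_waveNumbers c₀ c₁).exists_isMinOn h continuousOn_id
    exact ⟨κ, pos_of_mem_waveNumbers hc₁ hκ, fun k hk => hmin hk⟩

/-- Joint continuity is what minimising over speeds and frequencies together needs. The singular
prefactor `(1 + k²) / k³` is pulled out, so that the remaining integrands are jointly continuous
everywhere. -/
lemma continuousOn_nK : ContinuousOn (fun p : ℝ × ℝ => nK p.1 p.2) {p | p.1 ≠ 0} := by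
  have e : ∀ p : ℝ × ℝ, nK p.1 p.2 = symA p.1 ^ 2 + 2 * ((1 + p.1 ^ 2) / p.1 ^ 3 *
      (∫ y in (0 : ℝ)..1, (p.1 * (1 - y) - Real.sin (p.1 * (1 - y))) * Real.cos (p.2 * y))
      - ∫ y in (0 : ℝ)..1, (1 - y) * Real.cos (p.2 * y)) := by
    intro p
    rw [nK, cosT]
    congr 2
    rw [← intervalIntegral.integral_const_mul, ← intervalIntegral.integral_sub
      (Continuous.intervalIntegrable (by fun_prop) 0 1)
      (Continuous.intervalIntegrable (by fun_prop) 0 1)]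
    congr 1; ext y
    unfold rhoK uK
    ring
  have c1 : Continuous fun p : ℝ × ℝ =>
      ∫ y in (0 : ℝ)..1, (p.1 * (1 - y) - Real.sin (p.1 * (1 - y))) * Real.cos (p.2 * y) :=
    intervalIntegral.continuous_parametric_intervalIntegral_of_continuous' (by fun_prop) 0 1
  have c2 : Continuous fun p : ℝ × ℝ => ∫ y in (0 : ℝ)..1, (1 - y) * Real.cos (p.2 * y) :=
    intervalIntegral.continuous_parametric_intervalIntegral_of_continuous' (by fun_prop) 0 1
  have c3 := continuous_symA
  simp only [e]
  refine ContinuousOn.add (by fun_prop) (ContinuousOn.mul continuousOn_const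
    (ContinuousOn.sub (ContinuousOn.mul (ContinuousOn.div (by fun_prop) (by fun_prop) ?_)
      c1.continuousOn) c2.continuousOn))
  intro p hp
  exact pow_ne_zero 3 hp

/-- Uniform bounds on the kernel `rhoK` and its derivatives. -/
lemma exists_rhoK_bounds {κ K : ℝ} (hκ : 0 < κ) : ∃ B > 0, ∀ k, κ ≤ k → k ≤ K →
    ∃ p' p'' : ℝ → ℝ, (∀ y, HasDerivAt (rhoK k) (p' y) y) ∧ (∀ y, HasDerivAt p' (p'' y) y) ∧
      Continuous p'' ∧ ∀ y ∈ Icc (0 : ℝ) 1, |rhoK k y| ≤ B ∧ |p' y| ≤ B ∧ |p'' y| ≤ B := by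
  -- `B1` and `B2` bound `uK k` and `uK' k` on `[0, 1]`. Absolute values keep the final constant
  -- positive even when no `k` satisfies `κ ≤ k ≤ K`.
  set B1 := (K + 1) / κ ^ 3
  set B2 := 2 / κ ^ 2
  refine ⟨|(1 + K ^ 2) * (|B1| + B2 + 1 + K ^ 2 * |B1|) + 1| + 1, by positivity,
    fun k hk hkK => ⟨fun y => (1 + k ^ 2) * uK' k y + 1,
      fun y => (1 + k ^ 2) * ((1 - y) - k ^ 2 * uK k y), fun y => ?_, fun y => ?_, ?_, ?_⟩⟩
  · exact (((hasDerivAt_uK (by linarith : 0 < k).ne' y).const_mul _).fun_sub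
      ((hasDerivAt_id' y).const_sub 1)).congr_deriv (by ring)
  · exact ((hasDerivAt_uK' (by linarith : 0 < k).ne' y).const_mul _).add_const 1
  · have := continuous_uK k
    fun_prop
  · intro y hy
    have hk0 : 0 < k := by linarith
    have hK0 : 0 < K := by linarith
    have b1 : |uK k y| ≤ |B1| := by
      refine le_trans ?_ (le_abs_self B1)
      rw [uK, abs_div, abs_of_pos (pow_pos hk0 3)]
      refine div_le_div₀ (by positivity) ?_ (by positivity) (pow_le_pow_left₀ hκ.le hk 3)
      refine (abs_sub _ _).trans (add_le_add ?_ (Real.abs_sin_le_one _))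
      rw [abs_of_nonneg (mul_nonneg hk0.le (by linarith [hy.2]))]
      nlinarith [hy.1]
    have b2 : |uK' k y| ≤ B2 := by
      rw [uK', abs_div, abs_of_pos (pow_pos hk0 2), abs_neg]
      refine div_le_div₀ (by positivity) ?_ (by positivity) (pow_le_pow_left₀ hκ.le hk 2)
      rw [abs_of_nonneg (by linarith [Real.cos_le_one (k * (1 - y))])]
      linarith [Real.neg_one_le_cos (k * (1 - y))]
    have b3 : |1 - y| ≤ 1 := by
      rw [abs_le]; constructor <;> linarith [hy.1, hy.2]
    have hB2 : 0 ≤ B2 := by positivity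
    have hk2 : k ^ 2 ≤ K ^ 2 := pow_le_pow_left₀ hk0.le hkK 2
    have hx : 0 ≤ |B1| := abs_nonneg _
    have mulle : ∀ a X : ℝ, |a| ≤ X → |(1 + k ^ 2) * a| ≤ (1 + K ^ 2) * X := by
      intro a X h
      rw [abs_mul, abs_of_pos (by positivity)]
      exact mul_le_mul (by linarith) h (abs_nonneg _) (by positivity)
    have b4 : |(1 - y) - k ^ 2 * uK k y| ≤ 1 + K ^ 2 * |B1| := by
      refine (abs_sub _ _).trans (add_le_add b3 ?_)
      rw [abs_mul, abs_of_nonneg (sq_nonneg k)]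
      exact mul_le_mul hk2 b1 (abs_nonneg _) (by positivity)
    have p1 : 0 ≤ (1 + K ^ 2) * |B1| := by positivity
    have p2 : 0 ≤ (1 + K ^ 2) * B2 := by positivity
    have p3 : 0 ≤ (1 + K ^ 2) * (1 + K ^ 2 * |B1|) := by positivity
    have hle := le_abs_self ((1 + K ^ 2) * (|B1| + B2 + 1 + K ^ 2 * |B1|) + 1)
    refine ⟨?_, ?_, ?_⟩
    · refine (abs_sub _ _).trans ?_
      linarith [mulle _ _ b1]
    · refine (abs_add_le _ _).trans ?_
      rw [abs_one]
      linarith [mulle _ _ b2]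
    · linarith [mulle _ _ b4]

/-- Uniform bounds on the symbol `nK` and its first two derivatives. -/
structure SymbolBounds (k N ν : ℝ) : Prop where
  cos0 : ∀ ω, |cosT (rhoK k) ω| ≤ N / (1 + ω ^ 2)
  sin1 : ∀ ω, |sinT (fun y => y * rhoK k y) ω| ≤ N / (1 + ω ^ 2)
  cos2 : ∀ ω, |cosT (fun y => y * (y * rhoK k y)) ω| ≤ N / (1 + ω ^ 2)
  le : ∀ ω, ν ≤ nK k ω

lemma exists_transform_bounds {κ K : ℝ} (hκ : 0 < κ) : ∃ N > 0, ∀ k, κ ≤ k → k ≤ K →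
    (∀ ω, |cosT (rhoK k) ω| ≤ N / (1 + ω ^ 2)) ∧
    (∀ ω, |sinT (fun y => y * rhoK k y) ω| ≤ N / (1 + ω ^ 2)) ∧
    ∀ ω, |cosT (fun y => y * (y * rhoK k y)) ω| ≤ N / (1 + ω ^ 2) := by
  obtain ⟨B, hB, h⟩ := exists_rhoK_bounds (K := K) hκ
  -- `4` is the constant of `abs_cosT_le` and `abs_sinT_le`; `7 = 2 + 4 + 1` is the largest
  -- coefficient sum, met in the second derivative of `y² ρ(y)`.
  refine ⟨4 * (7 * B), by positivity, fun k hk hkK => ?_⟩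
  obtain ⟨p', p'', d1, d2, hc, hb⟩ := h k hk hkK
  have hp0 := continuous_rhoK k
  have hp'c : Continuous p' := continuous_iff_continuousAt.2 fun y => (d2 y).continuousAt
  have r1 : rhoK k 1 = 0 := by simp [rhoK, uK]
  have ym : ∀ y ∈ Icc (0 : ℝ) 1, ∀ a X : ℝ, |a| ≤ X → |y * a| ≤ X := by
    intro y hy a X h
    rw [mul_comm]
    exact abs_mul_le_of_abs_le_one h (by rw [abs_of_nonneg hy.1]; exact hy.2)
  have d3 : ∀ y, HasDerivAt (fun y => y * rhoK k y) (rhoK k y + y * p' y) y := fun y =>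
    ((hasDerivAt_id' y).fun_mul (d1 y)).congr_deriv (by ring)
  have d4 : ∀ y, HasDerivAt (fun y => rhoK k y + y * p' y) (2 * p' y + y * p'' y) y := fun y =>
    ((d1 y).fun_add ((hasDerivAt_id' y).fun_mul (d2 y))).congr_deriv (by ring)
  have d5 : ∀ y, HasDerivAt (fun y => y * (y * rhoK k y)) (2 * (y * rhoK k y) + y * (y * p' y)) y :=
    fun y => ((hasDerivAt_id' y).fun_mul (d3 y)).congr_deriv (by ring)
  have d6 : ∀ y, HasDerivAt (fun y => 2 * (y * rhoK k y) + y * (y * p' y))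
      (2 * rhoK k y + 4 * (y * p' y) + y * (y * p'' y)) y := fun y =>
    (((d3 y).const_mul 2).fun_add ((hasDerivAt_id' y).fun_mul
      ((hasDerivAt_id' y).fun_mul (d2 y)))).congr_deriv (by ring)
  refine ⟨fun ω => ?_, fun ω => ?_, fun ω => ?_⟩
  · refine abs_cosT_le d1 d2 hc (fun y hy => ?_) (fun y hy => ?_) (fun y hy => ?_) r1 ω <;>
    linarith [(hb y hy).1, (hb y hy).2.1, (hb y hy).2.2]
  · refine abs_sinT_le d3 d4 (by fun_prop) (fun y hy => ?_) (fun y hy => ?_) (fun y hy => ?_)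
      (by simp) (by simp [r1]) ω
    · linarith [ym y hy _ _ (hb y hy).1]
    · refine (abs_add_le _ _).trans ?_
      linarith [ym y hy _ _ (hb y hy).2.1, (hb y hy).1]
    · refine (abs_add_le _ _).trans ?_
      rw [abs_mul, abs_two]
      linarith [ym y hy _ _ (hb y hy).2.2, (hb y hy).2.1]
  · refine abs_cosT_le d5 d6 (by fun_prop) (fun y hy => ?_) (fun y hy => ?_) (fun y hy => ?_)
      (by simp [r1]) ω
    · linarith [ym y hy _ _ (ym y hy _ _ (hb y hy).1)]
    · refine (abs_add_le _ _).trans ?_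
      rw [abs_mul, abs_two]
      linarith [ym y hy _ _ (hb y hy).1, ym y hy _ _ (ym y hy _ _ (hb y hy).2.1)]
    · refine (abs_add_three _ _ _).trans ?_
      rw [abs_mul, abs_two, abs_mul 4, abs_of_pos (by norm_num : (0:ℝ) < 4)]
      linarith [ym y hy _ _ (hb y hy).2.1, ym y hy _ _ (ym y hy _ _ (hb y hy).2.2), (hb y hy).1]

lemma continuous_cosT {r : ℝ → ℝ} (hr : Continuous r) : Continuous (cosT r) :=
  continuous_iff_continuousAt.2 fun ω => (hasDerivAt_cosT hr ω).continuousAt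

lemma continuous_sinT {r : ℝ → ℝ} (hr : Continuous r) : Continuous (sinT r) :=
  continuous_iff_continuousAt.2 fun ω => (hasDerivAt_sinT hr ω).continuousAt

lemma continuous_nK (k : ℝ) : Continuous (nK k) :=
  continuous_const.add (continuous_const.mul (continuous_cosT (continuous_rhoK k)))

/-- The symbol is bounded below by half its limit for large frequencies. -/
lemma nK_ge_of_large {k c N ω : ℝ} (hc : 0 < c) (hk : c ≤ symA k)
    (hN : |cosT (rhoK k) ω| ≤ N / (1 + ω ^ 2)) (hω : 4 * N / c ^ 2 ≤ 1 + ω ^ 2) :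
    c ^ 2 / 2 ≤ nK k ω := by
  have h1 : N / (1 + ω ^ 2) ≤ c ^ 2 / 4 := by
    rw [div_le_iff₀ (by positivity)]
    rw [div_le_iff₀ (by positivity)] at hω
    linarith
  have h2 := abs_le.1 (hN.trans h1)
  have h3 : c ^ 2 ≤ symA k ^ 2 := pow_le_pow_left₀ hc.le hk 2
  unfold nK
  linarith [h2.1]

/-- The symbol has no zeros and is positive at high frequencies, so the intermediate value theorem
fixes its sign. -/
lemma nK_pos {k c N : ℝ} (h : IsOnlyRoot k) (hc : 0 < c) (hk : c ≤ symA k)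
    (hN : ∀ ω, |cosT (rhoK k) ω| ≤ N / (1 + ω ^ 2)) (ω : ℝ) : 0 < nK k ω := by
  by_contra hneg
  set W := max ω (|4 * N / c ^ 2| + 1) with hW
  have hW1 : |4 * N / c ^ 2| + 1 ≤ W := le_max_right _ _
  have h1 : 0 < nK k W := by
    have := nK_ge_of_large hc hk (hN W) (by
      have := le_abs_self (4 * N / c ^ 2)
      nlinarith [abs_nonneg (4 * N / c ^ 2)])
    have : 0 < c ^ 2 / 2 := by positivity
    linarith
  obtain ⟨z, -, hz⟩ := intermediate_value_Icc (le_max_left ω _ : ω ≤ W)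
    (continuous_nK k).continuousOn ⟨not_lt.1 hneg, h1.le⟩
  exact h.nK_ne_zero z hz

/-- The symbol bounds hold uniformly for all speeds in `[c₀, c₁]`. -/
theorem exists_symbolBounds {c₀ c₁ : ℝ} (hc₀ : 0 < c₀) (hc₁ : c₁ < 1)
    (hroot : ∀ c ∈ Icc c₀ c₁, ∃! k : ℝ, 0 < k ∧ symM c k = 0) :
    ∃ κ > 0, ∃ N > 0, ∃ ν > 0, ∀ k, 0 < k → symA k ∈ Icc c₀ c₁ →
      κ ≤ k ∧ k ≤ 2 * Real.pi ∧ SymbolBounds k N ν := by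
  obtain ⟨κ, hκ, hκk⟩ := exists_forall_le_waveNumbers c₀ hc₁
  obtain ⟨N, hN, hNk⟩ := exists_transform_bounds (K := 2 * Real.pi) hκ
  have only : ∀ k ∈ waveNumbers c₀ c₁, IsOnlyRoot k := fun k hk =>
    isOnlyRoot_of_existsUnique (hc₀.trans_le hk.2.2.1) (hk.2.2.2.trans_lt hc₁) (hroot _ hk.2.2)
      (pos_of_mem_waveNumbers hc₁ hk) rfl
  -- Frequencies with `|ω| > W` are covered by `nK_ge_of_large`, as `1 + ω² ≥ 2 |ω|`. The other
  -- pairs `(k, ω)` form a compact set on which `nK` attains a positive minimum.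
  set W := 4 * N / c₀ ^ 2 with hW
  have hcpt : IsCompact (waveNumbers c₀ c₁ ×ˢ Icc (-W) W) :=
    (isCompact_waveNumbers c₀ c₁).prod isCompact_Icc
  obtain ⟨ν, hν, hνk⟩ : ∃ ν > 0, ∀ p ∈ waveNumbers c₀ c₁ ×ˢ Icc (-W) W, ν ≤ nK p.1 p.2 := by
    rcases (waveNumbers c₀ c₁ ×ˢ Icc (-W) W).eq_empty_or_nonempty with h | h
    · exact ⟨1, one_pos, by simp [h]⟩
    · obtain ⟨p, hp, hmin⟩ := hcpt.exists_isMinOn h (continuousOn_nK.mono fun p hp =>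
        (pos_of_mem_waveNumbers hc₁ hp.1).ne')
      exact ⟨nK p.1 p.2, nK_pos (only _ hp.1) hc₀ hp.1.2.2.1
        (hNk _ (hκk _ hp.1) hp.1.2.1).1 _, fun k hk => hmin hk⟩
  refine ⟨κ, hκ, N, hN, min ν (c₀ ^ 2 / 2), lt_min hν (by positivity), fun k hk hkc => ?_⟩
  have hk2 := (isOnlyRoot_of_existsUnique (hc₀.trans_le hkc.1) (hkc.2.trans_lt hc₁) (hroot _ hkc)
    hk rfl).lt_two_pi.le
  have hmem : k ∈ waveNumbers c₀ c₁ := ⟨hk.le, hk2, hkc⟩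
  obtain ⟨b0, b1, b2⟩ := hNk k (hκk _ hmem) hk2
  refine ⟨hκk _ hmem, hk2, b0, b1, b2, fun ω => ?_⟩
  by_cases hω : |ω| ≤ W
  · exact (min_le_left _ _).trans (hνk (k, ω) ⟨hmem, abs_le.1 hω⟩)
  · refine (min_le_right _ _).trans (nK_ge_of_large hc₀ hkc.1 (b0 ω) ?_)
    rw [not_le] at hω
    have : ω ^ 2 = |ω| ^ 2 := (sq_abs ω).symm
    nlinarith [sq_nonneg (|ω| - 1)]

/-! ### Functions with quadratic decay -/

lemma integrable_div_one_add_sq (A : ℝ) : Integrable fun ω : ℝ => A / (1 + ω ^ 2) := by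
  simpa [div_eq_mul_inv] using integrable_inv_one_add_sq.const_mul A

lemma integral_div_one_add_sq (A : ℝ) : ∫ ω : ℝ, A / (1 + ω ^ 2) = A * Real.pi := by
  simp only [div_eq_mul_inv]
  rw [integral_const_mul, integral_univ_inv_one_add_sq]

lemma integrable_of_abs_le_div {f : ℝ → ℝ} {A : ℝ} (hf : Measurable f)
    (h : ∀ ω, |f ω| ≤ A / (1 + ω ^ 2)) : Integrable f :=
  (integrable_div_one_add_sq A).mono' hf.aestronglyMeasurable (Eventually.of_forall h)

lemma integrable_mul_of_abs_le_div {f g : ℝ → ℝ} {A : ℝ} (hf : Measurable f) (hg : Measurable g)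
    (h : ∀ ω, |f ω| ≤ A / (1 + ω ^ 2)) (hg1 : ∀ ω, |g ω| ≤ 1) :
    Integrable fun ω => f ω * g ω :=
  integrable_of_abs_le_div (hf.mul hg) fun ω => abs_mul_le_of_abs_le_one (h ω) (hg1 ω)

lemma abs_integral_le_of_abs_le_div {f : ℝ → ℝ} {A : ℝ}
    (h : ∀ ω, |f ω| ≤ A / (1 + ω ^ 2)) : |∫ ω, f ω| ≤ A * Real.pi := by
  rw [← integral_div_one_add_sq]
  exact norm_integral_le_of_norm_le (f := f) (integrable_div_one_add_sq A) (Eventually.of_forall h)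

/-- Two derivatives in frequency buy quadratic decay in space; integrability removes the boundary
terms. The factor `2` adds the bounds for the transform itself and for `x²` times it. -/
lemma abs_integral_cos_le {q q' q'' : ℝ → ℝ} {A : ℝ} (hq : ∀ ω, HasDerivAt q (q' ω) ω)
    (hq' : ∀ ω, HasDerivAt q' (q'' ω) ω) (hq'' : Continuous q'')
    (b0 : ∀ ω, |q ω| ≤ A / (1 + ω ^ 2)) (b1 : ∀ ω, |q' ω| ≤ A / (1 + ω ^ 2))
    (b2 : ∀ ω, |q'' ω| ≤ A / (1 + ω ^ 2)) (x : ℝ) :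
    |∫ ω, q ω * Real.cos (x * ω)| ≤ 2 * A * Real.pi / (1 + x ^ 2) := by
  have hqc : Continuous q := continuous_iff_continuousAt.2 fun y => (hq y).continuousAt
  have hq'c : Continuous q' := continuous_iff_continuousAt.2 fun y => (hq' y).continuousAt
  have dlin : ∀ y, HasDerivAt (fun y => x * y) x y := fun y =>
    ((hasDerivAt_id' y).const_mul x).congr_deriv (mul_one x)
  have mc : Measurable fun ω : ℝ => Real.cos (x * ω) := by fun_prop
  have ms : Measurable fun ω : ℝ => Real.sin (x * ω) := by fun_prop
  have hc1 : ∀ ω, |Real.cos (x * ω)| ≤ 1 := fun ω => Real.abs_cos_le_one _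
  have hs1 : ∀ ω, |Real.sin (x * ω)| ≤ 1 := fun ω => Real.abs_sin_le_one _
  have i0c := integrable_mul_of_abs_le_div hqc.measurable mc b0 hc1
  have i0s := integrable_mul_of_abs_le_div hqc.measurable ms b0 hs1
  have i1s := integrable_mul_of_abs_le_div hq'c.measurable ms b1 hs1
  have i1c := integrable_mul_of_abs_le_div hq'c.measurable mc b1 hc1
  have i2c := integrable_mul_of_abs_le_div hq''.measurable mc b2 hc1
  have k1 := integral_mul_deriv_eq_deriv_mul_of_integrable (u := q) (u' := q')
    (v := fun ω => Real.sin (x * ω)) (v' := fun ω => Real.cos (x * ω) * x)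
    (fun ω _ => hq ω) (fun ω _ => (dlin ω).sin)
    ((i0c.mul_const x).congr (Eventually.of_forall fun ω => mul_assoc _ _ _)) i1s i0s
  have k2 := integral_mul_deriv_eq_deriv_mul_of_integrable (u := q') (u' := q'')
    (v := fun ω => Real.cos (x * ω)) (v' := fun ω => -Real.sin (x * ω) * x)
    (fun ω _ => hq' ω) (fun ω _ => (dlin ω).cos)
    ((i1s.mul_const (-x)).congr (Eventually.of_forall fun ω => by
      simp only [Pi.mul_apply]; ring)) i2c i1c
  have e1 : ∫ ω, q ω * (Real.cos (x * ω) * x) = x * ∫ ω, q ω * Real.cos (x * ω) := by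
    rw [← integral_const_mul]; congr 1; ext ω; ring
  have e2 : ∫ ω, q' ω * (-Real.sin (x * ω) * x) = -x * ∫ ω, q' ω * Real.sin (x * ω) := by
    rw [← integral_const_mul]; congr 1; ext ω; ring
  have e3 : x ^ 2 * ∫ ω, q ω * Real.cos (x * ω) = -∫ ω, q'' ω * Real.cos (x * ω) := by
    rw [← k2, e2]
    linear_combination x * k1 - x * e1
  have a0 := abs_integral_le_of_abs_le_div (f := fun ω => q ω * Real.cos (x * ω))
    fun ω => abs_mul_le_of_abs_le_one (b0 ω) (hc1 ω)
  have a2 := abs_integral_le_of_abs_le_div (f := fun ω => q'' ω * Real.cos (x * ω))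
    fun ω => abs_mul_le_of_abs_le_one (b2 ω) (hc1 ω)
  have a3 : x ^ 2 * |∫ ω, q ω * Real.cos (x * ω)| ≤ A * Real.pi := by
    rw [← abs_of_nonneg (sq_nonneg x), ← abs_mul, e3, abs_neg]
    exact a2
  rw [le_div_iff₀ (by positivity)]
  linarith

/-! ### The resolvent kernel -/

/-- The limit of `1 / nK` at infinity is subtracted, which is the Dirac part of the inverse; the
remainder is integrable. -/
noncomputable def qK (k ω : ℝ) : ℝ := 1 / nK k ω - 1 / symA k ^ 2

/-- The resolvent kernel: `(symA k ^ 2 δ₀ + ρ) * (symA k ^ (-2) δ₀ + sK) = δ₀`. -/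
noncomputable def sK (k x : ℝ) : ℝ := (2 * Real.pi)⁻¹ * ∫ ω, qK k ω * Real.cos (x * ω)

lemma hasDerivAt_nK (k ω : ℝ) :
    HasDerivAt (nK k) (-(2 * sinT (fun y => y * rhoK k y) ω)) ω := by
  refine (((hasDerivAt_cosT (continuous_rhoK k) ω).const_mul 2).const_add (symA k ^ 2)).congr_deriv ?_
  ring

section
variable {k N ν : ℝ}

lemma SymbolBounds.nonneg (h : SymbolBounds k N ν) : 0 ≤ N := by
  have := (abs_nonneg _).trans (h.cos0 0)
  simpa using this

lemma SymbolBounds.pos (h : SymbolBounds k N ν) (hν : 0 < ν) (ω : ℝ) : 0 < nK k ω :=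
  hν.trans_le (h.le ω)

lemma SymbolBounds.hasDerivAt_qK (h : SymbolBounds k N ν) (hν : 0 < ν) (ω : ℝ) :
    HasDerivAt (qK k) (2 * sinT (fun y => y * rhoK k y) ω / nK k ω ^ 2) ω := by
  have hn := (h.pos hν ω).ne'
  refine (((hasDerivAt_const ω (1 : ℝ)).fun_div (hasDerivAt_nK k ω) hn).sub_const
    (1 / symA k ^ 2)).congr_deriv ?_
  ring

lemma SymbolBounds.hasDerivAt_qK' (h : SymbolBounds k N ν) (hν : 0 < ν) (ω : ℝ) :
    HasDerivAt (fun ω => 2 * sinT (fun y => y * rhoK k y) ω / nK k ω ^ 2)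
      (2 * cosT (fun y => y * (y * rhoK k y)) ω / nK k ω ^ 2
        + 8 * sinT (fun y => y * rhoK k y) ω ^ 2 / nK k ω ^ 3) ω := by
  have hn := (h.pos hν ω).ne'
  have hc := continuous_rhoK k
  refine (((hasDerivAt_sinT (r := fun y => y * rhoK k y) (by fun_prop) ω).const_mul 2).fun_div
    ((hasDerivAt_nK k ω).fun_pow 2) (pow_ne_zero 2 hn)).congr_deriv ?_
  field_simp
  ring

lemma SymbolBounds.abs_qK_le (h : SymbolBounds k N ν) (hν : 0 < ν) {c : ℝ} (hc : 0 < c)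
    (hk : c ≤ symA k) (ω : ℝ) : |qK k ω| ≤ 2 * N / (ν * c ^ 2) / (1 + ω ^ 2) := by
  have hn := h.pos hν ω
  have hs : 0 < symA k := hc.trans_le hk
  have e : qK k ω = -(2 * cosT (rhoK k) ω) / (nK k ω * symA k ^ 2) := by
    have : nK k ω ≠ 0 := hn.ne'
    rw [qK]
    field_simp
    rw [nK]
    ring
  rw [e, abs_div, abs_neg, abs_mul, abs_two, abs_of_pos (mul_pos hn (pow_pos hs 2)),
    div_right_comm, ]
  have h1 := h.cos0 ω
  refine div_le_div₀ (div_nonneg (mul_nonneg zero_le_two h.nonneg) (by positivity)) ?_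
    (by positivity) (mul_le_mul (h.le ω) (pow_le_pow_left₀ hc.le hk 2) (by positivity) hn.le)
  rw [mul_div_assoc]
  linarith

lemma SymbolBounds.abs_qK'_le (h : SymbolBounds k N ν) (hν : 0 < ν) (ω : ℝ) :
    |2 * sinT (fun y => y * rhoK k y) ω / nK k ω ^ 2| ≤ 2 * N / ν ^ 2 / (1 + ω ^ 2) := by
  have hn := h.pos hν ω
  rw [abs_div, abs_of_pos (pow_pos hn 2), abs_mul, abs_two, div_right_comm]
  have h1 := h.sin1 ω
  refine div_le_div₀ (div_nonneg (mul_nonneg zero_le_two h.nonneg) (by positivity)) ?_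
    (by positivity) (pow_le_pow_left₀ hν.le (h.le ω) 2)
  rw [mul_div_assoc]
  linarith

lemma SymbolBounds.abs_qK''_le (h : SymbolBounds k N ν) (hν : 0 < ν) (ω : ℝ) :
    |2 * cosT (fun y => y * (y * rhoK k y)) ω / nK k ω ^ 2
      + 8 * sinT (fun y => y * rhoK k y) ω ^ 2 / nK k ω ^ 3|
      ≤ (2 * N / ν ^ 2 + 8 * N ^ 2 / ν ^ 3) / (1 + ω ^ 2) := by
  have hn := h.pos hν ω
  have hN := h.nonneg
  rw [add_div]
  refine (abs_add_le _ _).trans (add_le_add ?_ ?_)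
  · rw [abs_div, abs_of_pos (pow_pos hn 2), abs_mul, abs_two, div_right_comm]
    have h1 := h.cos2 ω
    refine div_le_div₀ (by positivity) ?_ (by positivity) (pow_le_pow_left₀ hν.le (h.le ω) 2)
    rw [mul_div_assoc]
    linarith
  · rw [abs_div, abs_of_pos (pow_pos hn 3), abs_of_nonneg (by positivity), div_right_comm]
    have h1 : sinT (fun y => y * rhoK k y) ω ^ 2 ≤ N ^ 2 / (1 + ω ^ 2) := by
      rw [← sq_abs]
      refine (pow_le_pow_left₀ (abs_nonneg _) (h.sin1 ω) 2).trans ?_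
      rw [div_pow]
      refine div_le_div_of_nonneg_left (by positivity) (by positivity) ?_
      nlinarith [sq_nonneg ω]
    refine div_le_div₀ (by positivity) ?_ (by positivity) (pow_le_pow_left₀ hν.le (h.le ω) 3)
    rw [mul_div_assoc]
    linarith

lemma SymbolBounds.continuous_qK (h : SymbolBounds k N ν) (hν : 0 < ν) : Continuous (qK k) :=
  continuous_iff_continuousAt.2 fun ω => (h.hasDerivAt_qK hν ω).continuousAt

/-- Uniform quadratic decay of the resolvent kernel. -/
lemma SymbolBounds.abs_sK_le (h : SymbolBounds k N ν) (hν : 0 < ν) {c : ℝ} (hc : 0 < c)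
    (hk : c ≤ symA k) (x : ℝ) :
    |sK k x| ≤ (2 * N / (ν * c ^ 2) + 2 * N / ν ^ 2 + 8 * N ^ 2 / ν ^ 3) / (1 + x ^ 2) := by
  have hN := h.nonneg
  have n1 : 0 ≤ 2 * N / (ν * c ^ 2) := by positivity
  have n2 : 0 ≤ 2 * N / ν ^ 2 := by positivity
  have n3 : 0 ≤ 8 * N ^ 2 / ν ^ 3 := by positivity
  set A := 2 * N / (ν * c ^ 2) + 2 * N / ν ^ 2 + 8 * N ^ 2 / ν ^ 3 with hA
  have hc0 := continuous_rhoK k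
  have hnc := continuous_nK k
  have c1 := continuous_cosT (r := fun y => y * (y * rhoK k y)) (by fun_prop)
  have c2 := continuous_sinT (r := fun y => y * rhoK k y) (by fun_prop)
  have mono : ∀ X ω : ℝ, X ≤ A → X / (1 + ω ^ 2) ≤ A / (1 + ω ^ 2) := fun X ω hX =>
    div_le_div_of_nonneg_right hX (by positivity)
  have key := abs_integral_cos_le (h.hasDerivAt_qK hν) (h.hasDerivAt_qK' hν)
    (by
      refine Continuous.add (Continuous.div (by fun_prop) (by fun_prop) fun ω => ?_)
        (Continuous.div (by fun_prop) (by fun_prop) fun ω => ?_)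
      · exact pow_ne_zero _ (h.pos hν ω).ne'
      · exact pow_ne_zero _ (h.pos hν ω).ne')
    (A := A)
    (fun ω => (h.abs_qK_le hν hc hk ω).trans (mono _ _ (by rw [hA]; linarith)))
    (fun ω => (h.abs_qK'_le hν ω).trans (mono _ _ (by rw [hA]; linarith)))
    (fun ω => (h.abs_qK''_le hν ω).trans (mono _ _ (by rw [hA]; linarith))) x
  rw [sK, abs_mul, abs_of_pos (by positivity)]
  refine (mul_le_mul_of_nonneg_left key (by positivity)).trans (le_of_eq ?_)
  have := Real.pi_pos.ne'
  field_simp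

lemma SymbolBounds.continuous_sK (h : SymbolBounds k N ν) (hν : 0 < ν) {c : ℝ} (hc : 0 < c)
    (hk : c ≤ symA k) : Continuous (sK k) := by
  have hq := h.continuous_qK hν
  refine continuous_const.mul (continuous_of_dominated (bound := fun ω => |qK k ω|)
    (fun x => Continuous.aestronglyMeasurable (by fun_prop))
    (fun x => Eventually.of_forall fun ω =>
      abs_mul_le_of_abs_le_one le_rfl (Real.abs_cos_le_one _))
    (integrable_of_abs_le_div hq.measurable (h.abs_qK_le hν hc hk)).abs
    (Eventually.of_forall fun ω => by fun_prop))

lemma sK_neg (k x : ℝ) : sK k (-x) = sK k x := by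
  simp [sK]

end

/-! ### Fourier inversion and the resolvent identity -/

/-- Exchanging an integral over the unit interval with one over the real line. -/
lemma integral_unit_swap {f : ℝ → ℝ → ℝ} {g : ℝ → ℝ} (hf : Measurable (Function.uncurry f))
    (hg : Integrable g) (hfg : ∀ y ∈ Icc (0 : ℝ) 1, ∀ z, |f y z| ≤ g z) :
    ∫ y in (0 : ℝ)..1, ∫ z, f y z = ∫ z, ∫ y in (0 : ℝ)..1, f y z := by
  simp only [intervalIntegral.integral_of_le zero_le_one]
  refine integral_integral_swap ?_
  have h1 : Integrable (fun p : ℝ × ℝ => g p.2) ((volume.restrict (Ioc (0 : ℝ) 1)).prod volume) :=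
    hg.comp_snd _
  refine h1.mono' hf.aestronglyMeasurable ?_
  have : (volume.restrict (Ioc (0 : ℝ) 1)).prod (volume : Measure ℝ)
      = (volume.prod volume).restrict (Ioc (0 : ℝ) 1 ×ˢ univ) := by
    rw [← Measure.prod_restrict, Measure.restrict_univ]
  rw [this]
  filter_upwards [ae_restrict_mem (measurableSet_Ioc.prod MeasurableSet.univ)] with p hp
  exact hfg p.1 ⟨hp.1.1.le, hp.1.2⟩ p.2

/-- Because `r 1 = 0`, truncation at `|z| = 1` creates no jump; in this form continuity is evident.
-/
lemma evenExt_eq_min {r : ℝ → ℝ} (h1 : r 1 = 0) (z : ℝ) : evenExt r z = r (min |z| 1) := by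
  unfold evenExt
  by_cases hz : z ∈ Icc (-1 : ℝ) 1
  · rw [indicator_of_mem hz, min_eq_left (abs_le.2 hz)]
  · rw [indicator_of_notMem hz, min_eq_right, h1]
    by_contra hlt
    exact hz (abs_le.1 (not_le.1 hlt).le)

lemma continuous_evenExt {r : ℝ → ℝ} (hr : Continuous r) (h1 : r 1 = 0) :
    Continuous (evenExt r) := by
  rw [funext (evenExt_eq_min h1)]
  fun_prop

lemma integrable_evenExt {r : ℝ → ℝ} (hr : Continuous r) : Integrable (evenExt r) := by
  unfold evenExt
  rw [integrable_indicator_iff measurableSet_Icc]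
  exact (hr.comp continuous_abs).continuousOn.integrableOn_Icc

lemma rhoK_one (k : ℝ) : rhoK k 1 = 0 := by simp [rhoK, uK]

lemma bddMeas_cos (ω : ℝ) : BddMeas fun x => Real.cos (ω * x) :=
  .of_continuous (by fun_prop) ⟨1, fun _ => Real.abs_cos_le_one _⟩

lemma bddMeas_sin (ω : ℝ) : BddMeas fun x => Real.sin (ω * x) :=
  .of_continuous (by fun_prop) ⟨1, fun _ => Real.abs_sin_le_one _⟩

open scoped FourierTransform in
lemma fourier_evenExt {r : ℝ → ℝ} (hr : Continuous r) (ξ : ℝ) :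
    𝓕 (fun x => (evenExt r x : ℂ)) ξ = ((2 * cosT r (2 * Real.pi * ξ) : ℝ) : ℂ) := by
  have hint := integrable_evenExt hr
  have ec : ∫ z, evenExt r z * Real.cos (2 * Real.pi * ξ * z) = 2 * cosT r (2 * Real.pi * ξ) := by
    have := integral_evenExt_mul hr (bddMeas_cos (2 * Real.pi * ξ)) 0
    rw [Cv_cos] at this
    simpa using this
  have es : ∫ z, evenExt r z * Real.sin (2 * Real.pi * ξ * z) = 0 := by
    have := integral_evenExt_mul hr (bddMeas_sin (2 * Real.pi * ξ)) 0
    rw [Cv_sin] at this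
    simpa [integral_neg] using this
  have ic : Integrable fun z => evenExt r z * Real.cos (2 * Real.pi * ξ * z) :=
    hint.mul_bdd (c := 1) (Continuous.aestronglyMeasurable (by fun_prop))
      (Eventually.of_forall fun _ => Real.abs_cos_le_one _)
  have is : Integrable fun z => evenExt r z * Real.sin (2 * Real.pi * ξ * z) :=
    hint.mul_bdd (c := 1) (Continuous.aestronglyMeasurable (by fun_prop))
      (Eventually.of_forall fun _ => Real.abs_sin_le_one _)
  rw [Real.fourier_real_eq_integral_exp_smul, ← ec]
  have e : ∀ v : ℝ, Complex.exp (((-2 * Real.pi * v * ξ : ℝ) : ℂ) * Complex.I) • (evenExt r v : ℂ)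
      = ((evenExt r v * Real.cos (2 * Real.pi * ξ * v) : ℝ) : ℂ)
        - ((evenExt r v * Real.sin (2 * Real.pi * ξ * v) : ℝ) : ℂ) * Complex.I := by
    intro v
    rw [Complex.exp_mul_I, ← Complex.ofReal_cos, ← Complex.ofReal_sin,
      show -2 * Real.pi * v * ξ = -(2 * Real.pi * ξ * v) by ring, Real.cos_neg, Real.sin_neg,
      smul_eq_mul]
    push_cast
    ring
  simp only [e]
  rw [integral_sub ic.ofReal (is.ofReal.mul_const _), integral_mul_const, integral_complex_ofReal,
    integral_complex_ofReal, es]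
  simp

/-- Fourier inversion for even kernels with integrable cosine transform. -/
lemma integral_cosT_mul_cos {r : ℝ → ℝ} (hr : Continuous r) (h1 : r 1 = 0) {N : ℝ}
    (hN : ∀ ω, |cosT r ω| ≤ N / (1 + ω ^ 2)) (x : ℝ) :
    (2 * Real.pi)⁻¹ * ∫ ω, 2 * cosT r ω * Real.cos (x * ω) = evenExt r x := by
  have hcc := continuous_cosT hr
  have hI : Integrable (cosT r) := integrable_of_abs_le_div hcc.measurable hN
  have hI2 : Integrable fun ξ => 2 * cosT r (2 * Real.pi * ξ) :=
    ((hI.comp_mul_left' (R := 2 * Real.pi) (by positivity))).const_mul 2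
  have hF : FourierTransform.fourier (fun x => (evenExt r x : ℂ))
      = fun ξ => ((2 * cosT r (2 * Real.pi * ξ) : ℝ) : ℂ) := funext (fourier_evenExt hr)
  have inv := congrFun (Continuous.fourierInv_fourier_eq
    (f := fun x => (evenExt r x : ℂ))
    (Complex.continuous_ofReal.comp (continuous_evenExt hr h1)) (integrable_evenExt hr).ofReal
    (by rw [hF]; exact hI2.ofReal)) x
  rw [hF, Real.fourierInv_eq'] at inv
  have e : ∀ v : ℝ, (Complex.exp (((2 * Real.pi * inner ℝ v x : ℝ) : ℂ) * Complex.I)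
      • ((2 * cosT r (2 * Real.pi * v) : ℝ) : ℂ)).re
      = 2 * cosT r (2 * Real.pi * v) * Real.cos (x * (2 * Real.pi * v)) := by
    intro v
    rw [smul_eq_mul, Complex.re_mul_ofReal, Complex.exp_ofReal_mul_I_re, RCLike.inner_apply, conj_trivial]
    ring_nf
  have hre := congrArg Complex.re inv
  have hint : Integrable fun v : ℝ => Complex.exp (((2 * Real.pi * inner ℝ v x : ℝ) : ℂ) * Complex.I)
      • ((2 * cosT r (2 * Real.pi * v) : ℝ) : ℂ) := by
    refine hI2.ofReal.bdd_mul (c := 1) (Continuous.aestronglyMeasurable (by fun_prop))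
      (Eventually.of_forall fun v => ?_)
    rw [Complex.norm_exp_ofReal_mul_I]
  have e2 := integral_re (𝕜 := ℂ) hint
  simp only [RCLike.re_eq_complex_re] at e2
  rw [← e2] at hre
  simp only [e, Complex.ofReal_re] at hre
  rw [← hre]
  have := Measure.integral_comp_mul_left (fun ω => 2 * cosT r ω * Real.cos (x * ω)) (2 * Real.pi)
  rw [this, abs_of_pos (by positivity), smul_eq_mul]

section
variable {k N ν c : ℝ}

/-- The resolvent identity. -/
lemma SymbolBounds.resolvent (h : SymbolBounds k N ν) (hν : 0 < ν) (hc : 0 < c)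
    (hk : c ≤ symA k) (x : ℝ) :
    symA k ^ 2 * sK k x + Cv (rhoK k) (sK k) x = -(1 / symA k ^ 2) * evenExt (rhoK k) x := by
  have hs : symA k ≠ 0 := (hc.trans_le hk).ne'
  have hrc := continuous_rhoK k
  have hcc := continuous_cosT hrc
  have hqc := h.continuous_qK hν
  have hq := integrable_of_abs_le_div hqc.measurable (h.abs_qK_le hν hc hk)
  have hqcos : ∀ t : ℝ, Integrable fun ω => qK k ω * Real.cos (t * ω) := fun t =>
    integrable_mul_of_abs_le_div hqc.measurable (by fun_prop) (h.abs_qK_le hν hc hk)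
      fun ω => Real.abs_cos_le_one _
  obtain ⟨a, ha⟩ := isCompact_Icc.exists_bound_of_continuousOn (s := Icc (0 : ℝ) 1) hrc.continuousOn
  have e1 : Cv (rhoK k) (sK k) x
      = (2 * Real.pi)⁻¹ * ∫ ω, qK k ω * (2 * cosT (rhoK k) ω) * Real.cos (x * ω) := by
    have s1 : ∀ y, rhoK k y * (sK k (x - y) + sK k (x + y))
        = (2 * Real.pi)⁻¹ * ∫ ω, rhoK k y * (qK k ω * (2 * Real.cos (x * ω) * Real.cos (y * ω))) := by
      intro y
      rw [sK, sK, ← mul_add, ← integral_add (hqcos _) (hqcos _), integral_const_mul]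
      rw [mul_left_comm]
      congr 3; ext ω
      rw [sub_mul, add_mul, Real.cos_sub, Real.cos_add]
      ring
    unfold Cv
    simp only [s1]
    rw [intervalIntegral.integral_const_mul, integral_unit_swap (g := fun ω => 2 * a * |qK k ω|)
      (Continuous.measurable (by fun_prop)) (hq.abs.const_mul _)]
    · congr 2; ext ω
      have s2 : ∀ y, rhoK k y * (qK k ω * (2 * Real.cos (x * ω) * Real.cos (y * ω)))
          = (qK k ω * 2 * Real.cos (x * ω)) * (rhoK k y * Real.cos (ω * y)) := by
        intro y; rw [mul_comm ω y]; ring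
      simp only [s2]
      rw [intervalIntegral.integral_const_mul, cosT]
      ring
    · intro y hy ω
      have b1 : |rhoK k y| ≤ a := ha y hy
      have b2 : |qK k ω * (2 * Real.cos (x * ω) * Real.cos (y * ω))| ≤ 2 * |qK k ω| := by
        have := abs_mul_le_of_abs_le_one (abs_mul_le_of_abs_le_one (le_refl |qK k ω * 2|)
          (Real.abs_cos_le_one (x * ω))) (Real.abs_cos_le_one (y * ω))
        rw [abs_mul _ (2 : ℝ), abs_two] at this
        calc _ = |qK k ω * 2 * Real.cos (x * ω) * Real.cos (y * ω)| := by ring_nf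
          _ ≤ _ := this
          _ = _ := by ring
      rw [abs_mul]
      calc _ ≤ a * (2 * |qK k ω|) := mul_le_mul b1 b2 (abs_nonneg _) ((abs_nonneg _).trans b1)
        _ = _ := by ring
  -- The resolvent identity on the Fourier side: insert that the transform of `ρ` is `nK - symA k ^
  -- 2`.
  have e2 : ∀ ω, qK k ω * (2 * cosT (rhoK k) ω) * Real.cos (x * ω)
      = -(1 / symA k ^ 2) * (2 * cosT (rhoK k) ω * Real.cos (x * ω))
        - symA k ^ 2 * (qK k ω * Real.cos (x * ω)) := by
    intro ω
    have hn : nK k ω ≠ 0 := (h.pos hν ω).ne'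
    have e3 : 2 * cosT (rhoK k) ω = nK k ω - symA k ^ 2 := by rw [nK]; ring
    rw [e3, qK]
    field_simp
    ring
  have hIc : Integrable fun ω => 2 * cosT (rhoK k) ω * Real.cos (x * ω) := by
    have := (integrable_mul_of_abs_le_div (g := fun ω => Real.cos (x * ω)) hcc.measurable
      (by fun_prop) h.cos0 fun ω => Real.abs_cos_le_one _).const_mul 2
    simpa only [mul_assoc] using this
  rw [e1, integral_congr_ae (Eventually.of_forall e2), integral_sub (hIc.const_mul _)
    ((hqcos x).const_mul _), integral_const_mul, integral_const_mul,
    ← integral_cosT_mul_cos hrc (rhoK_one k) h.cos0 x, sK]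
  ring

end

/-! ### Convolution with quadratically decaying kernels -/

/-- Even continuous convolution kernels with quadratic decay. -/
structure DecayKernel (s : ℝ → ℝ) (A : ℝ) : Prop where
  cont : Continuous s
  even : ∀ x, s (-x) = s x
  bound : ∀ x, |s x| ≤ A / (1 + x ^ 2)

noncomputable def conv (s F : ℝ → ℝ) (x : ℝ) : ℝ := ∫ z, s z * F (x - z)

section
variable {s F G : ℝ → ℝ} {A B : ℝ}

lemma DecayKernel.nonneg (hs : DecayKernel s A) : 0 ≤ A := by
  have := (abs_nonneg _).trans (hs.bound 0)
  simpa using this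

lemma DecayKernel.abs_mul_le (hs : DecayKernel s A) (hB : ∀ x, |F x| ≤ B) (z y : ℝ) :
    |s z * F y| ≤ A * B / (1 + z ^ 2) := by
  rw [abs_mul, mul_div_right_comm]
  exact mul_le_mul (hs.bound z) (hB y) (abs_nonneg _) (div_nonneg hs.nonneg (by positivity))

lemma DecayKernel.integrable (hs : DecayKernel s A) (hF : BddMeas F) (x : ℝ) :
    Integrable fun z => s z * F (x - z) := by
  obtain ⟨B, hB⟩ := hF.bdd
  exact integrable_of_abs_le_div (hs.cont.measurable.mul (hF.comp_sub_left x).meas)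
    fun z => hs.abs_mul_le hB z _

lemma DecayKernel.abs_conv_le (hs : DecayKernel s A) (hB : ∀ x, |F x| ≤ B) (x : ℝ) :
    |conv s F x| ≤ A * Real.pi * B := by
  have := abs_integral_le_of_abs_le_div (f := fun z => s z * F (x - z))
    fun z => hs.abs_mul_le hB z _
  rw [mul_right_comm]
  exact this

lemma conv_eq (s F : ℝ → ℝ) (x : ℝ) : conv s F x = ∫ z, s (x - z) * F z := by
  rw [conv, ← integral_sub_left_eq_self _ volume x]
  simp

lemma DecayKernel.conv_sub (hs : DecayKernel s A) (hF : BddMeas F) (hG : BddMeas G) (x : ℝ) :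
    conv s (fun x => F x - G x) x = conv s F x - conv s G x := by
  unfold conv
  rw [← integral_sub (hs.integrable hF x) (hs.integrable hG x)]
  congr 1; ext z; ring

lemma DecayKernel.conv_add (hs : DecayKernel s A) (hF : BddMeas F) (hG : BddMeas G) (x : ℝ) :
    conv s (fun x => F x + G x) x = conv s F x + conv s G x := by
  unfold conv
  rw [← integral_add (hs.integrable hF x) (hs.integrable hG x)]
  congr 1; ext z; ring

lemma conv_const_mul (s F : ℝ → ℝ) (a x : ℝ) :
    conv s (fun x => a * F x) x = a * conv s F x := by
  unfold conv
  rw [← integral_const_mul]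
  congr 1; ext z; ring

lemma DecayKernel.abs_conv_sub_le (hs : DecayKernel s A) (hF : BddMeas F) {L : ℝ}
    (hL : ∀ x y, |F x - F y| ≤ L * |x - y|) (x x' : ℝ) :
    |conv s F x - conv s F x'| ≤ A * Real.pi * L * |x - x'| := by
  have e : conv s F x - conv s F x' = conv s (fun z => F (z + (x - x')) - F z) x' := by
    rw [hs.conv_sub (hF.comp_add_right _) hF]
    congr 1
    unfold conv
    congr 1; ext y
    beta_reduce
    rw [show x' - y + (x - x') = x - y by ring]
  rw [e]
  have := hs.abs_conv_le (F := fun z => F (z + (x - x')) - F z) (B := L * |x - x'|)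
    (fun z => by
      have := hL (z + (x - x')) z
      rwa [show z + (x - x') - z = x - x' by ring] at this) x'
  calc _ ≤ _ := this
    _ = _ := by ring

lemma DecayKernel.bddMeas_conv (hs : DecayKernel s A) (hF : BddMeas F) : BddMeas (conv s F) := by
  constructor
  · have : Measurable fun p : ℝ × ℝ => s p.2 * F (p.1 - p.2) :=
      (hs.cont.measurable.comp measurable_snd).mul
        (hF.meas.comp (measurable_fst.sub measurable_snd))
    exact (this.stronglyMeasurable.integral_prod_right').measurable
  · obtain ⟨B, hB⟩ := hF.bdd
    exact ⟨_, hs.abs_conv_le hB⟩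

/-- The two readings of `r * (s * F)` have different uses. The commuted form here gives injectivity
of `symA k ^ 2 + ρ *`; the associated form in `DecayKernel.Cv_conv'` transfers the resolvent
identity from kernels to functions. -/
lemma DecayKernel.Cv_conv (hs : DecayKernel s A) {r : ℝ → ℝ} (hr : Continuous r) (hF : BddMeas F)
    (x : ℝ) : Cv r (conv s F) x = conv s (Cv r F) x := by
  obtain ⟨B, hB⟩ := hF.bdd
  obtain ⟨a, ha⟩ := isCompact_Icc.exists_bound_of_continuousOn (s := Icc (0 : ℝ) 1) hr.continuousOn
  have e1 : ∀ y, r y * (conv s F (x - y) + conv s F (x + y))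
      = ∫ z, s z * (r y * (F (x - z - y) + F (x - z + y))) := by
    intro y
    rw [conv, conv, ← integral_add (hs.integrable hF _) (hs.integrable hF _), ← integral_const_mul]
    congr 1; ext z
    rw [show x - y - z = x - z - y by ring, show x + y - z = x - z + y by ring]
    ring
  unfold Cv
  simp only [e1]
  rw [integral_unit_swap (g := fun z => A * (a * (B + B)) / (1 + z ^ 2)) ?_
    (integrable_div_one_add_sq _)]
  · unfold conv
    congr 1; ext z
    rw [intervalIntegral.integral_const_mul]
  · intro y hy z
    rw [abs_mul, mul_div_right_comm]
    refine mul_le_mul (hs.bound z) ?_ (abs_nonneg _) (div_nonneg hs.nonneg (by positivity))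
    rw [abs_mul]
    exact mul_le_mul (ha y hy) ((abs_add_le _ _).trans (add_le_add (hB _) (hB _)))
      (abs_nonneg _) ((abs_nonneg _).trans (ha y hy))
  · refine (hs.cont.measurable.comp measurable_snd).mul ((hr.measurable.comp measurable_fst).mul
      ((hF.meas.comp ?_).add (hF.meas.comp ?_))) <;> fun_prop

/-- Shifts by at most one preserve the quadratic weight up to a factor, which yields the integrable
majorant for the exchange of integrals in `DecayKernel.Cv_conv'`. -/
lemma inv_one_add_sq_shift_le {w w' : ℝ} (h : |w - w'| ≤ 1) :
    1 / (1 + w ^ 2) ≤ 3 / (1 + w' ^ 2) := by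
  rw [div_le_div_iff₀ (by positivity) (by positivity)]
  have := abs_le.1 h
  nlinarith [sq_nonneg (w - w'), sq_nonneg (2 * w - w'), sq_abs (w - w'), sq_nonneg (w + w')]

lemma DecayKernel.Cv_conv' (hs : DecayKernel s A) {r : ℝ → ℝ} (hr : Continuous r) (hF : BddMeas F)
    (x : ℝ) : Cv r (conv s F) x = conv (Cv r s) F x := by
  obtain ⟨B, hB⟩ := hF.bdd
  obtain ⟨a, ha⟩ := isCompact_Icc.exists_bound_of_continuousOn (s := Icc (0 : ℝ) 1) hr.continuousOn
  have hA := hs.nonneg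
  have int' : ∀ x, Integrable fun z => s (x - z) * F z := fun x => by
    have := (hs.integrable hF x).comp_sub_left x
    simpa using this
  have e1 : ∀ y, r y * (conv s F (x - y) + conv s F (x + y))
      = ∫ z, r y * (s (x - z - y) + s (x - z + y)) * F z := by
    intro y
    rw [conv_eq, conv_eq, ← integral_add (int' _) (int' _), ← integral_const_mul]
    congr 1; ext z
    rw [show x - y - z = x - z - y by ring, show x + y - z = x - z + y by ring]
    ring
  rw [conv_eq]
  unfold Cv
  simp only [e1]
  have ig : Integrable fun z => a * (6 * A) * B / (1 + (x - z) ^ 2) :=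
    (integrable_div_one_add_sq (a * (6 * A) * B)).comp_sub_left x
  rw [integral_unit_swap ?_ ig]
  · congr 1; ext z
    rw [intervalIntegral.integral_mul_const]
  · intro y hy z
    have hsh : ∀ w w' : ℝ, |w - w'| ≤ 1 → |s w| ≤ 3 * A / (1 + w' ^ 2) := by
      intro w w' hw
      refine (hs.bound w).trans ?_
      have := mul_le_mul_of_nonneg_left (inv_one_add_sq_shift_le hw) hA
      calc A / (1 + w ^ 2) = A * (1 / (1 + w ^ 2)) := by ring
        _ ≤ _ := this
        _ = _ := by ring
    have h1 := hsh (x - z - y) (x - z) (by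
      rw [show x - z - y - (x - z) = -y by ring, abs_neg, abs_of_nonneg hy.1]; exact hy.2)
    have h2 := hsh (x - z + y) (x - z) (by
      rw [show x - z + y - (x - z) = y by ring, abs_of_nonneg hy.1]; exact hy.2)
    have h3 : |s (x - z - y) + s (x - z + y)| ≤ 6 * A / (1 + (x - z) ^ 2) := by
      refine (abs_add_le _ _).trans ?_
      calc _ ≤ 3 * A / (1 + (x - z) ^ 2) + 3 * A / (1 + (x - z) ^ 2) := add_le_add h1 h2
        _ = _ := by ring
    have ha0 : 0 ≤ a := (norm_nonneg _).trans (ha y hy)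
    rw [abs_mul, abs_mul]
    calc |r y| * |s (x - z - y) + s (x - z + y)| * |F z|
        ≤ a * (6 * A / (1 + (x - z) ^ 2)) * B :=
          mul_le_mul (mul_le_mul (ha y hy) h3 (abs_nonneg _) ha0) (hB z) (abs_nonneg _)
            (by positivity)
      _ = _ := by ring
  · refine ((hr.measurable.comp measurable_fst).mul
      ((hs.cont.measurable.comp ?_).add (hs.cont.measurable.comp ?_))).mul
      (hF.meas.comp measurable_snd) <;> fun_prop

lemma DecayKernel.conv_cos (hs : DecayKernel s A) (k x : ℝ) :
    conv s (fun x => Real.cos (k * x)) x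
      = (∫ z, s z * Real.cos (k * z)) * Real.cos (k * x) := by
  have i1 : Integrable fun z => s z * Real.cos (k * z) := by
    have := hs.integrable (bddMeas_cos k) 0
    simpa using this
  have i2 : Integrable fun z => s z * Real.sin (k * z) := by
    have := (hs.integrable (bddMeas_sin k) 0).neg
    refine this.congr (Eventually.of_forall fun z => ?_)
    simp
  have h0 : ∫ z, s z * Real.sin (k * z) = 0 := by
    have := integral_neg_eq_self (fun z => s z * Real.sin (k * z)) volume
    simp only [hs.even, mul_neg, Real.sin_neg, integral_neg] at this
    linarith
  have e : ∀ z, s z * Real.cos (k * (x - z)) = s z * Real.cos (k * z) * Real.cos (k * x)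
      + s z * Real.sin (k * z) * Real.sin (k * x) := by
    intro z; rw [mul_sub, Real.cos_sub]; ring
  unfold conv
  simp only [e]
  rw [integral_add (i1.mul_const _) (i2.mul_const _), integral_mul_const, integral_mul_const, h0]
  ring

lemma DecayKernel.conv_sin (hs : DecayKernel s A) (k x : ℝ) :
    conv s (fun x => Real.sin (k * x)) x
      = (∫ z, s z * Real.cos (k * z)) * Real.sin (k * x) := by
  have i1 : Integrable fun z => s z * Real.cos (k * z) := by
    have := hs.integrable (bddMeas_cos k) 0
    simpa using this
  have i2 : Integrable fun z => s z * Real.sin (k * z) := by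
    have := (hs.integrable (bddMeas_sin k) 0).neg
    refine this.congr (Eventually.of_forall fun z => ?_)
    simp
  have h0 : ∫ z, s z * Real.sin (k * z) = 0 := by
    have := integral_neg_eq_self (fun z => s z * Real.sin (k * z)) volume
    simp only [hs.even, mul_neg, Real.sin_neg, integral_neg] at this
    linarith
  have e : ∀ z, s z * Real.sin (k * (x - z)) = s z * Real.cos (k * z) * Real.sin (k * x)
      - s z * Real.sin (k * z) * Real.cos (k * x) := by
    intro z; rw [mul_sub, Real.sin_sub]; ring
  unfold conv
  simp only [e]
  rw [integral_sub (i1.mul_const _) (i2.mul_const _), integral_mul_const, integral_mul_const, h0]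
  ring

/-- Convolution of a bounded function supported in a left half line decays on the right. -/
lemma DecayKernel.abs_conv_le_of_support (hs : DecayKernel s A) (hB : ∀ x, |F x| ≤ B) {b : ℝ}
    (hb : 0 ≤ b) (h0 : ∀ z, b < z → F z = 0) :
    ∃ C, ∀ x, 0 ≤ x → |conv s F x| ≤ C / (1 + x) := by
  have hA := hs.nonneg
  have hB0 : 0 ≤ B := (abs_nonneg _).trans (hB 0)
  refine ⟨A * B * (b + 2) + A * Real.pi * B * (b + 2), fun x hx => ?_⟩
  rcases le_or_gt x (b + 1) with h | h
  · refine (hs.abs_conv_le hB x).trans ?_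
    rw [le_div_iff₀ (by linarith)]
    have : 0 ≤ A * B * (b + 2) := by positivity
    have h2 : 0 ≤ A * Real.pi * B := by positivity
    nlinarith
  · have hxb : 1 < x - b := by linarith
    have e : (fun z => s z * F (x - z)) = (Ici (x - b)).indicator (fun z => s z * F (x - z)) := by
      ext z
      by_cases hz : z ∈ Ici (x - b)
      · rw [indicator_of_mem hz]
      · rw [indicator_of_notMem hz, h0 (x - z), mul_zero]
        rw [mem_Ici, not_le] at hz
        linarith
    have b1 : |conv s F x| ≤ A * B * (x - b)⁻¹ := by
      unfold conv
      rw [e, integral_indicator measurableSet_Ici, integral_Ici_eq_integral_Ioi]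
      refine (norm_integral_le_of_norm_le (f := fun z => s z * F (x - z)) (g := fun z => A * B / (1 + z ^ 2))
        (integrable_div_one_add_sq (A * B)).integrableOn
        (Eventually.of_forall fun z => hs.abs_mul_le hB z _)).trans ?_
      simp only [div_eq_mul_inv]
      rw [integral_const_mul, integral_Ioi_inv_one_add_sq]
      refine mul_le_mul_of_nonneg_left ?_ (by positivity)
      -- The tail integral of `1 / (1 + z²)` from `t` on is `arctan (1/t)`, at most `1/t`: quadratic
      -- decay of the kernel leaves first-order decay of the convolution.
      rw [← Real.arctan_inv_of_pos (by linarith)]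
      have hpos : 0 < (x - b)⁻¹ := by positivity
      have := Real.lt_tan (Real.arctan_pos.2 hpos) (Real.arctan_lt_pi_div_two _)
      rw [Real.tan_arctan] at this
      exact this.le
    refine b1.trans ?_
    rw [le_div_iff₀ (by linarith), mul_assoc, inv_mul_eq_div]
    have h3 : (1 + x) / (x - b) ≤ b + 2 := by
      rw [div_le_iff₀ (by linarith)]
      nlinarith
    have h4 : 0 ≤ A * Real.pi * B * (b + 2) := by positivity
    have h5 : A * B * ((1 + x) / (x - b)) ≤ A * B * (b + 2) :=
      mul_le_mul_of_nonneg_left h3 (by positivity)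
    linarith

lemma DecayKernel.conv_neg (hs : DecayKernel s A) (x : ℝ) :
    conv s (fun z => F (-z)) (-x) = conv s F x := by
  unfold conv
  rw [← integral_neg_eq_self]
  congr 1; ext z
  rw [hs.even]
  congr 2; ring_nf

lemma DecayKernel.abs_conv_le_of_support' (hs : DecayKernel s A) (hB : ∀ x, |F x| ≤ B) {b : ℝ}
    (hb : 0 ≤ b) (h0 : ∀ z, z < -b → F z = 0) :
    ∃ C, ∀ x, x ≤ 0 → |conv s F x| ≤ C / (1 - x) := by
  obtain ⟨C, hC⟩ := hs.abs_conv_le_of_support (F := fun z => F (-z)) (fun x => hB (-x)) hb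
    (fun z hz => h0 _ (by linarith))
  refine ⟨C, fun x hx => ?_⟩
  rw [← hs.conv_neg]
  exact hC (-x) (by linarith)

end

/-! ### Inverting `symA k ^ 2 + ρ *` -/

section
variable {k N ν c A : ℝ}

/-- The data needed to invert `F ↦ symA k ^ 2 F + ρ * F`. -/
structure HasResolvent (k A : ℝ) : Prop where
  kernel : DecayKernel (sK k) A
  symA_ne : symA k ≠ 0
  resolvent : ∀ x,
    symA k ^ 2 * sK k x + Cv (rhoK k) (sK k) x = -(1 / symA k ^ 2) * evenExt (rhoK k) x

lemma SymbolBounds.hasResolvent (h : SymbolBounds k N ν) (hν : 0 < ν) (hc : 0 < c)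
    (hk : c ≤ symA k) :
    HasResolvent k (2 * N / (ν * c ^ 2) + 2 * N / ν ^ 2 + 8 * N ^ 2 / ν ^ 3) :=
  ⟨⟨h.continuous_sK hν hc hk, sK_neg k, h.abs_sK_le hν hc hk⟩, (hc.trans_le hk).ne',
    h.resolvent hν hc hk⟩

lemma HasResolvent.conv_identity (h : HasResolvent k A) {F : ℝ → ℝ} (hF : BddMeas F) (x : ℝ) :
    symA k ^ 2 * conv (sK k) F x + Cv (rhoK k) (conv (sK k) F) x
      = -(1 / symA k ^ 2) * Cv (rhoK k) F x := by
  have hr := continuous_rhoK k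
  have i1 := (h.kernel.integrable hF x).const_mul (symA k ^ 2)
  have i2 : Integrable fun z => evenExt (rhoK k) z * F (x - z) := by
    obtain ⟨B, hB⟩ := hF.bdd
    exact (integrable_evenExt hr).mul_bdd (c := B) (hF.comp_sub_left x).meas.aestronglyMeasurable
      (Eventually.of_forall fun z => hB _)
  have e : ∀ z, Cv (rhoK k) (sK k) z * F (x - z)
      = -(1 / symA k ^ 2) * (evenExt (rhoK k) z * F (x - z))
        - symA k ^ 2 * (sK k z * F (x - z)) := by
    intro z
    linear_combination F (x - z) * h.resolvent z
  rw [h.kernel.Cv_conv' hr hF, conv, conv]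
  simp only [e]
  rw [integral_sub (i2.const_mul _) i1, integral_const_mul, integral_const_mul,
    integral_evenExt_mul hr hF]
  ring

/-- The solution of `symA k ^ 2 w + ρ * w = Q`. -/
noncomputable def resolve (k : ℝ) (Q : ℝ → ℝ) (x : ℝ) : ℝ := Q x / symA k ^ 2 + conv (sK k) Q x

lemma HasResolvent.resolve_eq (h : HasResolvent k A) {Q : ℝ → ℝ} (hQ : BddMeas Q) (x : ℝ) :
    symA k ^ 2 * resolve k Q x + Cv (rhoK k) (resolve k Q) x = Q x := by
  have hs := h.symA_ne
  have e : resolve k Q = fun x => 1 / symA k ^ 2 * Q x + conv (sK k) Q x := by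
    ext x; rw [resolve]; ring
  have i1 : ∀ a b, IntervalIntegrable (fun x => 1 / symA k ^ 2 * Q x) volume a b :=
    fun a b => (hQ.intervalIntegrable a b).const_mul _
  rw [e, Cv_add (continuous_rhoK k) i1 (h.kernel.bddMeas_conv hQ).intervalIntegrable,
    Cv_const_mul]
  have := h.conv_identity hQ x
  field_simp at this ⊢
  linarith

/-- By commutation `ρ * (s * F) = s * (ρ * F) = -symA k ^ 2 (s * F)`, so the left side of
`conv_identity` vanishes, while its right side is `F` itself. -/
lemma HasResolvent.eq_zero (h : HasResolvent k A) {F : ℝ → ℝ} (hF : BddMeas F)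
    (h0 : ∀ x, symA k ^ 2 * F x + Cv (rhoK k) F x = 0) (x : ℝ) : F x = 0 := by
  have hs := pow_ne_zero 2 h.symA_ne
  have e : Cv (rhoK k) F = fun x => -symA k ^ 2 * F x := by
    ext y; linarith [h0 y]
  have h1 := h.conv_identity hF x
  rw [h.kernel.Cv_conv (continuous_rhoK k) hF, e, conv_const_mul] at h1
  have h2 : -(1 / symA k ^ 2) * (-symA k ^ 2 * F x) = F x := by
    rw [← mul_assoc, neg_mul_neg, one_div_mul_cancel hs, one_mul]
  beta_reduce at h1
  linarith

end

/-! ### Sources supported near the origin -/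

/-- Bounded sources supported in `[-ε, ε]` that are continuous away from the origin. -/
structure IsSource (G : ℝ → ℝ) (ε B : ℝ) : Prop where
  pos : 0 < ε
  le_one : ε ≤ 1
  cont : ∀ x ≠ 0, ContinuousAt G x
  bound : ∀ x, |G x| ≤ B
  support : ∀ x, ε ≤ |x| → G x = 0

lemma abs_setIntegral_le_of_support {g : ℝ → ℝ} {ε B : ℝ} (hε : 0 ≤ ε)
    (hB : ∀ z, |g z| ≤ B) (h0 : ∀ z, ε ≤ |z| → g z = 0) (s : Set ℝ) :
    |∫ z in s, g z| ≤ 2 * ε * B := by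
  have hB0 : 0 ≤ B := (abs_nonneg _).trans (hB 0)
  have hi : Integrable ((Icc (-ε) ε).indicator fun _ : ℝ => B) :=
    (integrable_indicator_iff measurableSet_Icc).2 (integrableOn_const (by simp))
  have hle : ∀ z, |g z| ≤ (Icc (-ε) ε).indicator (fun _ => B) z := by
    intro z
    by_cases hz : z ∈ Icc (-ε) ε
    · rw [indicator_of_mem hz]; exact hB z
    · rw [indicator_of_notMem hz, h0 z, abs_zero]
      by_contra hlt
      exact hz (abs_le.1 (not_le.1 hlt).le)
  have h1 : |∫ z in s, g z| ≤ ∫ z in s, (Icc (-ε) ε).indicator (fun _ => B) z :=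
    norm_integral_le_of_norm_le (f := g) hi.integrableOn (Eventually.of_forall hle)
  have h2 : ∫ z in s, (Icc (-ε) ε).indicator (fun _ => B) z
      ≤ ∫ z, (Icc (-ε) ε).indicator (fun _ => B) z :=
    setIntegral_le_integral hi (Eventually.of_forall fun z => indicator_nonneg (fun _ _ => hB0) z)
  have h3 : ∫ z, (Icc (-ε) ε).indicator (fun _ => B) z = 2 * ε * B := by
    rw [integral_indicator measurableSet_Icc, setIntegral_const]
    simp only [Measure.real, Real.volume_Icc, smul_eq_mul]
    rw [ENNReal.toReal_ofReal (by linarith)]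
    ring
  linarith

section
variable {G : ℝ → ℝ} {ε B k : ℝ}

lemma IsSource.contOffZero (hG : IsSource G ε B) : ContOffZero G := ⟨hG.cont, B, hG.bound⟩

lemma IsSource.nonneg (hG : IsSource G ε B) : 0 ≤ B := (abs_nonneg _).trans (hG.bound 0)

lemma abs_intervalIntegral_le_of_support {g : ℝ → ℝ} (hε : 0 ≤ ε)
    (hB : ∀ z, |g z| ≤ B) (h0 : ∀ z, ε ≤ |z| → g z = 0) (a b : ℝ) :
    |∫ z in a..b, g z| ≤ 2 * ε * B := by
  rw [intervalIntegral.abs_intervalIntegral_eq]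
  exact abs_setIntegral_le_of_support hε hB h0 _

lemma abs_integral_le_of_support {g : ℝ → ℝ} (hε : 0 ≤ ε)
    (hB : ∀ z, |g z| ≤ B) (h0 : ∀ z, ε ≤ |z| → g z = 0) :
    |∫ z, g z| ≤ 2 * ε * B := by
  have := abs_setIntegral_le_of_support hε hB h0 univ
  rwa [setIntegral_univ] at this

lemma IsSource.integrable (hG : IsSource G ε B) : Integrable G := by
  have hi : IntegrableOn G (Icc (-1) 1) :=
    (intervalIntegrable_iff_integrableOn_Icc_of_le (by norm_num)).1
      (hG.contOffZero.bddMeas.intervalIntegrable (-1) 1)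
  refine hi.integrable_of_forall_notMem_eq_zero fun z hz => hG.support z ?_
  by_contra hlt
  exact hz (abs_le.1 ((not_le.1 hlt).le.trans hG.le_one))

lemma IsSource.mul {f : ℝ → ℝ} (hG : IsSource G ε B) (hf : Continuous f) {b : ℝ}
    (hb : ∀ z, |z| ≤ ε → |f z| ≤ b) : IsSource (fun z => f z * G z) ε (b * B) := by
  have hb0 : 0 ≤ b := (abs_nonneg _).trans (hb 0 (by simpa using hG.pos.le))
  refine ⟨hG.pos, hG.le_one, fun x hx => hf.continuousAt.mul (hG.cont x hx), fun x => ?_,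
    fun x hx => by rw [hG.support x hx, mul_zero]⟩
  rw [abs_mul]
  rcases le_or_gt |x| ε with h | h
  · exact mul_le_mul (hb x h) (hG.bound x) (abs_nonneg _) hb0
  · rw [hG.support x h.le, abs_zero, mul_zero]
    exact mul_nonneg hb0 hG.nonneg

lemma IsSource.interval_eq (hG : IsSource G ε B) : ∫ z in (-1 : ℝ)..1, G z = ∫ z, G z := by
  refine intervalIntegral.integral_eq_integral_of_support_subset fun z hz => ?_
  have : |z| < ε := by
    by_contra hlt
    exact hz (hG.support z (not_lt.1 hlt))
  have := abs_lt.1 (this.trans_le hG.le_one)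
  exact ⟨this.1, this.2.le⟩

lemma IsSource.interval_right (hG : IsSource G ε B) {x : ℝ} (hx : ε ≤ x) :
    ∫ z in x..1, G z = 0 := by
  rw [intervalIntegral.integral_congr (g := fun _ => 0), intervalIntegral.integral_zero]
  intro z hz
  have : ε ≤ z := (le_min hx hG.le_one).trans hz.1
  exact hG.support z (this.trans (le_abs_self z))

lemma IsSource.interval_left (hG : IsSource G ε B) {x : ℝ} (hx : x ≤ -ε) :
    ∫ z in x..1, G z = ∫ z, G z := by
  have hI := hG.contOffZero.bddMeas.intervalIntegrable
  rw [← hG.interval_eq, ← intervalIntegral.integral_add_adjacent_intervals (hI x (-1)) (hI (-1) 1),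
    intervalIntegral.integral_congr (g := fun _ => 0), intervalIntegral.integral_zero, zero_add]
  intro z hz
  have : z ≤ -ε := hz.2.trans (max_le hx (by linarith [hG.le_one]))
  exact hG.support z (by rw [le_abs]; right; linarith)

/-! ### The Helmholtz equation `P'' + k² P = G` -/

/-- The coefficients `helmC` and `helmS` come from variation of constants. The endpoint `1` stands
for `+∞`, because sources live in `[-ε, ε]` with `ε ≤ 1`. -/
noncomputable def helmC (k : ℝ) (G : ℝ → ℝ) (x : ℝ) : ℝ := ∫ z in x..1, Real.cos (k * z) * G z

noncomputable def helmS (k : ℝ) (G : ℝ → ℝ) (x : ℝ) : ℝ := ∫ z in x..1, Real.sin (k * z) * G z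

/-- The solution of `P'' + k² P = G` that vanishes for large arguments. -/
noncomputable def helm (k : ℝ) (G : ℝ → ℝ) (x : ℝ) : ℝ :=
  -(Real.sin (k * x) * helmC k G x - Real.cos (k * x) * helmS k G x) / k

noncomputable def helm' (k : ℝ) (G : ℝ → ℝ) (x : ℝ) : ℝ :=
  -(Real.cos (k * x) * helmC k G x + Real.sin (k * x) * helmS k G x)

lemma IsSource.cos (hG : IsSource G ε B) (k : ℝ) : IsSource (fun z => Real.cos (k * z) * G z) ε B := by
  simpa using hG.mul (f := fun z => Real.cos (k * z)) (by fun_prop) (b := 1)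
    fun z _ => Real.abs_cos_le_one _

lemma IsSource.sin (hG : IsSource G ε B) (k : ℝ) : IsSource (fun z => Real.sin (k * z) * G z) ε B := by
  simpa using hG.mul (f := fun z => Real.sin (k * z)) (by fun_prop) (b := 1)
    fun z _ => Real.abs_sin_le_one _

lemma IsSource.hasDerivAt_left (hG : IsSource G ε B) {x : ℝ} (hx : x ≠ 0) :
    HasDerivAt (fun x => ∫ z in x..1, G z) (-G x) x :=
  intervalIntegral.integral_hasDerivAt_left (hG.contOffZero.bddMeas.intervalIntegrable x 1)
    (hG.contOffZero.bddMeas.meas.stronglyMeasurable.stronglyMeasurableAtFilter) (hG.cont x hx)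

lemma IsSource.continuous_left (hG : IsSource G ε B) : Continuous fun x => ∫ z in x..1, G z := by
  have h := intervalIntegral.continuous_primitive
    (fun a b => hG.contOffZero.bddMeas.intervalIntegrable a b) 1
  simp only [intervalIntegral.integral_symm 1]
  exact (h.neg).congr fun x => by simp

lemma IsSource.continuous_helm (hG : IsSource G ε B) : Continuous (helm k G) := by
  have h1 : Continuous (helmC k G) := (hG.cos k).continuous_left
  have h2 : Continuous (helmS k G) := (hG.sin k).continuous_left
  unfold helm
  fun_prop

lemma IsSource.continuous_helm' (hG : IsSource G ε B) : Continuous (helm' k G) := by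
  have h1 : Continuous (helmC k G) := (hG.cos k).continuous_left
  have h2 : Continuous (helmS k G) := (hG.sin k).continuous_left
  unfold helm'
  fun_prop

lemma hasDerivAt_const_mul_id (k x : ℝ) : HasDerivAt (fun x => k * x) k x :=
  ((hasDerivAt_id' x).const_mul k).congr_deriv (mul_one k)

/-- At the origin `G` may jump, so the product rule is available only elsewhere. The derivative
extends to the origin because `helm` and `helm'` are continuous there. -/
lemma IsSource.hasDerivAt_helm (hG : IsSource G ε B) (hk : k ≠ 0) (x : ℝ) :
    HasDerivAt (helm k G) (helm' k G x) x := by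
  have off : ∀ x ≠ 0, HasDerivAt (helm k G) (helm' k G x) x := by
    intro x hx
    have dl := hasDerivAt_const_mul_id k x
    have d1 : HasDerivAt (helmC k G) _ x := (hG.cos k).hasDerivAt_left hx
    have d2 : HasDerivAt (helmS k G) _ x := (hG.sin k).hasDerivAt_left hx
    refine (((dl.sin.fun_mul d1).fun_sub (dl.cos.fun_mul d2)).fun_neg.div_const k).congr_deriv ?_
    unfold helm'
    field_simp
    ring
  by_cases hx : x = 0
  · subst hx
    exact hasDerivAt_of_hasDerivAt_of_ne (fun y hy => off y hy) hG.continuous_helm.continuousAt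
      hG.continuous_helm'.continuousAt
  · exact off x hx

lemma IsSource.hasDerivAt_helm' (hG : IsSource G ε B) {x : ℝ} (hx : x ≠ 0) :
    HasDerivAt (helm' k G) (G x - k ^ 2 * helm k G x) x := by
  have dl := hasDerivAt_const_mul_id k x
  have d1 : HasDerivAt (helmC k G) _ x := (hG.cos k).hasDerivAt_left hx
  have d2 : HasDerivAt (helmS k G) _ x := (hG.sin k).hasDerivAt_left hx
  refine ((dl.cos.fun_mul d1).fun_add (dl.sin.fun_mul d2)).fun_neg.congr_deriv ?_
  unfold helm
  field_simp
  linear_combination G x * Real.sin_sq_add_cos_sq (k * x)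

lemma IsSource.helm_right (hG : IsSource G ε B) {x : ℝ} (hx : ε ≤ x) : helm k G x = 0 := by
  simp [helm, helmC, helmS, (hG.cos k).interval_right hx, (hG.sin k).interval_right hx]

lemma IsSource.helm_left (hG : IsSource G ε B) {x : ℝ} (hx : x ≤ -ε) :
    helm k G x = -(Real.sin (k * x) * (∫ z, Real.cos (k * z) * G z)
      - Real.cos (k * x) * ∫ z, Real.sin (k * z) * G z) / k := by
  rw [helm, helmC, helmS, (hG.cos k).interval_left hx, (hG.sin k).interval_left hx]

lemma IsSource.abs_helm'_le (hG : IsSource G ε B) (x : ℝ) : |helm' k G x| ≤ 4 * ε * B := by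
  have h1 : |helmC k G x| ≤ 2 * ε * B :=
    abs_intervalIntegral_le_of_support hG.pos.le (hG.cos k).bound (hG.cos k).support _ _
  have h2 : |helmS k G x| ≤ 2 * ε * B :=
    abs_intervalIntegral_le_of_support hG.pos.le (hG.sin k).bound (hG.sin k).support _ _
  rw [helm', abs_neg]
  refine (abs_add_le _ _).trans ?_
  have h3 := abs_mul_le_of_abs_le_one h1 (Real.abs_cos_le_one (k * x))
  have h4 := abs_mul_le_of_abs_le_one h2 (Real.abs_sin_le_one (k * x))
  rw [mul_comm] at h3 h4
  linarith

lemma abs_sub_le_of_hasDerivAt {f f' : ℝ → ℝ} {L : ℝ} (h : ∀ x, HasDerivAt f (f' x) x)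
    (hL : ∀ x, |f' x| ≤ L) (x y : ℝ) : |f x - f y| ≤ L * |x - y| :=
  Convex.norm_image_sub_le_of_norm_hasDerivWithin_le (f := f) (f' := f') (s := univ)
    (fun z _ => (h z).hasDerivWithinAt) (fun z _ => hL z) convex_univ (mem_univ y) (mem_univ x)

lemma IsSource.abs_helm_sub_le (hG : IsSource G ε B) (hk : k ≠ 0) (x y : ℝ) :
    |helm k G x - helm k G y| ≤ 4 * ε * B * |x - y| :=
  abs_sub_le_of_hasDerivAt (hG.hasDerivAt_helm hk) hG.abs_helm'_le x y

/-- The origin of the scaling `|∫ G| + ε² B`. Left of the support the amplitudes are moments of `G`,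
where `cos (kz)` and `sin (kz)` differ from `1` and `0` by at most `kε`; on the support the
Lipschitz bound is integrated from the right edge, where `helm` vanishes. -/
lemma IsSource.abs_helm_le (hG : IsSource G ε B) (hk : 0 < k) (x : ℝ) :
    |helm k G x| ≤ |∫ z, G z| / k + 8 * ε ^ 2 * B := by
  have hε := hG.pos
  have hB := hG.nonneg
  have hJ : 0 ≤ |∫ z, G z| / k := by positivity
  have hεB : 0 ≤ ε ^ 2 * B := by positivity
  rcases le_or_gt ε x with h | h
  · rw [hG.helm_right h, abs_zero]
    linarith
  rcases le_or_gt x (-ε) with h' | h'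
  · have b1 : ∀ z, |z| ≤ ε → |Real.sin (k * z)| ≤ k * ε := fun z hz => by
      refine Real.abs_sin_le_abs.trans ?_
      rw [abs_mul, abs_of_pos hk]
      exact mul_le_mul_of_nonneg_left hz hk.le
    have b2 : ∀ z, |z| ≤ ε → |Real.cos (k * z) - 1| ≤ k * ε := fun z hz => by
      have h1 := Real.abs_cos_sub_cos_le (k * z) 0
      rw [Real.cos_zero, sub_zero] at h1
      refine h1.trans ?_
      rw [abs_mul, abs_of_pos hk]
      exact mul_le_mul_of_nonneg_left hz hk.le
    have s1 := hG.mul (by fun_prop) b1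
    have s2 := hG.mul (by fun_prop) b2
    have i1 := abs_integral_le_of_support hε.le s1.bound s1.support
    have i2 := abs_integral_le_of_support hε.le s2.bound s2.support
    have e : ∫ z, Real.cos (k * z) * G z = (∫ z, (Real.cos (k * z) - 1) * G z) + ∫ z, G z := by
      rw [← integral_add s2.integrable hG.integrable]
      congr 1; ext z; ring
    have i3 : |∫ z, Real.cos (k * z) * G z| ≤ 2 * ε * (k * ε * B) + |∫ z, G z| := by
      rw [e]
      exact (abs_add_le _ _).trans (by linarith)
    rw [hG.helm_left h', abs_div, abs_neg, abs_of_pos hk, div_le_iff₀ hk]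
    refine (abs_sub _ _).trans ?_
    have h3 := abs_mul_le_of_abs_le_one i3 (Real.abs_sin_le_one (k * x))
    have h4 := abs_mul_le_of_abs_le_one i1 (Real.abs_cos_le_one (k * x))
    rw [mul_comm] at h3 h4
    have e2 : (|∫ z, G z| / k + 8 * ε ^ 2 * B) * k = |∫ z, G z| + 8 * (k * (ε ^ 2 * B)) := by
      field_simp
    rw [e2]
    have : 0 ≤ k * (ε ^ 2 * B) := by positivity
    linarith
  · have h1 := hG.abs_helm_sub_le hk.ne' x ε
    rw [hG.helm_right le_rfl, sub_zero] at h1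
    have h2 : |x - ε| ≤ 2 * ε := by
      rw [abs_le]; constructor <;> linarith
    have h3 : 4 * ε * B * |x - ε| ≤ 4 * ε * B * (2 * ε) :=
      mul_le_mul_of_nonneg_left h2 (by positivity)
    linarith

lemma IsSource.bddMeas_helm (hG : IsSource G ε B) (hk : 0 < k) : BddMeas (helm k G) :=
  .of_continuous hG.continuous_helm ⟨_, hG.abs_helm_le hk⟩

/-! ### The tent kernel applied to a source -/

lemma evenExt_tent (z : ℝ) : evenExt (fun y => 1 - y) z = 1 - min |z| 1 := by
  rw [evenExt_eq_min (by simp)]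

lemma abs_evenExt_tent_sub_le (x y : ℝ) :
    |evenExt (fun y => 1 - y) x - evenExt (fun y => 1 - y) y| ≤ |x - y| := by
  rw [evenExt_tent, evenExt_tent, show 1 - min |x| 1 - (1 - min |y| 1) = min |y| 1 - min |x| 1 by ring]
  refine (abs_min_sub_min_le_max _ _ _ _).trans ?_
  rw [sub_self, abs_zero, max_eq_left (abs_nonneg _), abs_sub_comm x y]
  exact abs_abs_sub_abs_le_abs_sub y x

lemma abs_evenExt_tent_le (x : ℝ) : |evenExt (fun y => 1 - y) x| ≤ 1 := by
  rw [evenExt_tent, abs_le]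
  constructor <;> linarith [min_le_right |x| 1, le_min (abs_nonneg x) zero_le_one]

/-- The tent is 1-Lipschitz, so over the support it can be frozen at one value, at the cost of a
factor `ε`. -/
lemma IsSource.abs_Cv_tent_le (hG : IsSource G ε B) (x : ℝ) :
    |Cv (fun y => 1 - y) G x| ≤ |∫ z, G z| + 2 * ε ^ 2 * B := by
  have hcont := continuous_evenExt continuous_tent (by simp)
  have s1 := hG.mul (f := fun z => evenExt (fun y => 1 - y) (x - z) - evenExt (fun y => 1 - y) x)
    (by fun_prop) (b := ε) (fun z hz => by
      refine (abs_evenExt_tent_sub_le _ _).trans ?_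
      rwa [show x - z - x = -z by ring, abs_neg])
  have i1 := abs_integral_le_of_support hG.pos.le s1.bound s1.support
  have e : Cv (fun y => 1 - y) G x
      = (∫ z, (evenExt (fun y => 1 - y) (x - z) - evenExt (fun y => 1 - y) x) * G z)
        + evenExt (fun y => 1 - y) x * ∫ z, G z := by
    rw [← integral_evenExt_mul' continuous_tent hG.contOffZero.bddMeas, ← integral_const_mul,
      ← integral_add s1.integrable (hG.integrable.const_mul _)]
    congr 1; ext z; ring
  rw [e]
  refine (abs_add_le _ _).trans ?_
  have := abs_mul_le_of_abs_le_one (le_refl |∫ z, G z|) (abs_evenExt_tent_le x)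
  rw [mul_comm] at this
  linarith

lemma IsSource.abs_Cv_tent_sub_le (hG : IsSource G ε B) (x y : ℝ) :
    |Cv (fun y => 1 - y) G x - Cv (fun y => 1 - y) G y| ≤ 4 * ε * B * |x - y| := by
  have hbm := hG.contOffZero.bddMeas
  have hd := hasDerivAt_opA_opA hbm
  have e : ∀ x, Cv (fun y => 1 - y) G x = opA (opA G) x := fun x =>
    (opA_opA_eq_Cv hG.contOffZero x).symm
  rw [e, e]
  refine abs_sub_le_of_hasDerivAt hd (fun z => ?_) x y
  have h1 : ∀ w, |opA G w| ≤ 2 * ε * B := fun w =>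
    abs_intervalIntegral_le_of_support hG.pos.le hG.bound hG.support _ _
  refine (abs_sub _ _).trans ?_
  linarith [h1 (z + 1 / 2), h1 (z - 1 / 2)]

end

/-! ### Existence for the affine problem -/

/-- A bounded solution of `f'' = f` vanishes. -/
lemma eq_zero_of_bounded_of_deriv_deriv_eq {f v : ℝ → ℝ} {M : ℝ} (hM : ∀ x, |f x| ≤ M)
    (h1 : ∀ x, HasDerivAt f (v x) x) (h2 : ∀ x, HasDerivAt v (f x) x) (x : ℝ) : f x = 0 := by
  have dexp : ∀ x : ℝ, HasDerivAt (fun x => Real.exp (-x)) (-Real.exp (-x)) x := fun x =>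
    ((hasDerivAt_id' x).fun_neg.exp).congr_deriv (by ring)
  have c1 : ∀ x y, (v x + f x) * Real.exp (-x) = (v y + f y) * Real.exp (-y) :=
    is_const_of_deriv_eq_zero
      (f := fun x => (v x + f x) * Real.exp (-x))
      (fun x => (((h2 x).fun_add (h1 x)).fun_mul (dexp x)).differentiableAt)
      (fun x => ((((h2 x).fun_add (h1 x)).fun_mul (dexp x)).congr_deriv (by ring)).deriv)
  have c2 : ∀ x y, (v x - f x) * Real.exp x = (v y - f y) * Real.exp y :=
    is_const_of_deriv_eq_zero
      (f := fun x => (v x - f x) * Real.exp x)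
      (fun x => (((h2 x).fun_sub (h1 x)).fun_mul (Real.hasDerivAt_exp x)).differentiableAt)
      (fun x => ((((h2 x).fun_sub (h1 x)).fun_mul (Real.hasDerivAt_exp x)).congr_deriv
        (by ring)).deriv)
  set a := v 0 + f 0 with ha
  set b := v 0 - f 0 with hb
  have e1 : ∀ x, v x + f x = a * Real.exp x := fun x => by
    have := c1 x 0
    rw [neg_zero, Real.exp_zero, mul_one] at this
    rw [ha, ← this, mul_assoc, ← Real.exp_add, neg_add_cancel, Real.exp_zero, mul_one]
  have e2 : ∀ x, v x - f x = b * Real.exp (-x) := fun x => by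
    have := c2 x 0
    rw [Real.exp_zero, mul_one] at this
    rw [hb, ← this, mul_assoc, ← Real.exp_add, add_neg_cancel, Real.exp_zero, mul_one]
  have e3 : ∀ x, 2 * f x = a * Real.exp x - b * Real.exp (-x) := fun x => by
    rw [← e1, ← e2]; ring
  have hbig : ∀ a b : ℝ, (∀ x, 0 ≤ x → |a * Real.exp x - b * Real.exp (-x)| ≤ 2 * M) → a = 0 := by
    intro a b h
    by_contra hne
    have hp : 0 < |a| := abs_pos.2 hne
    obtain ⟨X, hX0, hX⟩ := ((eventually_ge_atTop (0 : ℝ)).and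
      (Real.tendsto_exp_atTop.eventually_gt_atTop ((2 * M + |b|) / |a|))).exists
    rw [div_lt_iff₀ hp] at hX
    have h3 := h X hX0
    have h4 := abs_sub_abs_le_abs_sub (a * Real.exp X) (b * Real.exp (-X))
    rw [abs_mul, abs_mul, Real.abs_exp, Real.abs_exp] at h4
    have h5 : |b| * Real.exp (-X) ≤ |b| :=
      mul_le_of_le_one_right (abs_nonneg b) (Real.exp_le_one_iff.2 (by linarith))
    linarith
  have ha0 : a = 0 := hbig a b fun x _ => by
    rw [← e3, abs_mul, abs_two]
    linarith [hM x]
  have hb0 : -b = 0 := hbig (-b) (-a) fun x _ => by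
    have := e3 (-x)
    rw [neg_neg] at this
    have e4 : -b * Real.exp x - -a * Real.exp (-x) = 2 * f (-x) := by rw [this]; ring
    rw [e4, abs_mul, abs_two]
    linarith [hM (-x)]
  have := e3 x
  rw [ha0, neg_eq_zero.1 hb0] at this
  linarith

section
variable {k A ε B : ℝ} {G : ℝ → ℝ}

/-- The right-hand side of the regularised equation. -/
noncomputable def rhsQ (k : ℝ) (G : ℝ → ℝ) (x : ℝ) : ℝ :=
  (1 + k ^ 2) * Cv (fun y => 1 - y) (helm k G) x - Cv (fun y => 1 - y) G x

/-- A solution of `A² S - symA k ^ 2 S = A² G` that tends to zero at `+∞`. -/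
noncomputable def solS (k : ℝ) (G : ℝ → ℝ) : ℝ → ℝ := resolve k (rhsQ k G)

lemma abs_tent_le : ∀ y ∈ Icc (0 : ℝ) 1, |1 - y| ≤ 1 := fun y hy => by
  rw [abs_le]; constructor <;> linarith [hy.1, hy.2]

lemma IsSource.abs_rhsQ_le (hG : IsSource G ε B) (hk : 0 < k) (x : ℝ) :
    |rhsQ k G x| ≤ (2 * (1 + k ^ 2) * (1 / k + 8) + 2) * (|∫ z, G z| + ε ^ 2 * B) := by
  have h1 := abs_Cv_le abs_tent_le (hG.abs_helm_le hk) x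
  have h2 := hG.abs_Cv_tent_le x
  have hJ := abs_nonneg (∫ z, G z)
  have hεB : 0 ≤ ε ^ 2 * B := mul_nonneg (sq_nonneg _) hG.nonneg
  have hk1 : 0 ≤ 1 / k := by positivity
  refine (abs_sub _ _).trans ?_
  rw [abs_mul, abs_of_pos (by positivity : (0:ℝ) < 1 + k ^ 2)]
  have h3 : |∫ z, G z| / k + 8 * ε ^ 2 * B ≤ (1 / k + 8) * (|∫ z, G z| + ε ^ 2 * B) := by
    have : |∫ z, G z| / k = 1 / k * |∫ z, G z| := by ring
    rw [this]
    nlinarith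
  have h4 : (1 + k ^ 2) * |Cv (fun y => 1 - y) (helm k G) x|
      ≤ (1 + k ^ 2) * (2 * ((1 / k + 8) * (|∫ z, G z| + ε ^ 2 * B))) :=
    mul_le_mul_of_nonneg_left (by linarith) (by positivity)
  linarith

lemma IsSource.abs_rhsQ_sub_le (hG : IsSource G ε B) (hk : 0 < k) (x y : ℝ) :
    |rhsQ k G x - rhsQ k G y| ≤ (8 * (1 + k ^ 2) + 4) * (ε * B) * |x - y| := by
  have h1 := abs_Cv_sub_le continuous_tent (hG.bddMeas_helm hk) abs_tent_le
    (hG.abs_helm_sub_le hk.ne') x y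
  have h2 := hG.abs_Cv_tent_sub_le x y
  have e : rhsQ k G x - rhsQ k G y
      = (1 + k ^ 2) * (Cv (fun y => 1 - y) (helm k G) x - Cv (fun y => 1 - y) (helm k G) y)
        - (Cv (fun y => 1 - y) G x - Cv (fun y => 1 - y) G y) := by
    unfold rhsQ; ring
  rw [e]
  refine (abs_sub _ _).trans ?_
  rw [abs_mul, abs_of_pos (by positivity : (0:ℝ) < 1 + k ^ 2)]
  have h4 := mul_le_mul_of_nonneg_left h1 (by positivity : (0:ℝ) ≤ 1 + k ^ 2)
  linarith

lemma IsSource.bddMeas_rhsQ (hG : IsSource G ε B) (hk : 0 < k) : BddMeas (rhsQ k G) :=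
  .of_continuous (continuous_of_abs_sub_le (hG.abs_rhsQ_sub_le hk)) ⟨_, hG.abs_rhsQ_le hk⟩

lemma HasResolvent.abs_resolve_le (h : HasResolvent k A) {Q : ℝ → ℝ} {M : ℝ}
    (hM : ∀ x, |Q x| ≤ M) (x : ℝ) : |resolve k Q x| ≤ (1 / symA k ^ 2 + A * Real.pi) * M := by
  have hs : 0 < symA k ^ 2 := by have := h.symA_ne; positivity
  refine (abs_add_le _ _).trans ?_
  rw [abs_div, abs_of_pos hs, add_mul, one_div_mul_eq_div]
  exact add_le_add (div_le_div_of_nonneg_right (hM x) hs.le) (h.kernel.abs_conv_le hM x)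

lemma HasResolvent.abs_resolve_sub_le (h : HasResolvent k A) {Q : ℝ → ℝ} {L : ℝ} (hQ : BddMeas Q)
    (hL : ∀ x y, |Q x - Q y| ≤ L * |x - y|) (x y : ℝ) :
    |resolve k Q x - resolve k Q y| ≤ (1 / symA k ^ 2 + A * Real.pi) * L * |x - y| := by
  have hs : 0 < symA k ^ 2 := by have := h.symA_ne; positivity
  have e : resolve k Q x - resolve k Q y
      = (Q x - Q y) / symA k ^ 2 + (conv (sK k) Q x - conv (sK k) Q y) := by
    unfold resolve; ring
  rw [e]
  refine (abs_add_le _ _).trans ?_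
  rw [abs_div, abs_of_pos hs, add_mul, add_mul, one_div_mul_eq_div, div_mul_eq_mul_div]
  exact add_le_add (div_le_div_of_nonneg_right (hL x y) hs.le) (h.kernel.abs_conv_sub_le hQ hL x y)

lemma HasResolvent.abs_solS_le (h : HasResolvent k A) (hG : IsSource G ε B) (hk : 0 < k) (x : ℝ) :
    |solS k G x| ≤ (1 / symA k ^ 2 + A * Real.pi) *
      ((2 * (1 + k ^ 2) * (1 / k + 8) + 2) * (|∫ z, G z| + ε ^ 2 * B)) :=
  h.abs_resolve_le (hG.abs_rhsQ_le hk) x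

lemma HasResolvent.abs_solS_sub_le (h : HasResolvent k A) (hG : IsSource G ε B) (hk : 0 < k)
    (x y : ℝ) : |solS k G x - solS k G y| ≤ (1 / symA k ^ 2 + A * Real.pi) *
      ((8 * (1 + k ^ 2) + 4) * (ε * B)) * |x - y| :=
  h.abs_resolve_sub_le (hG.bddMeas_rhsQ hk) (hG.abs_rhsQ_sub_le hk) x y

lemma HasResolvent.continuous_solS (h : HasResolvent k A) (hG : IsSource G ε B) (hk : 0 < k) :
    Continuous (solS k G) := continuous_of_abs_sub_le (h.abs_solS_sub_le hG hk)

lemma HasResolvent.bddMeas_solS (h : HasResolvent k A) (hG : IsSource G ε B) (hk : 0 < k) :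
    BddMeas (solS k G) := .of_continuous (h.continuous_solS hG hk) ⟨_, h.abs_solS_le hG hk⟩

/-- `solS` solves the affine equation with `η = 0`. -/
theorem HasResolvent.Cv_tent_solS (h : HasResolvent k A) (hG : IsSource G ε B) (hk : 0 < k)
    (x : ℝ) : Cv (fun y => 1 - y) (solS k G) x - symA k ^ 2 * solS k G x
      = Cv (fun y => 1 - y) G x := by
  have hS := h.bddMeas_solS hG hk
  have hSc := h.continuous_solS hG hk
  have hP := hG.bddMeas_helm hk
  -- The resolved equation says `(1 - ∂²) D = 0` for the defect `D` in `u * S = A² P`. As `D` is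
  -- bounded it vanishes, and `e1` then becomes the assertion.
  set D : ℝ → ℝ := fun x => Cv (uK k) (solS k G) x - Cv (fun y => 1 - y) (helm k G) x with hD
  have e1 : ∀ x, (1 + k ^ 2) * D x = Cv (fun y => 1 - y) (solS k G) x - symA k ^ 2 * solS k G x
      - Cv (fun y => 1 - y) G x := by
    intro x
    have h1 := h.resolve_eq (hG.bddMeas_rhsQ hk) x
    have h2 := Cv_rhoK (k := k) hS.intervalIntegrable x
    change symA k ^ 2 * solS k G x + Cv (rhoK k) (solS k G) x = _ at h1
    rw [h2, rhsQ] at h1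
    rw [hD]
    linear_combination h1
  obtain ⟨v, hv1, hv2⟩ := exists_hasDerivAt_Cv_uK hk.ne' hSc
  have hPo : (Cv fun y => 1 - y) (helm k G) = opA (opA (helm k G)) := by
    ext x
    exact (opA_opA_eq_Cv (.of_continuous hG.continuous_helm hP.bdd) x).symm
  have d1 : ∀ x, HasDerivAt (Cv (fun y => 1 - y) (helm k G))
      (opA (helm k G) (x + 1 / 2) - opA (helm k G) (x - 1 / 2)) x := fun x => by
    rw [hPo]; exact hasDerivAt_opA_opA hP x
  have d0 : ∀ x, HasDerivAt (opA (helm k G)) (helm k G (x + 1 / 2) - helm k G (x - 1 / 2)) x :=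
    fun x => hasDerivAt_opA hP hG.continuous_helm.continuousAt hG.continuous_helm.continuousAt
  have d2 : ∀ x, HasDerivAt (fun x => opA (helm k G) (x + 1 / 2) - opA (helm k G) (x - 1 / 2))
      (Cv (fun y => 1 - y) G x - k ^ 2 * Cv (fun y => 1 - y) (helm k G) x) x := by
    intro x
    have iP : ∀ a b, IntervalIntegrable (fun x => k ^ 2 * helm k G x) volume a b :=
      fun a b => (hP.intervalIntegrable a b).const_mul _
    have iG := hG.contOffZero.bddMeas.intervalIntegrable
    have h1 := Cv_tent_eq (H := fun x => G x - k ^ 2 * helm k G x) (hG.hasDerivAt_helm hk.ne')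
      hG.continuous_helm' (fun x hx => hG.hasDerivAt_helm' hx)
      (fun a b => (iG a b).sub (iP a b)) x
    rw [Cv_sub continuous_tent iG iP, Cv_const_mul] at h1
    rw [h1]
    refine (((d0 (x + 1 / 2)).comp_add_const x (1 / 2)).fun_sub
      ((d0 (x - 1 / 2)).comp_sub_const x (1 / 2))).congr_deriv ?_
    rw [show x + 1 / 2 + 1 / 2 = x + 1 by ring, show x - 1 / 2 - 1 / 2 = x - 1 by ring,
      show x + 1 / 2 - 1 / 2 = x by ring, show x - 1 / 2 + 1 / 2 = x by ring]
    ring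
  have hDb : ∃ M, ∀ x, |D x| ≤ M :=
    ((bddMeas_Cv (continuous_uK k) hS).sub (bddMeas_Cv continuous_tent hP)).bdd
  obtain ⟨M, hM⟩ := hDb
  have hz := eq_zero_of_bounded_of_deriv_deriv_eq hM (fun x => (hv1 x).fun_sub (d1 x))
    (fun x => ((hv2 x).fun_sub (d2 x)).congr_deriv (by
      rw [hD]
      have := e1 x
      rw [hD] at this
      linear_combination -this)) x
  have := e1 x
  rw [hz] at this
  linarith

/-- The solution has a limit on the right and a harmonic tail on the left. -/
theorem HasResolvent.solS_asymptotics (h : HasResolvent k A) (hG : IsSource G ε B) (hk : 0 < k) :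
    ∃ α β C : ℝ, (∀ x, 0 ≤ x → |solS k G x| ≤ C / (1 + x)) ∧
      ∀ x, x ≤ 0 → |solS k G x - α * Real.cos (k * x) - β * Real.sin (k * x)| ≤ C / (1 - x) := by
  have hs : 0 < symA k ^ 2 := by have := h.symA_ne; positivity
  have hQ := hG.bddMeas_rhsQ (k := k) hk
  -- The local part of the resolvent: where the right-hand side may be nonzero, `1 + t ≤ 3`.
  have loc : ∀ Q : ℝ → ℝ, ∀ M t x : ℝ, (∀ z, |Q z| ≤ M) → (2 < t → Q x = 0) → 0 ≤ t →
      |Q x / symA k ^ 2| ≤ 3 * M / symA k ^ 2 / (1 + t) := by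
    intro Q M t x hM h0 ht
    have hM0 : 0 ≤ M := (abs_nonneg _).trans (hM 0)
    rw [abs_div, abs_of_pos hs, div_right_comm]
    refine div_le_div_of_nonneg_right ?_ hs.le
    rw [le_div_iff₀ (by linarith)]
    rcases le_or_gt t 2 with h | h
    · nlinarith [hM x, abs_nonneg (Q x)]
    · rw [h0 h, abs_zero]; linarith
  -- the right tail
  have hQr : ∀ x, 2 < x → rhsQ k G x = 0 := by
    intro x hx
    have e1 : Cv (fun y => 1 - y) (helm k G) x = Cv (fun y => 1 - y) (fun _ => 0) x :=
      Cv_congr fun y hy => hG.helm_right (by linarith [hy.1, hG.le_one])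
    have e2 : Cv (fun y => 1 - y) G x = Cv (fun y => 1 - y) (fun _ => 0) x :=
      Cv_congr fun y hy => hG.support y (by
        rw [le_abs]; left; linarith [hy.1, hG.le_one])
    have e3 : Cv (fun y => 1 - y) (fun _ => 0) x = 0 := by simp [Cv]
    rw [rhsQ, e1, e2, e3]; ring
  obtain ⟨M, hM⟩ := hQ.bdd
  obtain ⟨C1, hC1⟩ := h.kernel.abs_conv_le_of_support hM zero_le_two hQr
  -- the left tail
  set p := (∫ z, Real.sin (k * z) * G z) / k with hp
  set q := -(∫ z, Real.cos (k * z) * G z) / k with hq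
  set a := (1 + k ^ 2) * symA k ^ 2 * p with ha
  set b := (1 + k ^ 2) * symA k ^ 2 * q with hb
  have hcs : BddMeas fun x => a * Real.cos (k * x) + b * Real.sin (k * x) :=
    ((BddMeas.const a).mul (bddMeas_cos k)).add ((BddMeas.const b).mul (bddMeas_sin k))
  have hQl : ∀ x, x < -2 → rhsQ k G x - (a * Real.cos (k * x) + b * Real.sin (k * x)) = 0 := by
    intro x hx
    have e1 : Cv (fun y => 1 - y) (helm k G) x
        = Cv (fun y => 1 - y) (fun x => p * Real.cos (k * x) + q * Real.sin (k * x)) x :=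
      Cv_congr fun y hy => by
        rw [hG.helm_left (by linarith [hy.2, hG.le_one]), hp, hq]
        ring
    have e2 : Cv (fun y => 1 - y) G x = Cv (fun y => 1 - y) (fun _ => 0) x :=
      Cv_congr fun y hy => hG.support y (by
        rw [le_abs]; right; linarith [hy.2, hG.le_one])
    have e3 : Cv (fun y => 1 - y) (fun _ => 0) x = 0 := by simp [Cv]
    rw [rhsQ, e1, e2, e3, Cv_add continuous_tent
      ((BddMeas.const p).mul (bddMeas_cos k)).intervalIntegrable
      ((BddMeas.const q).mul (bddMeas_sin k)).intervalIntegrable, Cv_const_mul, Cv_const_mul,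
      Cv_cos, Cv_sin, two_cosT_tent, ha, hb]
    ring
  have hQd := hQ.sub hcs
  obtain ⟨M', hM'⟩ := hQd.bdd
  obtain ⟨C2, hC2⟩ := h.kernel.abs_conv_le_of_support' hM' zero_le_two hQl
  -- The oscillation removed from `rhsQ` is an eigenfunction of convolution with the even kernel `sK
  -- k`, with eigenvalue `τ`.
  set τ := ∫ z, sK k z * Real.cos (k * z) with hτ
  set C := max (3 * M / symA k ^ 2 + C1) (3 * M' / symA k ^ 2 + C2) with hC
  refine ⟨a / symA k ^ 2 + τ * a, b / symA k ^ 2 + τ * b, C, fun x hx => ?_, fun x hx => ?_⟩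
  · refine (abs_add_le _ _).trans ?_
    have h1 := loc _ M x x hM (hQr x) hx
    have h2 := hC1 x hx
    have h3 : (3 * M / symA k ^ 2 + C1) / (1 + x) ≤ C / (1 + x) :=
      div_le_div_of_nonneg_right (le_max_left _ _) (by linarith)
    rw [add_div] at h3
    linarith
  · have e : solS k G x - (a / symA k ^ 2 + τ * a) * Real.cos (k * x)
        - (b / symA k ^ 2 + τ * b) * Real.sin (k * x)
        = (rhsQ k G x - (a * Real.cos (k * x) + b * Real.sin (k * x))) / symA k ^ 2
          + conv (sK k) (fun x => rhsQ k G x - (a * Real.cos (k * x) + b * Real.sin (k * x))) x := by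
      rw [h.kernel.conv_sub hQ hcs, h.kernel.conv_add ((BddMeas.const a).mul (bddMeas_cos k))
        ((BddMeas.const b).mul (bddMeas_sin k)), conv_const_mul, conv_const_mul,
        h.kernel.conv_cos, h.kernel.conv_sin, solS, resolve, ← hτ]
      ring
    rw [e]
    refine (abs_add_le _ _).trans ?_
    have h1 := loc _ M' (-x) x hM' (fun ht => hQl x (by linarith)) (by linarith)
    have h2 := hC2 x hx
    rw [← sub_eq_add_neg] at h1
    have h3 : (3 * M' / symA k ^ 2 + C2) / (1 - x) ≤ C / (1 - x) :=
      div_le_div_of_nonneg_right (le_max_right _ _) (by linarith)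
    rw [add_div] at h3
    linarith

end

/-! ### Uniqueness for the affine problem -/

/-- A solution of the harmonic oscillator equation that vanishes at `+∞` is zero. -/
lemma eq_zero_of_harmonic_of_tendsto {k : ℝ} (hk : 0 < k) {v w : ℝ → ℝ}
    (h1 : ∀ x, HasDerivAt v (w x) x) (h2 : ∀ x, HasDerivAt w (-k ^ 2 * v x) x)
    (h0 : Tendsto v atTop (𝓝 0)) (x : ℝ) : v x = 0 := by
  have dl := hasDerivAt_const_mul_id k
  -- `c1` and `c2` are the conserved amplitudes of the oscillation. They make `v` periodic, and a
  -- periodic function that tends to zero is zero.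
  have c1 : ∀ x y, v x * Real.cos (k * x) - w x / k * Real.sin (k * x)
      = v y * Real.cos (k * y) - w y / k * Real.sin (k * y) :=
    is_const_of_deriv_eq_zero
      (f := fun x => v x * Real.cos (k * x) - w x / k * Real.sin (k * x))
      (fun x => (((h1 x).fun_mul (dl x).cos).fun_sub
        (((h2 x).div_const k).fun_mul (dl x).sin)).differentiableAt)
      (fun x => ((((h1 x).fun_mul (dl x).cos).fun_sub
        (((h2 x).div_const k).fun_mul (dl x).sin)).congr_deriv (by field_simp; ring)).deriv)
  have c2 : ∀ x y, v x * Real.sin (k * x) + w x / k * Real.cos (k * x)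
      = v y * Real.sin (k * y) + w y / k * Real.cos (k * y) :=
    is_const_of_deriv_eq_zero
      (f := fun x => v x * Real.sin (k * x) + w x / k * Real.cos (k * x))
      (fun x => (((h1 x).fun_mul (dl x).sin).fun_add
        (((h2 x).div_const k).fun_mul (dl x).cos)).differentiableAt)
      (fun x => ((((h1 x).fun_mul (dl x).sin).fun_add
        (((h2 x).div_const k).fun_mul (dl x).cos)).congr_deriv (by field_simp; ring)).deriv)
  have per : ∀ x, v (x + 2 * Real.pi / k) = v x := by
    intro x
    have hv : ∀ y, v y = (v x * Real.cos (k * x) - w x / k * Real.sin (k * x)) * Real.cos (k * y)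
        + (v x * Real.sin (k * x) + w x / k * Real.cos (k * x)) * Real.sin (k * y) := by
      intro y
      rw [c1 x y, c2 x y]
      linear_combination -v y * Real.sin_sq_add_cos_sq (k * y)
    rw [hv (x + 2 * Real.pi / k)]
    have e : k * (x + 2 * Real.pi / k) = k * x + 2 * Real.pi := by field_simp
    rw [e, Real.cos_add_two_pi, Real.sin_add_two_pi, ← hv x]
  have pern : ∀ n : ℕ, v (x + n * (2 * Real.pi / k)) = v x := by
    intro n
    induction n with
    | zero => simp
    | succ n ih =>
      rw [← ih, ← per (x + n * (2 * Real.pi / k))]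
      congr 1
      push_cast
      ring
  have hlim : Tendsto (fun n : ℕ => v (x + n * (2 * Real.pi / k))) atTop (𝓝 0) :=
    h0.comp (tendsto_atTop_add_const_left _ _
      (tendsto_natCast_atTop_atTop.atTop_mul_const (by positivity)))
  simp only [pern] at hlim
  exact tendsto_nhds_unique tendsto_const_nhds hlim

lemma tendsto_Cv_zero {r F : ℝ → ℝ} (hr : Continuous r) (hF : Tendsto F atTop (𝓝 0)) :
    Tendsto (Cv r F) atTop (𝓝 0) := by
  obtain ⟨a, ha⟩ := isCompact_Icc.exists_bound_of_continuousOn (s := Icc (0 : ℝ) 1) hr.continuousOn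
  have ha0 : 0 ≤ a := (norm_nonneg _).trans (ha 0 (by simp))
  rw [Metric.tendsto_atTop] at hF ⊢
  intro e he
  obtain ⟨X, hX⟩ := hF (e / (2 * a + 1)) (by positivity)
  refine ⟨X + 1, fun x hx => ?_⟩
  have e1 : Cv r F x = Cv r ((Ici X).indicator F) x := Cv_congr fun y hy => by
    rw [indicator_of_mem]
    exact (by linarith [hy.1] : X ≤ y)
  have h1 := abs_Cv_le (r := r) (F := (Ici X).indicator F) (B := e / (2 * a + 1)) ha (fun y => by
    by_cases hy : y ∈ Ici X
    · rw [indicator_of_mem hy]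
      have := (hX y hy).le
      rwa [Real.dist_eq, sub_zero] at this
    · rw [indicator_of_notMem hy, abs_zero]; positivity) x
  rw [Real.dist_eq, sub_zero, e1]
  refine h1.trans_lt ?_
  rw [← mul_div_assoc, div_lt_iff₀ (by positivity)]
  linarith

lemma MemX.continuous {S : ℝ → ℝ} (h : MemX S) : Continuous S := h.memW2inf.differentiable.continuous

lemma MemX.bddMeas {S : ℝ → ℝ} (h : MemX S) : BddMeas S :=
  .of_continuous h.continuous h.memW2inf.bounded

/-- Uniqueness of solutions in `X × ℝ`. -/
theorem HasResolvent.affine_unique {k A : ℝ} (h : HasResolvent k A) (hk : 0 < k)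
    {G : ℝ → ℝ} {p q : (ℝ → ℝ) × ℝ}
    (hp : IsAffineSolution (symA k) G p) (hq : IsAffineSolution (symA k) G q) : p = q := by
  obtain ⟨hp1, hp2⟩ := hp
  obtain ⟨hq1, hq2⟩ := hq
  obtain ⟨σ, hσ⟩ := hp1.tendsto
  obtain ⟨σ', hσ'⟩ := hq1.tendsto
  -- Subtracting the limit makes the difference tend to zero. It changes the right-hand side only by
  -- a constant, since `M 1 = 1 - symA k ^ 2`; `he0` shows that the resulting constant is zero by
  -- letting `x → ∞`.
  set L := σ - σ' with hL
  set F : ℝ → ℝ := fun x => p.1 x - q.1 x - L with hF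
  have hpq := hp1.bddMeas.sub hq1.bddMeas
  have hFm : BddMeas F := hpq.sub (.const L)
  have hFc : Continuous F := (hp1.continuous.sub hq1.continuous).sub continuous_const
  have hF0 : Tendsto F atTop (𝓝 0) := by
    have := (hσ.sub hσ').sub_const L
    rwa [hL, sub_self] at this
  set e := p.2 - q.2 - (1 - symA k ^ 2) * L with he
  have hMF : ∀ x, Cv (fun y => 1 - y) F x - symA k ^ 2 * F x = e := by
    intro x
    have h1 := hp2 x
    have h2 := hq2 x
    rw [opM] at h1 h2
    have e1 : Cv (fun y => 1 - y) F x = opA (opA p.1) x - opA (opA q.1) x - L := by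
      rw [← opA_opA_eq_Cv (.of_continuous hFc hFm.bdd), hF, opA_sub hpq (.const L), opA_const,
        opA_sub hp1.bddMeas hq1.bddMeas, opA_sub
        ((bddMeas_opA hp1.bddMeas).sub (bddMeas_opA hq1.bddMeas)) (.const L), opA_const,
        opA_sub (bddMeas_opA hp1.bddMeas) (bddMeas_opA hq1.bddMeas)]
    rw [e1, hF, he]
    linear_combination h1 - h2
  have he0 : e = 0 := by
    have h1 := (tendsto_Cv_zero continuous_tent hF0).sub (hF0.const_mul (symA k ^ 2))
    simp only [hMF, mul_zero, sub_zero] at h1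
    exact tendsto_nhds_unique tendsto_const_nhds h1
  obtain ⟨v, hv1, hv2⟩ := exists_hasDerivAt_Cv_uK hk.ne' hFc
  -- `(∂² + k²)(u * F) = M F = 0`, and `u * F` inherits from `F` the limit zero at `+∞`.
  have hu : ∀ x, Cv (uK k) F x = 0 := eq_zero_of_harmonic_of_tendsto hk hv1
    (fun x => (hv2 x).congr_deriv (by rw [hMF, he0]; ring))
    (tendsto_Cv_zero (continuous_uK k) hF0)
  have hFz : ∀ x, F x = 0 := h.eq_zero hFm fun x => by
    rw [Cv_rhoK hFm.intervalIntegrable, hu]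
    linarith [hMF x]
  have hL0 : L = 0 := by
    have := hFz 0
    rw [hF] at this
    simp only [hp1.map_zero, hq1.map_zero] at this
    linarith
  refine Prod.ext (funext fun x => ?_) ?_
  · have := hFz x
    rw [hF] at this
    simp only at this
    linarith
  · rw [he, hL0] at he0
    linarith

/-! ### The linear theory with uniform constants -/

/-- A priori bounds and asymptotics for a solution of the affine problem. -/
structure SolutionBounds (k Λ ε B J : ℝ) (S : ℝ → ℝ) : Prop where
  abs_le : ∀ x, |S x| ≤ Λ * (J + ε ^ 2 * B)
  abs_deriv_le : ∀ x, |deriv S x| ≤ Λ * (ε * B)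
  abs_deriv_sub_le : ∀ x y, |deriv S x - deriv S y| ≤ Λ * B * |x - y|
  asymptotics : ∃ l α β C : ℝ, (∀ x, 0 ≤ x → |S x - l| ≤ C / (1 + x)) ∧
      ∀ x, x ≤ 0 → |S x - l - α * Real.cos (k * x) - β * Real.sin (k * x)| ≤ C / (1 - x)

lemma tendsto_zero_of_abs_le_div {f : ℝ → ℝ} {C : ℝ} (h : ∀ x, 0 ≤ x → |f x| ≤ C / (1 + x)) :
    Tendsto f atTop (𝓝 0) := by
  refine squeeze_zero_norm' (a := fun x => C / (1 + x)) ?_ ?_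
  · filter_upwards [eventually_ge_atTop 0] with x hx using h x hx
  · exact tendsto_const_nhds.div_atTop (tendsto_atTop_add_const_left _ _ tendsto_id)

lemma tendsto_zero_of_abs_le_div' {f : ℝ → ℝ} {C : ℝ} (h : ∀ x, x ≤ 0 → |f x| ≤ C / (1 - x)) :
    Tendsto f atBot (𝓝 0) := by
  have : Tendsto (fun x => f (-x)) atTop (𝓝 0) :=
    tendsto_zero_of_abs_le_div (C := C) fun x hx => by
      have := h (-x) (by linarith)
      rwa [sub_neg_eq_add] at this
  have h2 := this.comp tendsto_neg_atBot_atTop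
  refine h2.congr fun x => ?_
  simp

lemma lipschitzWith_of_abs_sub_le {f : ℝ → ℝ} {K : ℝ} (h : ∀ x y, |f x - f y| ≤ K * |x - y|) :
    LipschitzWith K.toNNReal f := by
  have hK : 0 ≤ K := by
    have := (abs_nonneg _).trans (h 1 0)
    simpa using this
  refine LipschitzWith.of_dist_le_mul fun x y => ?_
  rw [Real.dist_eq, Real.dist_eq, Real.coe_toNNReal _ hK]
  exact h x y

lemma abs_deriv_le_of_abs_sub_le {f : ℝ → ℝ} {K : ℝ} (h : ∀ x y, |f x - f y| ≤ K * |x - y|)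
    (x : ℝ) : |deriv f x| ≤ K := by
  have hK : 0 ≤ K := by
    have := (abs_nonneg _).trans (h 1 0)
    simpa using this
  have := norm_deriv_le_of_lipschitz (x₀ := x) (lipschitzWith_of_abs_sub_le h)
  rwa [Real.coe_toNNReal _ hK] at this

/-- Existence with explicit bounds for a single wave number. -/
theorem HasResolvent.exists_affine {k A Λ c₀ ε B : ℝ} (h : HasResolvent k A) (hk : 0 < k)
    (hc₀ : 0 < c₀) (hck : c₀ ≤ symA k)
    (hΛ1 : (1 / symA k ^ 2 + A * Real.pi) * (2 * (1 + k ^ 2) * (1 / k + 8) + 2) ≤ Λ)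
    (hΛ2 : (1 / symA k ^ 2 + A * Real.pi) * (8 * (1 + k ^ 2) + 4) ≤ Λ) {G : ℝ → ℝ}
    (hG : IsSource G ε B) :
    ∃ S η, IsAffineSolution (symA k) G (S, η) ∧
      SolutionBounds k (2 * Λ + 4 / c₀ ^ 2 * (3 * Λ + 1)) ε B |∫ z, G z| S := by
  have hA := h.kernel.nonneg
  have hs : 0 < symA k := hc₀.trans_le hck
  have hΛ : 0 ≤ Λ := le_trans (by positivity) hΛ2
  have hB := hG.nonneg
  have hε := hG.pos
  set J := |∫ z, G z| with hJ
  have hJ0 : 0 ≤ J := abs_nonneg _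
  have hJB : J ≤ 2 * ε * B := abs_integral_le_of_support hε.le hG.bound hG.support
  have hεB : 0 ≤ ε ^ 2 * B := by positivity
  have hεB1 : ε * B ≤ B := mul_le_of_le_one_left hB hG.le_one
  have hεB2 : ε ^ 2 * B ≤ B := mul_le_of_le_one_left hB (pow_le_one₀ hε.le hG.le_one)
  set S₀ := solS k G with hS₀
  have b0 : ∀ x, |S₀ x| ≤ Λ * (J + ε ^ 2 * B) := fun x => by
    refine (h.abs_solS_le hG hk x).trans ?_
    rw [← mul_assoc]
    exact mul_le_mul_of_nonneg_right hΛ1 (by positivity)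
  have b1 : ∀ x y, |S₀ x - S₀ y| ≤ Λ * (ε * B) * |x - y| := fun x y => by
    refine (h.abs_solS_sub_le hG hk x y).trans ?_
    rw [← mul_assoc]
    exact mul_le_mul_of_nonneg_right (mul_le_mul_of_nonneg_right hΛ2 (by positivity))
      (abs_nonneg _)
  have hSm := h.bddMeas_solS hG hk
  have hSc := h.continuous_solS hG hk
  have hGm := hG.contOffZero.bddMeas
  -- The equation reads `symA k ^ 2 S₀ = A² H`, so two derivatives can be taken from the averagings.
  -- The constant `3 Λ + 1` uses `|∫ G| ≤ 2 B` and `ε² B ≤ B`.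
  set H : ℝ → ℝ := fun x => S₀ x - G x with hH
  have hHm : BddMeas H := hSm.sub hGm
  have bH : ∀ x, |H x| ≤ (3 * Λ + 1) * B := fun x => by
    refine (abs_sub _ _).trans ?_
    have h1 : Λ * (J + ε ^ 2 * B) ≤ Λ * (3 * B) :=
      mul_le_mul_of_nonneg_left (by linarith) hΛ
    linarith [b0 x, hG.bound x]
  set S : ℝ → ℝ := fun x => S₀ x - S₀ 0 with hS
  have eqA : ∀ x, symA k ^ 2 * S₀ x = opA (opA H) x := by
    intro x
    have h1 := h.Cv_tent_solS hG hk x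
    rw [hH, opA_sub hSm hGm, opA_sub (bddMeas_opA hSm) (bddMeas_opA hGm)]
    beta_reduce
    rw [opA_opA_eq_Cv hG.contOffZero, opA_opA_eq_Cv (.of_continuous hSc hSm.bdd)]
    linarith
  have dS : ∀ x, HasDerivAt S
      (1 / symA k ^ 2 * (opA H (x + 1 / 2) - opA H (x - 1 / 2))) x := by
    refine hasDerivAt_of_eq_opA_opA (a := -(symA k ^ 2 * S₀ 0)) hHm fun x => ?_
    rw [← eqA, hS]
    field_simp
    ring
  have dS' : ∀ x, deriv S x = 1 / symA k ^ 2 * (opA H (x + 1 / 2) - opA H (x - 1 / 2)) :=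
    fun x => (dS x).deriv
  have bS0 : ∀ x, |S x| ≤ 2 * Λ * (J + ε ^ 2 * B) := fun x => by
    refine (abs_sub _ _).trans ?_
    linarith [b0 x, b0 0]
  have bS1 : ∀ x, |deriv S x| ≤ Λ * (ε * B) :=
    abs_deriv_le_of_abs_sub_le fun x y => by
      have := b1 x y
      rwa [show S x - S y = S₀ x - S₀ y by rw [hS]; ring]
  have hinv : 1 / symA k ^ 2 ≤ 1 / c₀ ^ 2 :=
    one_div_le_one_div_of_le (by positivity) (pow_le_pow_left₀ hc₀.le hck 2)
  have bS2 : ∀ x y, |deriv S x - deriv S y| ≤ 4 / c₀ ^ 2 * (3 * Λ + 1) * B * |x - y| := by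
    intro x y
    rw [dS', dS', ← mul_sub, abs_mul, abs_of_pos (by positivity)]
    have h1 := abs_opA_sub_le hHm bH (x + 1 / 2) (y + 1 / 2)
    have h2 := abs_opA_sub_le hHm bH (x - 1 / 2) (y - 1 / 2)
    rw [show x + 1 / 2 - (y + 1 / 2) = x - y by ring] at h1
    rw [show x - 1 / 2 - (y - 1 / 2) = x - y by ring] at h2
    have h3 : |opA H (x + 1 / 2) - opA H (x - 1 / 2) - (opA H (y + 1 / 2) - opA H (y - 1 / 2))|
        ≤ 4 * ((3 * Λ + 1) * B) * |x - y| := by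
      rw [show opA H (x + 1 / 2) - opA H (x - 1 / 2) - (opA H (y + 1 / 2) - opA H (y - 1 / 2))
        = (opA H (x + 1 / 2) - opA H (y + 1 / 2)) - (opA H (x - 1 / 2) - opA H (y - 1 / 2)) by ring]
      refine (abs_sub _ _).trans ?_
      linarith
    calc _ ≤ 1 / c₀ ^ 2 * (4 * ((3 * Λ + 1) * B) * |x - y|) :=
          mul_le_mul hinv h3 (abs_nonneg _) (by positivity)
      _ = _ := by ring
  obtain ⟨α, β, C, hr, hl⟩ := h.solS_asymptotics hG hk
  have hlim : Tendsto S atTop (𝓝 (0 - S₀ 0)) :=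
    (tendsto_zero_of_abs_le_div hr).sub_const _
  have hLL : 0 ≤ 4 / c₀ ^ 2 * (3 * Λ + 1) := by positivity
  -- The normalisation `S(0) = 0` subtracts a constant from `S₀`; `η` is the image of that
  -- subtracted constant under `M`.
  refine ⟨S, -(1 - symA k ^ 2) * S₀ 0, ⟨⟨⟨fun x => (dS x).differentiableAt, ⟨_, bS0⟩, ⟨_, bS1⟩,
    ⟨_, lipschitzWith_of_abs_sub_le bS2⟩⟩, by simp [hS], ⟨_, hlim⟩⟩, fun x => ?_⟩,
    fun x => ?_, fun x => ?_, fun x y => ?_, -S₀ 0, α, β, C, fun x hx => ?_, fun x hx => ?_⟩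
  · have h1 := h.Cv_tent_solS hG hk x
    rw [opM]
    simp only
    rw [hS, opA_sub hSm (.const _), opA_const, opA_sub (bddMeas_opA hSm) (.const _), opA_const]
    beta_reduce
    rw [opA_opA_eq_Cv hG.contOffZero, opA_opA_eq_Cv (.of_continuous hSc hSm.bdd)]
    linear_combination h1
  · refine (bS0 x).trans (mul_le_mul_of_nonneg_right ?_ (by positivity))
    linarith
  · refine (bS1 x).trans (mul_le_mul_of_nonneg_right ?_ (by positivity))
    linarith
  · refine (bS2 x y).trans (mul_le_mul_of_nonneg_right (mul_le_mul_of_nonneg_right ?_ hB)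
      (abs_nonneg _))
    linarith
  · have := hr x hx
    rwa [show S x - -S₀ 0 = solS k G x by rw [hS]; simp only; ring]
  · have := hl x hx
    rwa [show S x - -S₀ 0 = solS k G x by rw [hS]; simp only; ring]

/-- Unique solvability of the affine problem, with constants that are uniform in the speed. -/
theorem exists_linear_theory {c₀ c₁ : ℝ} (hc₀ : 0 < c₀) (hc₁ : c₁ < 1)
    (hroot : ∀ c ∈ Icc c₀ c₁, ∃! k : ℝ, 0 < k ∧ symM c k = 0) :
    ∃ Λ > 0, ∀ k, 0 < k → symA k ∈ Icc c₀ c₁ →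
      (∀ G p q, IsAffineSolution (symA k) G p → IsAffineSolution (symA k) G q → p = q) ∧
      ∀ G ε B, IsSource G ε B → ∃ S η, IsAffineSolution (symA k) G (S, η) ∧
        SolutionBounds k Λ ε B |∫ z, G z| S := by
  obtain ⟨κ, hκ, N, hN, ν, hν, hb⟩ := exists_symbolBounds hc₀ hc₁ hroot
  set A := 2 * N / (ν * c₀ ^ 2) + 2 * N / ν ^ 2 + 8 * N ^ 2 / ν ^ 3 with hA
  have hA0 : 0 < A := by positivity
  set K := 2 * Real.pi with hK
  -- Both constants of the single-speed result increase when `symA k` is replaced by `c₀`, `1/k` by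
  -- `1/κ` and `k` by `K`; their sum serves for both.
  set Λ := (1 / c₀ ^ 2 + A * Real.pi) *
    (2 * (1 + K ^ 2) * (1 / κ + 8) + 2 + (8 * (1 + K ^ 2) + 4)) with hΛ
  have hΛ0 : 0 < Λ := by positivity
  refine ⟨2 * Λ + 4 / c₀ ^ 2 * (3 * Λ + 1), by positivity, fun k hk hkc => ?_⟩
  obtain ⟨hκk, hkK, hsb⟩ := hb k hk hkc
  have hres := hsb.hasResolvent hν hc₀ hkc.1
  have hs : 0 < symA k := hc₀.trans_le hkc.1
  refine ⟨fun G p q hp hq => hres.affine_unique hk hp hq,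
    fun G ε B hG => hres.exists_affine hk hc₀ hkc.1 ?_ ?_ hG⟩
  all_goals
    have hinv : 1 / symA k ^ 2 ≤ 1 / c₀ ^ 2 :=
      one_div_le_one_div_of_le (by positivity) (pow_le_pow_left₀ hc₀.le hkc.1 2)
    have hk2 : k ^ 2 ≤ K ^ 2 := pow_le_pow_left₀ hk.le hkK 2
    have hki : 1 / k ≤ 1 / κ := one_div_le_one_div_of_le hκ hκk
    have hAp : 0 ≤ A * Real.pi := by positivity
    have h1 : 2 * (1 + k ^ 2) * (1 / k + 8) ≤ 2 * (1 + K ^ 2) * (1 / κ + 8) :=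
      mul_le_mul (by linarith) (by linarith) (by positivity) (by positivity)
    have h2 : 0 ≤ 2 * (1 + K ^ 2) * (1 / κ + 8) := by positivity
    have h3 : 0 ≤ 8 * (1 + K ^ 2) := by positivity
    exact mul_le_mul (by linarith) (by linarith) (by positivity) (by positivity)

/-! ### The superposition operator near an anchor wave -/

/-- The quantitative properties of an anchor wave that enter the fixed point argument. -/
structure AnchorData (x₀ r₀ d₀ M₀ : ℝ) (R₀ : ℝ → ℝ) : Prop where
  diff : Differentiable ℝ R₀
  map_zero : R₀ 0 = 0
  lip : ∀ x y, |deriv R₀ x - deriv R₀ y| ≤ M₀ * |x - y|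
  deriv_gt : ∀ x, |x| < x₀ → d₀ < deriv R₀ x
  far_right : ∀ x, x₀ < x → r₀ < R₀ x
  far_left : ∀ x, x < -x₀ → R₀ x < -r₀
  near_right : ∀ x, 0 ≤ x → x ≤ x₀ → d₀ * x ≤ R₀ x
  near_left : ∀ x, -x₀ ≤ x → x ≤ 0 → R₀ x ≤ d₀ * x
  pos : 0 < r₀ ∧ 0 < d₀ ∧ 0 < x₀

/-- The properties of a single potential `P = Ψ_δ`. -/
structure PotentialData (P : ℝ → ℝ) (b δ : ℝ) : Prop where
  cont : Continuous (deriv P)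
  eq_sign : ∀ r, δ ≤ |r| → deriv P r = Real.sign r
  bound : ∀ r, |deriv P r| ≤ b
  lip : ∀ r s, |deriv P r - deriv P s| ≤ b / δ * |r - s|
  gap : ∫ r, (deriv P r - Real.sign r) = 0

/-- Small perturbations of the anchor wave. -/
structure SmallPert (C₀ C₁ δ : ℝ) (V : ℝ → ℝ) : Prop where
  diff : Differentiable ℝ V
  map_zero : V 0 = 0
  bound : ∀ x, |V x| ≤ C₀ * δ ^ 2
  deriv_bound : ∀ x, |deriv V x| ≤ C₁ * δ

/-- The smallness conditions on `δ`. -/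
structure SmallParam (r₀ d₀ M₀ C₀ C₁ δ : ℝ) : Prop where
  pos : 0 < δ
  width_le : 2 * δ / d₀ ≤ 1
  amp : C₀ * δ < 1
  far : 2 * δ < r₀
  slope : M₀ * (2 * δ / d₀) + C₁ * δ < d₀ / 2

lemma measurable_sign : Measurable Real.sign := by
  unfold Real.sign
  exact Measurable.ite measurableSet_Iio measurable_const
    (Measurable.ite measurableSet_Ioi measurable_const measurable_const)

lemma abs_sign_le (r : ℝ) : |Real.sign r| ≤ 1 := by
  rcases Real.sign_apply_eq r with h | h | h <;> rw [h] <;> simp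

lemma continuousAt_sign {r : ℝ} (hr : r ≠ 0) : ContinuousAt Real.sign r := by
  rcases lt_or_gt_of_ne hr with h | h
  · refine (continuousAt_const (y := (-1 : ℝ))).congr ?_
    filter_upwards [Iio_mem_nhds h] with y hy using (Real.sign_of_neg hy).symm
  · refine (continuousAt_const (y := (1 : ℝ))).congr ?_
    filter_upwards [Ioi_mem_nhds h] with y hy using (Real.sign_of_pos hy).symm

lemma PotentialData.contOffZero {P : ℝ → ℝ} {b δ : ℝ} (hP : PotentialData P b δ) :
    ContOffZero fun r => deriv P r - Real.sign r :=
  ⟨fun _ hx => hP.cont.continuousAt.sub (continuousAt_sign hx), b + 1, fun r =>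
    (abs_sub _ _).trans (add_le_add (hP.bound r) (abs_sign_le r))⟩

section
variable {x₀ r₀ d₀ M₀ C₀ C₁ δ b : ℝ} {R₀ V W P : ℝ → ℝ}

lemma AnchorData.right_pos (h : AnchorData x₀ r₀ d₀ M₀ R₀) {x : ℝ} (hx : 0 < x) : 0 < R₀ x := by
  rcases le_or_gt x x₀ with h1 | h1
  · exact (mul_pos h.pos.2.1 hx).trans_le (h.near_right x hx.le h1)
  · exact h.pos.1.trans (h.far_right x h1)

lemma AnchorData.left_neg (h : AnchorData x₀ r₀ d₀ M₀ R₀) {x : ℝ} (hx : x < 0) : R₀ x < 0 := by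
  rcases le_or_gt (-x₀) x with h1 | h1
  · exact (h.near_left x h1 hx.le).trans_lt (mul_neg_of_pos_of_neg h.pos.2.1 hx)
  · linarith [h.far_left x h1, h.pos.1]

lemma AnchorData.ne_zero (h : AnchorData x₀ r₀ d₀ M₀ R₀) {x : ℝ} (hx : x ≠ 0) : R₀ x ≠ 0 := by
  rcases lt_or_gt_of_ne hx with h1 | h1
  · exact (h.left_neg h1).ne
  · exact (h.right_pos h1).ne'

lemma SmallParam.amp_lt (hs : SmallParam r₀ d₀ M₀ C₀ C₁ δ) : C₀ * δ ^ 2 < δ := by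
  nlinarith [hs.pos, hs.amp]

lemma SmallParam.width_pos (hs : SmallParam r₀ d₀ M₀ C₀ C₁ δ) (hd : 0 < d₀) :
    0 < 2 * δ / d₀ := by
  have := hs.pos
  positivity

/-- From `2δ/d₀` up to `x₀` the slope bound gives `R₀ ≥ 2δ`, and further out `R₀ > r₀ > 2δ`. The
perturbation costs less than `δ` in either case. -/
lemma AnchorData.gt_right (h : AnchorData x₀ r₀ d₀ M₀ R₀)
    (hs : SmallParam r₀ d₀ M₀ C₀ C₁ δ) (hV : SmallPert C₀ C₁ δ V) {x : ℝ}
    (hx : 2 * δ / d₀ ≤ x) : δ < R₀ x + V x := by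
  have h1 := (abs_le.1 (hV.bound x)).1
  have h2 := hs.amp_lt
  have hw := hs.width_pos h.pos.2.1
  rcases le_or_gt x x₀ with h3 | h3
  · have h4 := h.near_right x (by linarith) h3
    rw [div_le_iff₀ h.pos.2.1] at hx
    linarith
  · have := h.far_right x h3
    linarith [hs.far]

lemma AnchorData.lt_left (h : AnchorData x₀ r₀ d₀ M₀ R₀)
    (hs : SmallParam r₀ d₀ M₀ C₀ C₁ δ) (hV : SmallPert C₀ C₁ δ V) {x : ℝ}
    (hx : x ≤ -(2 * δ / d₀)) : R₀ x + V x < -δ := by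
  have h1 := (abs_le.1 (hV.bound x)).2
  have h2 := hs.amp_lt
  have hw := hs.width_pos h.pos.2.1
  rcases le_or_gt (-x₀) x with h3 | h3
  · have h4 := h.near_left x h3 (by linarith)
    have hx' : 2 * δ / d₀ ≤ -x := by linarith
    rw [div_le_iff₀ h.pos.2.1] at hx'
    linarith
  · have := h.far_left x h3
    linarith [hs.far]

/-- The slope of the perturbed wave in the transition region. -/
lemma AnchorData.abs_slope_sub_le (h : AnchorData x₀ r₀ d₀ M₀ R₀) (hV : SmallPert C₀ C₁ δ V)
    (x : ℝ) : |deriv R₀ 0 - (deriv R₀ x + deriv V x)| ≤ M₀ * |x| + C₁ * δ := by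
  have h1 := h.lip 0 x
  rw [zero_sub, abs_neg] at h1
  rw [show deriv R₀ 0 - (deriv R₀ x + deriv V x) = (deriv R₀ 0 - deriv R₀ x) - deriv V x by ring]
  exact (abs_sub _ _).trans (add_le_add h1 (hV.deriv_bound x))

lemma AnchorData.lip_nonneg (h : AnchorData x₀ r₀ d₀ M₀ R₀) : 0 ≤ M₀ := by
  have := (abs_nonneg _).trans (h.lip 1 0)
  simpa using this

/-- The smallness condition `slope` is tailored to this: the deviation is below `d₀/2`, and `d₀ <
R₀'(0)`. Strict monotonicity near the origin and both slope bounds in admissibility follow. -/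
lemma AnchorData.abs_slope_sub_lt (h : AnchorData x₀ r₀ d₀ M₀ R₀)
    (hs : SmallParam r₀ d₀ M₀ C₀ C₁ δ) (hV : SmallPert C₀ C₁ δ V) {x : ℝ}
    (hx : |x| ≤ 2 * δ / d₀) : |deriv R₀ 0 - (deriv R₀ x + deriv V x)| < deriv R₀ 0 / 2 := by
  have h1 := h.abs_slope_sub_le hV x
  have h2 := h.deriv_gt 0 (by rw [abs_zero]; exact h.pos.2.2)
  have h3 := mul_le_mul_of_nonneg_left hx h.lip_nonneg
  linarith [hs.slope]

lemma AnchorData.hasDerivAt_add (h : AnchorData x₀ r₀ d₀ M₀ R₀) (hV : SmallPert C₀ C₁ δ V) (x : ℝ) :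
    HasDerivAt (fun x => R₀ x + V x) (deriv R₀ x + deriv V x) x :=
  (h.diff x).hasDerivAt.fun_add (hV.diff x).hasDerivAt

lemma AnchorData.strictMonoOn (h : AnchorData x₀ r₀ d₀ M₀ R₀)
    (hs : SmallParam r₀ d₀ M₀ C₀ C₁ δ) (hV : SmallPert C₀ C₁ δ V) :
    StrictMonoOn (fun x => R₀ x + V x) (Icc (-(2 * δ / d₀)) (2 * δ / d₀)) := by
  refine strictMonoOn_of_deriv_pos (convex_Icc _ _)
    (fun x _ => (h.hasDerivAt_add hV x).continuousAt.continuousWithinAt) fun x hx => ?_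
  rw [interior_Icc] at hx
  rw [(h.hasDerivAt_add hV x).deriv]
  have h1 := abs_lt.1 (h.abs_slope_sub_lt hs hV (abs_le.2 ⟨hx.1.le, hx.2.le⟩))
  have h2 := h.deriv_gt 0 (by rw [abs_zero]; exact h.pos.2.2)
  linarith [h.pos.2.1, h1.2]

lemma AnchorData.add_right_pos (h : AnchorData x₀ r₀ d₀ M₀ R₀)
    (hs : SmallParam r₀ d₀ M₀ C₀ C₁ δ) (hV : SmallPert C₀ C₁ δ V) {x : ℝ} (hx : 0 < x) :
    0 < R₀ x + V x := by
  have hw := hs.width_pos h.pos.2.1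
  rcases le_or_gt x (2 * δ / d₀) with h1 | h1
  · have := h.strictMonoOn hs hV ⟨by linarith, hw.le⟩ ⟨by linarith, h1⟩ hx
    simpa [h.map_zero, hV.map_zero] using this
  · exact hs.pos.trans (h.gt_right hs hV h1.le)

lemma AnchorData.add_left_neg (h : AnchorData x₀ r₀ d₀ M₀ R₀)
    (hs : SmallParam r₀ d₀ M₀ C₀ C₁ δ) (hV : SmallPert C₀ C₁ δ V) {x : ℝ} (hx : x < 0) :
    R₀ x + V x < 0 := by
  have hw := hs.width_pos h.pos.2.1
  rcases le_or_gt (-(2 * δ / d₀)) x with h1 | h1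
  · have := h.strictMonoOn hs hV ⟨h1, by linarith⟩ ⟨by linarith, hw.le⟩ hx
    simpa [h.map_zero, hV.map_zero] using this
  · linarith [h.lt_left hs hV h1.le, hs.pos]

lemma AnchorData.sign_add (h : AnchorData x₀ r₀ d₀ M₀ R₀)
    (hs : SmallParam r₀ d₀ M₀ C₀ C₁ δ) (hV : SmallPert C₀ C₁ δ V) (x : ℝ) :
    Real.sign (R₀ x + V x) = Real.sign (R₀ x) := by
  rcases lt_trichotomy x 0 with hx | hx | hx
  · rw [Real.sign_of_neg (h.add_left_neg hs hV hx), Real.sign_of_neg (h.left_neg hx)]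
  · rw [hx, h.map_zero, hV.map_zero, add_zero]
  · rw [Real.sign_of_pos (h.add_right_pos hs hV hx), Real.sign_of_pos (h.right_pos hx)]

lemma AnchorData.le_abs_add (h : AnchorData x₀ r₀ d₀ M₀ R₀)
    (hs : SmallParam r₀ d₀ M₀ C₀ C₁ δ) (hV : SmallPert C₀ C₁ δ V) {x : ℝ}
    (hx : 2 * δ / d₀ ≤ |x|) : δ ≤ |R₀ x + V x| := by
  rcases le_abs.1 hx with h1 | h1
  · exact (h.gt_right hs hV h1).le.trans (le_abs_self _)
  · have := h.lt_left hs hV (x := x) (by linarith)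
    rw [le_abs]; right; linarith

/-- Makes the source a function of `R₀ + V` alone, which is what permits the substitution `r = R₀(x)
+ V(x)` in its integral. -/
lemma AnchorData.opG_eq (h : AnchorData x₀ r₀ d₀ M₀ R₀)
    (hs : SmallParam r₀ d₀ M₀ C₀ C₁ δ) (hV : SmallPert C₀ C₁ δ V) (x : ℝ) :
    opG P R₀ V x = deriv P (R₀ x + V x) - Real.sign (R₀ x + V x) := by
  rw [opG, h.sign_add hs hV]

/-- The superposition operator produces admissible sources. -/
lemma AnchorData.isSource (h : AnchorData x₀ r₀ d₀ M₀ R₀)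
    (hs : SmallParam r₀ d₀ M₀ C₀ C₁ δ) (hP : PotentialData P b δ) (hV : SmallPert C₀ C₁ δ V) :
    IsSource (opG P R₀ V) (2 * δ / d₀) (b + 1) := by
  refine ⟨hs.width_pos h.pos.2.1, hs.width_le, fun x hx => ?_, fun x => ?_, fun x hx => ?_⟩
  · have h1 : ContinuousAt (fun x => deriv P (R₀ x + V x)) x :=
      (hP.cont.comp (h.diff.continuous.add hV.diff.continuous)).continuousAt
    have h2 : ContinuousAt (fun x => Real.sign (R₀ x)) x :=
      (continuousAt_sign (h.ne_zero hx)).comp h.diff.continuous.continuousAt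
    exact h1.sub h2
  · exact (abs_sub _ _).trans (add_le_add (hP.bound _) (abs_sign_le _))
  · rw [h.opG_eq hs hV, hP.eq_sign _ (h.le_abs_add hs hV hx), sub_self]

/-- The vanishing energy gap makes the mean of the source quadratically small. -/
lemma AnchorData.abs_integral_opG_le (h : AnchorData x₀ r₀ d₀ M₀ R₀)
    (hs : SmallParam r₀ d₀ M₀ C₀ C₁ δ) (hP : PotentialData P b δ) (hV : SmallPert C₀ C₁ δ V) :
    |∫ x, opG P R₀ V x| ≤ 4 * (b + 1) / d₀ ^ 2 * (2 * M₀ / d₀ + C₁) * δ ^ 2 := by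
  have hd := h.pos.2.1
  have hδ := hs.pos
  set ε := 2 * δ / d₀ with hε
  have hε0 : 0 < ε := hs.width_pos hd
  have hsrc := h.isSource hs hP hV
  have hG := hP.contOffZero
  set g : ℝ → ℝ := fun r => deriv P r - Real.sign r with hg
  set R : ℝ → ℝ := fun x => R₀ x + V x with hR
  have hRd : ∀ x, HasDerivAt R (deriv R₀ x + deriv V x) x := h.hasDerivAt_add hV
  have hRc : Continuous R := continuous_iff_continuousAt.2 fun x => (hRd x).continuousAt
  have hgi := hG.bddMeas.intervalIntegrable
  set Γ : ℝ → ℝ := fun x => ∫ s in (0 : ℝ)..x, g s with hΓ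
  have hΓc : Continuous Γ := intervalIntegral.continuous_primitive hgi 0
  have hRne : ∀ x ≠ 0, R x ≠ 0 := fun x hx => by
    rcases lt_or_gt_of_ne hx with h1 | h1
    · exact (h.add_left_neg hs hV h1).ne
    · exact (h.add_right_pos hs hV h1).ne'
  have hgR : BddMeas fun x => g (R x) := hG.bddMeas.comp hRc.measurable
  -- `X` serves only for integrability and does not enter the final constant.
  obtain ⟨X, hX⟩ := (isCompact_Icc (a := (-1 : ℝ)) (b := 1)).exists_bound_of_continuousOn
    (f := deriv R₀) (lipschitzWith_of_abs_sub_le h.lip).continuous.continuousOn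
  have hRm : ∀ x, |x| ≤ 1 → |deriv R₀ x + deriv V x| ≤ X + C₁ * δ := fun x hx =>
    (abs_add_le _ _).trans (add_le_add (hX x (abs_le.1 hx)) (hV.deriv_bound x))
  have hmeas : Measurable fun x => deriv R₀ x + deriv V x :=
    (measurable_deriv R₀).add (measurable_deriv V)
  obtain ⟨Bg, hBg⟩ := hgR.bdd
  have i1 : IntervalIntegrable (fun x => g (R x) * (deriv R₀ x + deriv V x)) volume (-1) 1 := by
    refine (intervalIntegrable_const (c := Bg * (X + C₁ * δ)) (μ := volume)).mono_fun
      (hgR.meas.mul hmeas).aestronglyMeasurable ?_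
    rw [uIoc_of_le (by norm_num)]
    filter_upwards [ae_restrict_mem measurableSet_Ioc] with x hx
    rw [norm_mul]
    refine le_trans ?_ (le_abs_self _)
    exact mul_le_mul (hBg x) (hRm x (abs_le.2 ⟨hx.1.le, hx.2⟩)) (norm_nonneg _)
      ((abs_nonneg _).trans (hBg x))
  -- Change of variables `r = R(x)`, with the origin exempt because `g` may jump there. Since `R`
  -- leaves `(-δ, δ)` inside `[-1, 1]`, the result is the full energy gap.
  have key := MeasureTheory.integral_eq_of_hasDerivAt_off_countable
    (fun x => Γ (R x)) (fun x => g (R x) * (deriv R₀ x + deriv V x)) (a := -1) (b := 1)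
    (countable_singleton (0 : ℝ)) (hΓc.comp hRc).continuousOn
    (fun x hx => (hG.hasDerivAt_primitive (hRne x hx.2)).comp x (hRd x)) i1
  have hgap : Γ (R 1) - Γ (R (-1)) = 0 := by
    rw [hΓ]
    simp only
    rw [intervalIntegral.integral_interval_sub_left (hgi _ _) (hgi _ _),
      intervalIntegral.integral_eq_integral_of_support_subset, ← hP.gap]
    intro r hr
    have : |r| < δ := by
      by_contra hlt
      exact hr (by rw [hg]; simp only; rw [hP.eq_sign r (not_lt.1 hlt), sub_self])
    have h1 := abs_lt.1 this
    have h2 : δ < R 1 := h.gt_right hs hV hs.width_le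
    have h3 : R (-1) < -δ := h.lt_left hs hV (by linarith [hs.width_le])
    exact ⟨by linarith [h1.1], by linarith [h1.2]⟩
  rw [hgap] at key
  have e1 : (∫ x, opG P R₀ V x) = ∫ x in (-1 : ℝ)..1, g (R x) := by
    rw [← hsrc.interval_eq]
    congr 1; ext x
    exact h.opG_eq hs hV x
  set m := deriv R₀ 0 with hm
  have hmd : d₀ < m := h.deriv_gt 0 (by rw [abs_zero]; exact h.pos.2.2)
  have i2 : IntervalIntegrable (fun x => m * g (R x)) volume (-1) 1 :=
    (hgR.intervalIntegrable _ _).const_mul m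
  -- Subtracting the vanishing integral of `g(R) R'` leaves the weight `m - R'`, which is `O(δ)` on
  -- a support of width `O(δ)`.
  have e2 : m * ∫ x in (-1 : ℝ)..1, g (R x)
      = ∫ x in (-1 : ℝ)..1, g (R x) * (m - (deriv R₀ x + deriv V x)) := by
    rw [← sub_zero (m * _), ← key, ← intervalIntegral.integral_const_mul,
      ← intervalIntegral.integral_sub i2 i1]
    congr 1; ext x; ring
  have hb1 : 0 ≤ b + 1 := hsrc.nonneg
  have h0 : ∀ x, ε ≤ |x| → g (R x) = 0 := fun x hx => by
    rw [hg]
    simp only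
    rw [hP.eq_sign _ (h.le_abs_add hs hV hx), sub_self]
  have hC1 : 0 ≤ C₁ * δ := (abs_nonneg _).trans (hV.deriv_bound 0)
  have b1 : |∫ x in (-1 : ℝ)..1, g (R x) * (m - (deriv R₀ x + deriv V x))|
      ≤ 2 * ε * ((b + 1) * (M₀ * ε + C₁ * δ)) := by
    refine abs_intervalIntegral_le_of_support hε0.le (fun x => ?_)
      (fun x hx => by rw [h0 x hx, zero_mul]) _ _
    rw [abs_mul]
    have hM := h.lip_nonneg
    rcases le_or_gt |x| ε with hx | hx
    · refine mul_le_mul ?_ ((h.abs_slope_sub_le hV x).trans ?_) (abs_nonneg _) hb1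
      · exact (abs_sub _ _).trans (add_le_add (hP.bound _) (abs_sign_le _))
      · linarith [mul_le_mul_of_nonneg_left hx hM]
    · rw [h0 x hx.le, abs_zero, zero_mul]
      positivity
  have b2 : d₀ * |∫ x, opG P R₀ V x| ≤ 2 * ε * ((b + 1) * (M₀ * ε + C₁ * δ)) := by
    refine le_trans ?_ b1
    rw [← e2, abs_mul, e1, abs_of_pos (hd.trans hmd)]
    exact mul_le_mul_of_nonneg_right hmd.le (abs_nonneg _)
  rw [← le_div_iff₀' hd] at b2
  refine b2.trans (le_of_eq ?_)
  rw [hε]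
  field_simp
  ring

/-- The difference of two superposition sources. -/
lemma AnchorData.isSource_sub (h : AnchorData x₀ r₀ d₀ M₀ R₀)
    (hs : SmallParam r₀ d₀ M₀ C₀ C₁ δ) (hP : PotentialData P b δ) (hV : SmallPert C₀ C₁ δ V)
    (hW : SmallPert C₀ C₁ δ W) {E : ℝ} (hE : ∀ x, |deriv V x - deriv W x| ≤ E) :
    IsSource (fun x => opG P R₀ V x - opG P R₀ W x) (2 * δ / d₀) (2 * b / d₀ * E) := by
  have hd := h.pos.2.1
  have hδ := hs.pos
  have sV := h.isSource hs hP hV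
  have sW := h.isSource hs hP hW
  have hE0 : 0 ≤ E := (abs_nonneg _).trans (hE 0)
  have hb : 0 ≤ b := (abs_nonneg _).trans (hP.bound 0)
  refine ⟨sV.pos, sV.le_one, fun x hx => (sV.cont x hx).sub (sW.cont x hx), fun x => ?_,
    fun x hx => by rw [sV.support x hx, sW.support x hx, sub_self]⟩
  rcases le_or_gt |x| (2 * δ / d₀) with hx | hx
  · have e : opG P R₀ V x - opG P R₀ W x
        = deriv P (R₀ x + V x) - deriv P (R₀ x + W x) := by
      unfold opG; ring
    have h1 := hP.lip (R₀ x + V x) (R₀ x + W x)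
    -- Both perturbations vanish at the origin, so their difference is at most `E |x|`. On the
    -- support this supplies the factor `δ` that cancels `1/δ` in the Lipschitz constant of `P'`.
    have h2 := abs_sub_le_of_hasDerivAt (f := fun x => V x - W x)
      (fun x => (hV.diff x).hasDerivAt.fun_sub (hW.diff x).hasDerivAt) hE x 0
    simp only [hV.map_zero, hW.map_zero, sub_zero] at h2
    rw [show R₀ x + V x - (R₀ x + W x) = V x - W x by ring] at h1
    rw [e]
    calc _ ≤ _ := h1
      _ ≤ b / δ * (E * (2 * δ / d₀)) := mul_le_mul_of_nonneg_left
          (h2.trans (mul_le_mul_of_nonneg_left hx hE0)) (by positivity)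
      _ = _ := by field_simp
  · rw [sV.support x hx.le, sW.support x hx.le, sub_self, abs_zero]
    positivity

end

/-! ### The essential supremum of continuous functions -/

lemma linf_le_ofReal {f : ℝ → ℝ} {M : ℝ} (h : ∀ x, |f x| ≤ M) : linf f ≤ ENNReal.ofReal M := by
  rw [linf, eLpNorm_exponent_top]
  exact eLpNormEssSup_le_of_ae_bound (Eventually.of_forall h)

lemma abs_le_of_linf_le {f : ℝ → ℝ} {M : ℝ} (hM : 0 ≤ M) (hf : Continuous f)
    (h : linf f ≤ ENNReal.ofReal M) (x : ℝ) : |f x| ≤ M := by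
  rw [linf, eLpNorm_exponent_top] at h
  have hae : ∀ᵐ x, |f x| ≤ M := by
    filter_upwards [ae_le_eLpNormEssSup (f := f) (μ := volume)] with x hx
    have := hx.trans h
    rw [Real.enorm_eq_ofReal_abs] at this
    exact (ENNReal.ofReal_le_ofReal_iff hM).1 this
  have hcl : closure {x | |f x| ≤ M} ⊆ {x | |f x| ≤ M} :=
    closure_minimal subset_rfl (isClosed_le hf.abs continuous_const)
  exact hcl (Measure.dense_of_ae hae x)

lemma eq_of_lipschitzWith_of_ae_hasDerivAt_zero {f : ℝ → ℝ} {K : NNReal} (hf : LipschitzWith K f)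
    (h : ∀ᵐ x, HasDerivAt f 0 x) (x y : ℝ) : f x = f y := by
  obtain ⟨C, hC⟩ := (hf.lipschitzOnWith (s := uIcc x y)).absolutelyContinuousOnInterval
    |>.const_of_ae_hasDerivAt_zero (h.mono fun _ h _ => h)
  rw [hC x left_mem_uIcc, hC y right_mem_uIcc]

/-! ### Anchor waves -/

lemma abs_opA_shift_sub_le {H : ℝ → ℝ} (hH : BddMeas H) {B : ℝ} (hB : ∀ x, |H x| ≤ B) (x y : ℝ) :
    |opA H (x + 1 / 2) - opA H (x - 1 / 2) - (opA H (y + 1 / 2) - opA H (y - 1 / 2))|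
      ≤ 4 * B * |x - y| := by
  have h1 := abs_opA_sub_le hH hB (x + 1 / 2) (y + 1 / 2)
  have h2 := abs_opA_sub_le hH hB (x - 1 / 2) (y - 1 / 2)
  rw [show x + 1 / 2 - (y + 1 / 2) = x - y by ring] at h1
  rw [show x - 1 / 2 - (y - 1 / 2) = x - y by ring] at h2
  rw [show opA H (x + 1 / 2) - opA H (x - 1 / 2) - (opA H (y + 1 / 2) - opA H (y - 1 / 2))
    = (opA H (x + 1 / 2) - opA H (y + 1 / 2)) - (opA H (x - 1 / 2) - opA H (y - 1 / 2)) by ring]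
  refine (abs_sub _ _).trans ?_
  linarith

lemma MemW2inf.contOffZero_sub_sign {R : ℝ → ℝ} (h : MemW2inf R) (hs : ∀ x ≠ 0, R x ≠ 0) :
    ContOffZero fun x => R x - Real.sign (R x) := by
  refine (ContOffZero.of_continuous h.differentiable.continuous h.bounded).sub
    ⟨fun x hx => (continuousAt_sign (hs x hx)).comp h.differentiable.continuous.continuousAt,
      1, fun x => abs_sign_le _⟩

/-- Twofold integration of the travelling wave equation. -/
lemma IsUnperturbedWave.exists_integrated {c : ℝ} {R : ℝ → ℝ} (h : IsUnperturbedWave c R)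
    (hs : ∀ x ≠ 0, R x ≠ 0) :
    ∃ a, ∀ x, c ^ 2 * R x = opA (opA fun y => R y - Real.sign (R y)) x + a := by
  obtain ⟨hR, heq⟩ := h
  have hH := hR.contOffZero_sub_sign hs
  set H : ℝ → ℝ := fun x => R x - Real.sign (R x) with hHdef
  have hHm := hH.bddMeas
  obtain ⟨B, hB⟩ := hH.bdd
  obtain ⟨K, hK⟩ := hR.deriv_lipschitz
  -- The first integral of the equation. It is Lipschitz with derivative zero almost everywhere,
  -- hence constant; a nonzero constant would make `R` grow linearly, against its boundedness.
  set D : ℝ → ℝ := fun x => c ^ 2 * deriv R x - (opA H (x + 1 / 2) - opA H (x - 1 / 2)) with hD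
  have hDl : ∀ x y, |D x - D y| ≤ (c ^ 2 * K + 4 * B) * |x - y| := fun x y => by
    have h1 := hK.dist_le_mul x y
    rw [Real.dist_eq, Real.dist_eq] at h1
    have h2 := abs_opA_shift_sub_le hHm hB x y
    rw [show D x - D y = c ^ 2 * (deriv R x - deriv R y)
      - (opA H (x + 1 / 2) - opA H (x - 1 / 2) - (opA H (y + 1 / 2) - opA H (y - 1 / 2))) by
        rw [hD]; ring]
    refine (abs_sub _ _).trans ?_
    rw [abs_mul, abs_of_nonneg (sq_nonneg c)]
    have h3 := mul_le_mul_of_nonneg_left h1 (sq_nonneg c)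
    linarith
  have hne : ∀ a : ℝ, ∀ᵐ x : ℝ, x ≠ a := fun a => compl_mem_ae_iff.2 (measure_singleton a)
  have hD0 : ∀ᵐ x, HasDerivAt D 0 x := by
    filter_upwards [heq, hK.ae_differentiableAt_real, hne 0, hne 1, hne (-1)] with x h1 h2 n0 n1 n2
    have c0 : ContinuousAt H x := hH.cont x n0
    have c1 : ContinuousAt H (x + 1) := hH.cont _ fun hx => n2 (by linarith)
    have c2 : ContinuousAt H (x - 1) := hH.cont _ fun hx => n1 (by linarith)
    have d1 := (hasDerivAt_opA hHm (x := x + 1 / 2)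
      (by rwa [show x + 1 / 2 + 1 / 2 = x + 1 by ring])
      (by rwa [show x + 1 / 2 - 1 / 2 = x by ring])).comp_add_const x (1 / 2)
    have d2 := (hasDerivAt_opA hHm (x := x - 1 / 2)
      (by rwa [show x - 1 / 2 + 1 / 2 = x by ring])
      (by rwa [show x - 1 / 2 - 1 / 2 = x - 1 by ring])).comp_sub_const x (1 / 2)
    refine ((h2.hasDerivAt.const_mul (c ^ 2)).fun_sub (d1.fun_sub d2)).congr_deriv ?_
    rw [h1, lap1, show x + 1 / 2 + 1 / 2 = x + 1 by ring, show x + 1 / 2 - 1 / 2 = x by ring,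
      show x - 1 / 2 + 1 / 2 = x by ring, show x - 1 / 2 - 1 / 2 = x - 1 by ring]
    ring
  have hDc := eq_of_lipschitzWith_of_ae_hasDerivAt_zero (lipschitzWith_of_abs_sub_le hDl) hD0
  set d := D 0 with hd
  set F : ℝ → ℝ := fun x => c ^ 2 * R x - opA (opA H) x - d * x with hF
  have hFd : ∀ x, HasDerivAt F 0 x := fun x => by
    refine ((((hR.differentiable x).hasDerivAt.const_mul (c ^ 2)).fun_sub
      (hasDerivAt_opA_opA hHm x)).fun_sub ((hasDerivAt_id' x).const_mul d)).congr_deriv ?_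
    have := hDc x 0
    rw [hD] at this
    simp only at this
    rw [mul_one, this]
    exact sub_self d
  have hFc : ∀ x, F x = F 0 := fun x =>
    is_const_of_deriv_eq_zero (fun x => (hFd x).differentiableAt) (fun x => (hFd x).deriv) x 0
  obtain ⟨A, hA⟩ := hR.bounded
  have hd0 : d = 0 := by
    by_contra hne
    set M := c ^ 2 * A + B with hM
    have hb : ∀ x, |F 0 + d * x| ≤ M := fun x => by
      rw [← hFc x, hF]
      simp only [sub_add_cancel]
      refine (abs_sub _ _).trans (add_le_add ?_ (abs_opA_le (abs_opA_le hB) x))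
      rw [abs_mul, abs_of_nonneg (sq_nonneg c)]
      exact mul_le_mul_of_nonneg_left (hA x) (sq_nonneg c)
    have := (le_abs_self _).trans (hb ((M + 1 - F 0) / d))
    rw [mul_div_cancel₀ _ hne] at this
    linarith
  refine ⟨F 0, fun x => ?_⟩
  rw [← hFc x, hF, hd0]
  simp only
  ring

section
variable {c₀ c₁ c k x₀ r₀ d₀ D₀ : ℝ} {R₀ : ℝ → ℝ}

lemma IsAnchorWave.anchorData_of_lipschitz (h : IsAnchorWave c k x₀ r₀ d₀ D₀ R₀) (hx₀ : 0 < x₀)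
    (hr₀ : 0 < r₀) (hd₀ : 0 < d₀) {M : ℝ}
    (hM : ∀ x y, |deriv R₀ x - deriv R₀ y| ≤ M * |x - y|) : AnchorData x₀ r₀ d₀ M R₀ := by
  have hd := h.wave.1.differentiable
  have near : ∀ x ∈ Icc (-x₀) x₀, ∀ y ∈ Icc (-x₀) x₀, x ≤ y → d₀ * (y - x) ≤ R₀ y - R₀ x :=
    (convex_Icc (-x₀) x₀).mul_sub_le_image_sub_of_le_deriv hd.continuous.continuousOn
      hd.differentiableOn fun x hx => by
        rw [interior_Icc] at hx
        exact (h.deriv_gt x (abs_lt.2 hx)).le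
  refine ⟨hd, h.map_zero, hM, h.deriv_gt, h.gt_of_gt, h.lt_of_lt, fun x h1 h2 => ?_,
    fun x h1 h2 => ?_, hr₀, hd₀, hx₀⟩
  · have := near 0 ⟨by linarith, hx₀.le⟩ x ⟨by linarith, h2⟩ h1
    rw [h.map_zero] at this
    linarith
  · have := near x ⟨h1, by linarith⟩ 0 ⟨by linarith, hx₀.le⟩ h2
    rw [h.map_zero] at this
    linarith

/-- Anchor waves have uniform bounds and satisfy the integrated equation. -/
lemma IsAnchorWave.anchorData (h : IsAnchorWave c k x₀ r₀ d₀ D₀ R₀) (hx₀ : 0 < x₀)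
    (hr₀ : 0 < r₀) (hd₀ : 0 < d₀) (hD₀ : 0 < D₀) (hc₀ : 0 < c₀) (hc₁ : c₁ < 1)
    (hc : c ∈ Icc c₀ c₁) :
    AnchorData x₀ r₀ d₀ (4 / c₀ ^ 2 * (D₀ * (1 - c₁ ^ 2)⁻¹ + 1)) R₀ ∧
      ∃ a, ∀ x, c ^ 2 * R₀ x = opA (opA fun y => R₀ y - Real.sign (R₀ y)) x + a := by
  obtain ⟨K, hK⟩ := h.wave.1.deriv_lipschitz
  -- `K` depends on the wave. This provisional version serves to locate the zero of `R₀`; the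
  -- integrated equation then provides a Lipschitz constant that is uniform over all waves and
  -- speeds.
  have pre := h.anchorData_of_lipschitz hx₀ hr₀ hd₀ (M := K) fun x y => by
    have := hK.dist_le_mul x y
    rwa [Real.dist_eq, Real.dist_eq] at this
  obtain ⟨a, ha⟩ := h.wave.exists_integrated fun x hx => pre.ne_zero hx
  refine ⟨h.anchorData_of_lipschitz hx₀ hr₀ hd₀ fun x y => ?_, a, ha⟩
  have hcp : 0 < c := hc₀.trans_le hc.1
  have hHm := (h.wave.1.contOffZero_sub_sign fun x hx => pre.ne_zero hx).bddMeas
  set H : ℝ → ℝ := fun x => R₀ x - Real.sign (R₀ x) with hH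
  have h1 : c ^ 2 ≤ c₁ ^ 2 := pow_le_pow_left₀ hcp.le hc.2 2
  have h2 : 0 < 1 - c₁ ^ 2 := by nlinarith [hcp.trans_le hc.2]
  have h3 : (1 - c ^ 2)⁻¹ ≤ (1 - c₁ ^ 2)⁻¹ := inv_anti₀ h2 (by linarith)
  have hB : ∀ x, |H x| ≤ D₀ * (1 - c₁ ^ 2)⁻¹ + 1 := fun x => by
    have h4 : 0 < (1 - c ^ 2)⁻¹ := inv_pos.2 (by linarith)
    have := abs_le_of_linf_le (by positivity) pre.diff.continuous h.norm_le x
    refine (abs_sub _ _).trans (add_le_add (this.trans ?_) (abs_sign_le _))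
    exact mul_le_mul_of_nonneg_left h3 hD₀.le
  have hd : ∀ x, deriv R₀ x = 1 / c ^ 2 * (opA H (x + 1 / 2) - opA H (x - 1 / 2)) := fun x =>
    (hasDerivAt_of_eq_opA_opA (a := a) hHm (fun x => by
      rw [← ha x]; field_simp) x).deriv
  have hinv : 1 / c ^ 2 ≤ 1 / c₀ ^ 2 :=
    one_div_le_one_div_of_le (by positivity) (pow_le_pow_left₀ hc₀.le hc.1 2)
  rw [hd, hd, ← mul_sub, abs_mul, abs_of_pos (by positivity)]
  calc _ ≤ 1 / c₀ ^ 2 * (4 * (D₀ * (1 - c₁ ^ 2)⁻¹ + 1) * |x - y|) :=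
        mul_le_mul hinv (abs_opA_shift_sub_le hHm hB x y) (abs_nonneg _) (by positivity)
    _ = _ := by ring

end

/-! ### Potentials -/

lemma IsPotentialFamily.nonneg {Ψ : ℝ → ℝ → ℝ} {CΨ : ℝ} (h : IsPotentialFamily Ψ CΨ) : 0 ≤ CΨ :=
  (abs_nonneg _).trans (h.deriv_le 1 one_pos 0)

lemma IsPotentialFamily.potentialData {Ψ : ℝ → ℝ → ℝ} {CΨ δ : ℝ} (h : IsPotentialFamily Ψ CΨ)
    (hδ : 0 < δ) (hI : energyGap (Ψ δ) = 0) : PotentialData (Ψ δ) CΨ δ := by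
  have hc := h.contDiff δ hδ
  refine ⟨hc.continuous_deriv (by norm_num), fun r hr => ?_, h.deriv_le δ hδ, ?_, ?_⟩
  · exact h.deriv_eq_sign δ hδ r fun hmem => absurd (abs_lt.2 hmem) (not_lt.2 hr)
  · exact abs_sub_le_of_hasDerivAt (fun x => (hc.differentiable_deriv_two x).hasDerivAt)
      (h.deriv_deriv_le δ hδ)
  · rw [energyGap] at hI
    linarith

/-! ### The fixed point operator -/

/-- Unique solvability of the affine problem with a priori bounds. -/
structure AffineSolvable (k Λ : ℝ) : Prop where
  pos : 0 < Λ
  unique : ∀ G p q, IsAffineSolution (symA k) G p → IsAffineSolution (symA k) G q → p = q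
  exists_sol : ∀ G ε B, IsSource G ε B → ∃ S η, IsAffineSolution (symA k) G (S, η) ∧
    SolutionBounds k Λ ε B |∫ z, G z| S

/-- Uniqueness identifies the solution selected by `Classical.epsilon` with the constructed one, so
that the bounds apply to it. -/
lemma AffineSolvable.opL_spec {k Λ ε B : ℝ} {G : ℝ → ℝ} (h : AffineSolvable k Λ)
    (hG : IsSource G ε B) : IsAffineSolution (symA k) G (opL (symA k) G) ∧
      SolutionBounds k Λ ε B |∫ z, G z| (opL (symA k) G).1 := by
  obtain ⟨S, η, h1, h2⟩ := h.exists_sol G ε B hG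
  have h3 : IsAffineSolution (symA k) G (opL (symA k) G) := Classical.epsilon_spec ⟨_, h1⟩
  refine ⟨h3, ?_⟩
  rw [h.unique G _ _ h3 h1]
  exact h2

lemma MemX.sub {S T : ℝ → ℝ} (hS : MemX S) (hT : MemX T) : MemX fun x => S x - T x := by
  obtain ⟨⟨d1, ⟨B1, b1⟩, ⟨C1, e1⟩, ⟨K1, l1⟩⟩, z1, ⟨σ1, t1⟩⟩ := hS
  obtain ⟨⟨d2, ⟨B2, b2⟩, ⟨C2, e2⟩, ⟨K2, l2⟩⟩, z2, ⟨σ2, t2⟩⟩ := hT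
  have hd : deriv (fun x => S x - T x) = fun x => deriv S x - deriv T x :=
    funext fun x => deriv_fun_sub (d1 x) (d2 x)
  refine ⟨⟨d1.fun_sub d2, ⟨B1 + B2, fun x => ?_⟩, ⟨C1 + C2, fun x => ?_⟩, ⟨K1 + K2, ?_⟩⟩,
    by rw [z1, z2, sub_zero], ⟨_, t1.sub t2⟩⟩
  · exact (abs_sub _ _).trans (add_le_add (b1 x) (b2 x))
  · rw [hd]
    exact (abs_sub _ _).trans (add_le_add (e1 x) (e2 x))
  · rw [hd]
    exact l1.sub l2

lemma opM_sub {c : ℝ} {S T : ℝ → ℝ} (hS : BddMeas S) (hT : BddMeas T) (x : ℝ) :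
    opM c (fun x => S x - T x) x = opM c S x - opM c T x := by
  unfold opM
  rw [opA_sub hS hT, opA_sub (bddMeas_opA hS) (bddMeas_opA hT)]
  ring

lemma IsAffineSolution.sub {c : ℝ} {G G' S S' : ℝ → ℝ} {η η' : ℝ} (hG : BddMeas G)
    (hG' : BddMeas G') (h : IsAffineSolution c G (S, η)) (h' : IsAffineSolution c G' (S', η')) :
    IsAffineSolution c (fun x => G x - G' x) (fun x => S x - S' x, η - η') := by
  refine ⟨h.1.sub h'.1, fun x => ?_⟩
  have h1 := h.2 x
  have h2 := h'.2 x
  simp only at h1 h2 ⊢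
  rw [opM_sub h.1.bddMeas h'.1.bddMeas, h1, h2, opA_sub hG hG',
    opA_sub (bddMeas_opA hG) (bddMeas_opA hG')]
  ring

/-- The standing assumptions of the fixed point argument. -/
structure FixedPointSetting (k Λ x₀ r₀ d₀ M₀ C₀ C₁ b δ : ℝ) (P R₀ : ℝ → ℝ) : Prop where
  solvable : AffineSolvable k Λ
  anchor : AnchorData x₀ r₀ d₀ M₀ R₀
  small : SmallParam r₀ d₀ M₀ C₀ C₁ δ
  potential : PotentialData P b δ
  -- The linear bounds with `ε = 2δ/d₀` and `B = b + 1` reproduce exactly these constants. There is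
  -- no circularity: `C₁` is fixed without `C₀`, and the mean of the source involves `C₁` only.
  amp_eq : Λ * (4 * (b + 1) / d₀ ^ 2 * (2 * M₀ / d₀ + C₁) + 4 * (b + 1) / d₀ ^ 2) = C₀
  slope_eq : 2 * Λ * (b + 1) / d₀ = C₁
  -- `8 = 6 + 2` collects the bounds for values and first derivatives, and `1` is the weighted
  -- second derivative.
  contr : Λ * (2 * b / d₀) * (8 / d₀ + 1) * δ ≤ 1 / 2

section
variable {k Λ x₀ r₀ d₀ M₀ C₀ C₁ b δ : ℝ} {P R₀ V W : ℝ → ℝ}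

lemma FixedPointSetting.b_nonneg (h : FixedPointSetting k Λ x₀ r₀ d₀ M₀ C₀ C₁ b δ P R₀) : 0 ≤ b :=
  (abs_nonneg _).trans (h.potential.bound 0)

lemma FixedPointSetting.C₁_nonneg (h : FixedPointSetting k Λ x₀ r₀ d₀ M₀ C₀ C₁ b δ P R₀) :
    0 ≤ C₁ := by
  have h1 := h.b_nonneg
  have h2 := h.anchor.pos.2.1
  have h3 := h.solvable.pos
  rw [← h.slope_eq]
  positivity

lemma FixedPointSetting.C₀_nonneg (h : FixedPointSetting k Λ x₀ r₀ d₀ M₀ C₀ C₁ b δ P R₀) :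
    0 ≤ C₀ := by
  have h1 := h.b_nonneg
  have h2 := h.anchor.pos.2.1
  have h3 := h.solvable.pos
  have h4 := h.C₁_nonneg
  have h5 := h.anchor.lip_nonneg
  rw [← h.amp_eq]
  positivity

/-- Bounds and asymptotics of the image under the fixed point operator. -/
lemma FixedPointSetting.opT_spec (h : FixedPointSetting k Λ x₀ r₀ d₀ M₀ C₀ C₁ b δ P R₀)
    (hV : SmallPert C₀ C₁ δ V) :
    IsAffineSolution (symA k) (opG P R₀ V) (opL (symA k) (opG P R₀ V)) ∧
      SolutionBounds k Λ (2 * δ / d₀) (b + 1) |∫ z, opG P R₀ V z| (opT (symA k) P R₀ V) :=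
  h.solvable.opL_spec (h.anchor.isSource h.small h.potential hV)

lemma FixedPointSetting.smallPert_opT (h : FixedPointSetting k Λ x₀ r₀ d₀ M₀ C₀ C₁ b δ P R₀)
    (hV : SmallPert C₀ C₁ δ V) : SmallPert C₀ C₁ δ (opT (symA k) P R₀ V) := by
  obtain ⟨h1, h2⟩ := h.opT_spec hV
  have hd := h.anchor.pos.2.1
  refine ⟨h1.1.memW2inf.differentiable, h1.1.map_zero, fun x => (h2.abs_le x).trans ?_,
    fun x => (h2.abs_deriv_le x).trans (le_of_eq ?_)⟩
  · have h3 := h.anchor.abs_integral_opG_le h.small h.potential hV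
    calc _ ≤ Λ * (4 * (b + 1) / d₀ ^ 2 * (2 * M₀ / d₀ + C₁) * δ ^ 2
          + (2 * δ / d₀) ^ 2 * (b + 1)) :=
          mul_le_mul_of_nonneg_left (by linarith) h.solvable.pos.le
      _ = _ := by
        rw [← h.amp_eq]
        field_simp
        ring
  · rw [← h.slope_eq]
    field_simp

/-- The second derivative of the image is controlled without any bound on that of `V`. Hence the
iteration can be run with the first two bounds alone. -/
lemma FixedPointSetting.memXdelta_opT (h : FixedPointSetting k Λ x₀ r₀ d₀ M₀ C₀ C₁ b δ P R₀)
    (hV : SmallPert C₀ C₁ δ V) :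
    MemXdelta C₀ C₁ (Λ * (b + 1)) δ (opT (symA k) P R₀ V) :=
  have h1 := h.smallPert_opT hV
  ⟨(h.opT_spec hV).1.1, linf_le_ofReal h1.bound, linf_le_ofReal h1.deriv_bound,
    linf_le_ofReal (abs_deriv_le_of_abs_sub_le (h.opT_spec hV).2.abs_deriv_sub_le)⟩

lemma MemXdelta.smallPert {C₂ : ℝ} (hV : MemXdelta C₀ C₁ C₂ δ V) (h0 : 0 ≤ C₀) (h1 : 0 ≤ C₁)
    (hδ : 0 ≤ δ) : SmallPert C₀ C₁ δ V := by
  obtain ⟨K, hK⟩ := hV.memX.memW2inf.deriv_lipschitz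
  exact ⟨hV.memX.memW2inf.differentiable, hV.memX.map_zero,
    abs_le_of_linf_le (by positivity) hV.memX.continuous hV.norm_le,
    abs_le_of_linf_le (by positivity) hK.continuous hV.norm_deriv_le⟩

/-- Lipschitz estimates for the fixed point operator. -/
lemma FixedPointSetting.opT_sub (h : FixedPointSetting k Λ x₀ r₀ d₀ M₀ C₀ C₁ b δ P R₀)
    (hV : SmallPert C₀ C₁ δ V) (hW : SmallPert C₀ C₁ δ W) {E : ℝ}
    (hE : ∀ x, |deriv V x - deriv W x| ≤ E) :
    (∀ x, |opT (symA k) P R₀ V x - opT (symA k) P R₀ W x|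
      ≤ Λ * (2 * b / d₀ * E) * (6 / d₀) * δ) ∧
    (∀ x, |deriv (opT (symA k) P R₀ V) x - deriv (opT (symA k) P R₀ W) x|
      ≤ Λ * (2 * b / d₀ * E) * (2 / d₀) * δ) ∧
    ∀ x, |deriv (deriv fun x => opT (symA k) P R₀ V x - opT (symA k) P R₀ W x) x|
      ≤ Λ * (2 * b / d₀ * E) := by
  have hV1 := (h.opT_spec hV).1
  have hW1 := (h.opT_spec hW).1
  have hGV := (h.anchor.isSource h.small h.potential hV).contOffZero.bddMeas
  have hGW := (h.anchor.isSource h.small h.potential hW).contOffZero.bddMeas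
  have hsrc := h.anchor.isSource_sub h.small h.potential hV hW hE
  obtain ⟨S, η, hS, hb⟩ := h.solvable.exists_sol _ _ _ hsrc
  have e := congrArg Prod.fst (h.solvable.unique _ _ _ (hV1.sub hGV hGW hW1) hS)
  simp only at e
  have e' : (fun x => opT (symA k) P R₀ V x - opT (symA k) P R₀ W x) = S := e
  have ed : ∀ x, deriv S x
      = deriv (opT (symA k) P R₀ V) x - deriv (opT (symA k) P R₀ W) x := fun x => by
    rw [← e']
    exact deriv_fun_sub (hV1.1.memW2inf.differentiable x) (hW1.1.memW2inf.differentiable x)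
  -- For differences the energy gap is not needed: the crude bound `2 ε B` on the mean already has
  -- the power of `δ` that makes `T` contract.
  have hJ := abs_integral_le_of_support hsrc.pos.le hsrc.bound hsrc.support
  have hB := hsrc.nonneg
  have hε := hsrc.pos
  have hε2 : (2 * δ / d₀) ^ 2 * (2 * b / d₀ * E) ≤ 2 * δ / d₀ * (2 * b / d₀ * E) := by
    refine mul_le_mul_of_nonneg_right ?_ hB
    nlinarith [hsrc.le_one]
  refine ⟨fun x => ?_, fun x => ?_, ?_⟩
  · rw [show opT (symA k) P R₀ V x - opT (symA k) P R₀ W x = S x from congrFun e' x]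
    refine (hb.abs_le x).trans ?_
    calc _ ≤ Λ * (3 * (2 * δ / d₀) * (2 * b / d₀ * E)) :=
          mul_le_mul_of_nonneg_left (by linarith) h.solvable.pos.le
      _ = _ := by ring
  · rw [← ed]
    refine (hb.abs_deriv_le x).trans (le_of_eq ?_)
    ring
  · rw [e']
    exact abs_deriv_le_of_abs_sub_le hb.abs_deriv_sub_le

lemma FixedPointSetting.opT_sub_half (h : FixedPointSetting k Λ x₀ r₀ d₀ M₀ C₀ C₁ b δ P R₀)
    (hV : SmallPert C₀ C₁ δ V) (hW : SmallPert C₀ C₁ δ W) {E : ℝ}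
    (hE : ∀ x, |deriv V x - deriv W x| ≤ E) :
    (∀ x, |opT (symA k) P R₀ V x - opT (symA k) P R₀ W x| ≤ E / 2) ∧
    (∀ x, |deriv (opT (symA k) P R₀ V) x - deriv (opT (symA k) P R₀ W) x| ≤ E / 2) := by
  obtain ⟨h1, h2, -⟩ := h.opT_sub hV hW hE
  have hE0 : 0 ≤ E := (abs_nonneg _).trans (hE 0)
  have hd := h.anchor.pos.2.1
  have hb := h.b_nonneg
  have hδ := h.small.pos
  have hΛ := h.solvable.pos
  have hc := mul_le_mul_of_nonneg_right h.contr hE0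
  have n1 : 0 ≤ Λ * (2 * b / d₀ * E) * (2 / d₀) * δ := by positivity
  have n2 : 0 ≤ Λ * (2 * b / d₀ * E) * δ := by positivity
  have key : Λ * (2 * b / d₀) * (8 / d₀ + 1) * δ * E
      = Λ * (2 * b / d₀ * E) * (6 / d₀) * δ + Λ * (2 * b / d₀ * E) * (2 / d₀) * δ
        + Λ * (2 * b / d₀ * E) * δ := by ring
  have e6 : Λ * (2 * b / d₀ * E) * (6 / d₀) * δ = 3 * (Λ * (2 * b / d₀ * E) * (2 / d₀) * δ) := by
    ring
  exact ⟨fun x => (h1 x).trans (by linarith), fun x => (h2 x).trans (by linarith)⟩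

/-- The fixed point operator is a contraction for the weighted norm. -/
lemma FixedPointSetting.hashNorm_opT_sub_le
    (h : FixedPointSetting k Λ x₀ r₀ d₀ M₀ C₀ C₁ b δ P R₀)
    (hV : SmallPert C₀ C₁ δ V) (hW : SmallPert C₀ C₁ δ W)
    (cV : Continuous (deriv V)) (cW : Continuous (deriv W)) :
    hashNorm δ (opT (symA k) P R₀ V - opT (symA k) P R₀ W)
      ≤ ENNReal.ofReal (1 / 2) * hashNorm δ (V - W) := by
  have ed : deriv (V - W) = fun x => deriv V x - deriv W x :=
    funext fun x => deriv_sub (hV.diff x) (hW.diff x)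
  have hfin : linf (deriv (V - W)) ≠ ∞ := by
    refine ne_top_of_le_ne_top ENNReal.ofReal_ne_top
      (linf_le_ofReal (f := deriv (V - W)) (M := C₁ * δ + C₁ * δ) fun x => ?_)
    rw [ed]
    exact (abs_sub _ _).trans (add_le_add (hV.deriv_bound x) (hW.deriv_bound x))
  -- Only the first-derivative part of the norm of `V - W` enters the estimate.
  set E := (linf (deriv (V - W))).toReal with hE
  have hE0 : 0 ≤ E := ENNReal.toReal_nonneg
  have hEV : ∀ x, |deriv V x - deriv W x| ≤ E := by
    have := abs_le_of_linf_le (f := deriv (V - W)) hE0 (by rw [ed]; exact cV.sub cW)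
      (ENNReal.ofReal_toReal hfin).ge
    rwa [ed] at this
  obtain ⟨h1, h2, h3⟩ := h.opT_sub hV hW hEV
  have dV := (h.smallPert_opT hV).diff
  have dW := (h.smallPert_opT hW).diff
  have ed' : deriv (opT (symA k) P R₀ V - opT (symA k) P R₀ W)
      = fun x => deriv (opT (symA k) P R₀ V) x - deriv (opT (symA k) P R₀ W) x :=
    funext fun x => deriv_sub (dV x) (dW x)
  have hd := h.anchor.pos.2.1
  have hb := h.b_nonneg
  have hδ := h.small.pos
  have hΛ := h.solvable.pos
  have b1 : linf (opT (symA k) P R₀ V - opT (symA k) P R₀ W) ≤ _ := linf_le_ofReal h1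
  have b2 := linf_le_ofReal h2
  rw [← ed'] at b2
  have b3 : linf (deriv (deriv (opT (symA k) P R₀ V - opT (symA k) P R₀ W))) ≤ _ :=
    linf_le_ofReal h3
  calc hashNorm δ (opT (symA k) P R₀ V - opT (symA k) P R₀ W)
      ≤ ENNReal.ofReal (Λ * (2 * b / d₀ * E) * (6 / d₀) * δ)
        + ENNReal.ofReal (Λ * (2 * b / d₀ * E) * (2 / d₀) * δ)
        + ENNReal.ofReal δ * ENNReal.ofReal (Λ * (2 * b / d₀ * E)) :=
        add_le_add (add_le_add b1 b2) (mul_le_mul_right b3 _)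
    _ = ENNReal.ofReal (Λ * (2 * b / d₀) * (8 / d₀ + 1) * δ * E) := by
        rw [← ENNReal.ofReal_mul hδ.le, ← ENNReal.ofReal_add (by positivity) (by positivity),
          ← ENNReal.ofReal_add (by positivity) (by positivity)]
        congr 1
        ring
    _ ≤ ENNReal.ofReal (1 / 2 * E) :=
        ENNReal.ofReal_le_ofReal (mul_le_mul_of_nonneg_right h.contr hE0)
    _ = ENNReal.ofReal (1 / 2) * linf (deriv (V - W)) := by
        rw [ENNReal.ofReal_mul (by norm_num), ENNReal.ofReal_toReal hfin]
    _ ≤ ENNReal.ofReal (1 / 2) * hashNorm δ (V - W) := by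
        refine mul_le_mul_right ?_ _
        unfold hashNorm
        exact le_add_self.trans le_self_add

lemma tendsto_geometric_half (E : ℝ) : Tendsto (fun n : ℕ => E * (1 / 2) ^ n) atTop (𝓝 0) := by
  simpa using (tendsto_pow_atTop_nhds_zero_of_lt_one (r := (1 / 2 : ℝ)) (by norm_num)
    (by norm_num)).const_mul E

/-- The fixed point operator has a fixed point. -/
theorem FixedPointSetting.exists_fixedPoint
    (h : FixedPointSetting k Λ x₀ r₀ d₀ M₀ C₀ C₁ b δ P R₀) :
    ∃ S, SmallPert C₀ C₁ δ S ∧ opT (symA k) P R₀ S = S := by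
  have hδ := h.small.pos
  have hC0 := h.C₀_nonneg
  have hC1 := h.C₁_nonneg
  set T := opT (symA k) P R₀ with hT
  -- Picard iteration in the `C¹` bounds. Derivatives converge uniformly at a geometric rate, and
  -- values pointwise because all iterates vanish at the origin. Nothing is passed to the limit for
  -- second derivatives; the fixed point regains them as an image under `T`.
  set V : ℕ → ℝ → ℝ := fun n => T^[n] fun _ => 0 with hVdef
  have hVs : ∀ n, V (n + 1) = T (V n) := fun n => Function.iterate_succ_apply' T n _
  have hV : ∀ n, SmallPert C₀ C₁ δ (V n) := by
    intro n
    induction n with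
    | zero =>
      refine ⟨differentiable_const 0, rfl, fun x => ?_, fun x => ?_⟩
      · rw [show V 0 x = 0 from rfl, abs_zero]
        positivity
      · rw [show deriv (V 0) x = 0 from deriv_const x 0, abs_zero]
        positivity
    | succ n ih => rw [hVs]; exact h.smallPert_opT ih
  set E := 2 * (C₁ * δ) with hE
  have step : ∀ n x, |deriv (V n) x - deriv (V (n + 1)) x| ≤ E * (1 / 2) ^ n := by
    intro n
    induction n with
    | zero =>
      intro x
      refine (abs_sub _ _).trans ?_
      have h1 := (hV 0).deriv_bound x
      have h2 := (hV 1).deriv_bound x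
      rw [pow_zero, mul_one, hE]
      linarith
    | succ n ih =>
      intro x
      have := (h.opT_sub_half (hV n) (hV (n + 1)) ih).2 x
      rw [← hT, ← hVs, ← hVs] at this
      rw [pow_succ]
      linarith
  have step0 : ∀ x n, |V n x - V (n + 1) x| ≤ E * |x| * (1 / 2) ^ n := fun x n => by
    have := abs_sub_le_of_hasDerivAt (f := fun x => V n x - V (n + 1) x)
      (fun x => ((hV n).diff x).hasDerivAt.fun_sub ((hV (n + 1)).diff x).hasDerivAt) (step n) x 0
    simp only [(hV n).map_zero, (hV (n + 1)).map_zero, sub_zero] at this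
    linarith
  have hhalf : (1 / 2 : ℝ) < 1 := by norm_num
  have c0 : ∀ x, CauchySeq fun n => V n x := fun x =>
    cauchySeq_of_le_geometric _ _ hhalf fun n => by rw [Real.dist_eq]; exact step0 x n
  have c1 : ∀ x, CauchySeq fun n => deriv (V n) x := fun x =>
    cauchySeq_of_le_geometric _ _ hhalf fun n => by rw [Real.dist_eq]; exact step n x
  choose S hS using fun x => cauchySeq_tendsto_of_complete (c0 x)
  choose S' hS' using fun x => cauchySeq_tendsto_of_complete (c1 x)
  have bS' : ∀ n x, |deriv (V n) x - S' x| ≤ 2 * E * (1 / 2) ^ n := fun n x => by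
    have := dist_le_of_le_geometric_of_tendsto (1 / 2) E hhalf
      (fun n => by rw [Real.dist_eq]; exact step n x) (hS' x) n
    rw [Real.dist_eq] at this
    refine this.trans (le_of_eq ?_)
    ring
  have hunif : TendstoUniformly (fun n => deriv (V n)) S' atTop := by
    rw [Metric.tendstoUniformly_iff]
    intro e he
    filter_upwards [(tendsto_geometric_half (2 * E)).eventually_lt_const he] with n hn x
    rw [dist_comm, Real.dist_eq]
    exact (bS' n x).trans_lt hn
  have hSd : ∀ x, HasDerivAt S (S' x) x := hasDerivAt_of_tendstoUniformly hunif
    (Eventually.of_forall fun n x => ((hV n).diff x).hasDerivAt) hS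
  have hSS : SmallPert C₀ C₁ δ S := by
    refine ⟨fun x => (hSd x).differentiableAt, ?_, fun x => ?_, fun x => ?_⟩
    · refine tendsto_nhds_unique (hS 0) ?_
      simp only [(hV _).map_zero]
      exact tendsto_const_nhds
    · exact le_of_tendsto' (hS x).abs fun n => (hV n).bound x
    · rw [(hSd x).deriv]
      exact le_of_tendsto' (hS' x).abs fun n => (hV n).deriv_bound x
  refine ⟨S, hSS, funext fun x => ?_⟩
  have hlim : Tendsto (fun n => V (n + 1) x) atTop (𝓝 (T S x)) := by
    rw [tendsto_iff_dist_tendsto_zero]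
    refine squeeze_zero (fun n => dist_nonneg) (fun n => ?_) (tendsto_geometric_half E)
    rw [Real.dist_eq, hVs]
    have := (h.opT_sub_half (hV n) hSS (E := 2 * E * (1 / 2) ^ n) fun x => by
      rw [(hSd x).deriv]; exact bS' n x).1 x
    rw [← hT] at this
    linarith
  exact tendsto_nhds_unique hlim ((hS x).comp (tendsto_add_atTop_nat 1))

end

/-! ### Properties of the fixed point -/

/-- The point is `m'(k) ≠ 0`, so that the quotient does not fall to the default value of division by
zero. -/
lemma poleCoeff_ne_zero {k : ℝ} (h : IsOnlyRoot k) (hk : 0 < k) : poleCoeff (symA k) k ≠ 0 := by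
  rw [poleCoeff, (hasDerivAt_symM_root hk.ne' rfl).deriv]
  have h1 := cosT_uK_self_pos hk h.lt_two_pi
  refine div_ne_zero (Real.sqrt_ne_zero'.2 (by positivity)) (neg_ne_zero.2 (by positivity))

/-- Functions with a harmonic tail at `-∞` belong to the tail space. -/
lemma memTailSpace_of_asymptotics {c k l α β C : ℝ} {S : ℝ → ℝ} (hp : poleCoeff c k ≠ 0)
    (hS : Measurable S) (hr : ∀ x, 0 ≤ x → |S x - l| ≤ C / (1 + x))
    (hl : ∀ x, x ≤ 0 → |S x - l - α * Real.cos (k * x) - β * Real.sin (k * x)| ≤ C / (1 - x)) :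
    MemTailSpace c k S := by
  set p := poleCoeff c k with hpdef
  -- `Y₁ - p cos` vanishes for `x > 0` and equals `-2p cos` for `x < 0`, and similarly for `Y₂`,
  -- whence the coefficients. What remains decays like `1 / (1 + |x|)` off the origin, which is
  -- square integrable.
  set Z : ℝ → ℝ := fun x => S x - l - -α / (2 * p) * (Y1 c k x - p * Real.cos (k * x))
    - -β / (2 * p) * (Y2 c k x - p * Real.sin (k * x)) with hZ
  refine ⟨Z, l, -α / (2 * p), -β / (2 * p), ?_, fun x => by rw [hZ]; ring⟩
  have hY1 : Measurable (Y1 c k) := by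
    unfold Y1
    exact (measurable_const.mul (by fun_prop)).mul measurable_sign
  have hY2 : Measurable (Y2 c k) := by
    unfold Y2
    exact (measurable_const.mul (by fun_prop)).mul measurable_sign
  have hZm : Measurable Z := by
    have h1 : Measurable fun x : ℝ => p * Real.cos (k * x) := by fun_prop
    have h2 : Measurable fun x : ℝ => p * Real.sin (k * x) := by fun_prop
    exact ((hS.sub_const l).sub ((hY1.sub h1).const_mul _)).sub ((hY2.sub h2).const_mul _)
  have hC : 0 ≤ C := by
    have := (abs_nonneg _).trans (hr 0 le_rfl)
    simpa using this
  have hb : ∀ x, x ≠ 0 → |Z x| ≤ C / (1 + |x|) := fun x hx => by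
    rcases lt_or_gt_of_ne hx with h | h
    · have e : Z x = S x - l - α * Real.cos (k * x) - β * Real.sin (k * x) := by
        rw [hZ]
        simp only [Y1, Y2, Real.sign_of_neg h, ← hpdef]
        field_simp
        ring
      rw [e, abs_of_neg h]
      exact hl x h.le
    · have e : Z x = S x - l := by
        rw [hZ]
        simp only [Y1, Y2, Real.sign_of_pos h, ← hpdef]
        ring
      rw [e, abs_of_pos h]
      exact hr x h.le
  rw [memLp_two_iff_integrable_sq hZm.aestronglyMeasurable]
  refine (integrable_div_one_add_sq (C ^ 2)).mono' (hZm.pow_const 2).aestronglyMeasurable ?_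
  filter_upwards [compl_mem_ae_iff.2 (measure_singleton (0 : ℝ))] with x hx
  rw [norm_pow, Real.norm_eq_abs]
  have h1 := abs_nonneg x
  calc |Z x| ^ 2 ≤ (C / (1 + |x|)) ^ 2 := pow_le_pow_left₀ (abs_nonneg _) (hb x hx) 2
    _ = C ^ 2 / (1 + |x|) ^ 2 := div_pow _ _ _
    _ ≤ C ^ 2 / (1 + x ^ 2) := by
      refine div_le_div_of_nonneg_left (sq_nonneg C) (by positivity) ?_
      rw [← sq_abs x]
      nlinarith

section
variable {x₀ r₀ d₀ M₀ C₀ C₁ δ : ℝ} {R₀ S : ℝ → ℝ}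

/-- The levels `±δ` are attained within `2δ/d₀` of the origin by continuity, and strict monotonicity
there excludes further crossings. -/
lemma AnchorData.isAdmissible (h : AnchorData x₀ r₀ d₀ M₀ R₀)
    (hs : SmallParam r₀ d₀ M₀ C₀ C₁ δ) (hS : SmallPert C₀ C₁ δ S) (hX : MemX S) :
    IsAdmissible R₀ δ S := by
  have hw := hs.width_pos h.pos.2.1
  have hδ := hs.pos
  set ε := 2 * δ / d₀ with hε
  have hc : Continuous fun x => R₀ x + S x := h.diff.continuous.add hS.diff.continuous
  have h0 : R₀ 0 + S 0 = 0 := by rw [h.map_zero, hS.map_zero, add_zero]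
  have hR := h.gt_right hs hS (x := ε) le_rfl
  have hL := h.lt_left hs hS (x := -ε) le_rfl
  obtain ⟨xp, ⟨p1, p2⟩, p3⟩ := intermediate_value_Icc hw.le hc.continuousOn
    (show δ ∈ Icc (R₀ 0 + S 0) (R₀ ε + S ε) from ⟨by rw [h0]; exact hδ.le, hR.le⟩)
  obtain ⟨xm, ⟨m1, m2⟩, m3⟩ := intermediate_value_Icc (by linarith : -ε ≤ 0) hc.continuousOn
    (show -δ ∈ Icc (R₀ (-ε) + S (-ε)) (R₀ 0 + S 0) from ⟨hL.le, by rw [h0]; linarith⟩)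
  simp only at p3 m3
  have hmono := h.strictMonoOn hs hS
  refine ⟨hX, xm, xp, lt_of_le_of_ne m2 ?_, lt_of_le_of_ne p1 ?_, m3, p3, fun x hx => ?_,
    fun x hx => ?_, fun x h1 h2 => ?_⟩
  · rintro rfl
    linarith
  · rintro rfl
    linarith
  · rcases le_or_gt x (-ε) with h1 | h1
    · exact h.lt_left hs hS h1
    · have := hmono ⟨h1.le, by linarith⟩ ⟨m1, by linarith⟩ hx
      simp only at this
      linarith
  · rcases le_or_gt ε x with h1 | h1
    · exact h.gt_right hs hS h1
    · have := hmono ⟨by linarith, p2⟩ ⟨by linarith, h1.le⟩ hx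
      simp only at this
      linarith
  · have h3 := abs_lt.1 (h.abs_slope_sub_lt hs hS (x := x) (abs_le.2 ⟨by linarith, by linarith⟩))
    have h4 := h.deriv_gt 0 (by rw [abs_zero]; exact h.pos.2.2)
    have h5 := h.pos.2.1
    exact ⟨by linarith, by linarith⟩

/-- The perturbed wave solves the integrated travelling wave equation. -/
lemma solvesIntegratedTW_add {c a η : ℝ} {P : ℝ → ℝ} (hR : BddMeas R₀)
    (ha : ∀ x, c ^ 2 * R₀ x = opA (opA fun y => R₀ y - Real.sign (R₀ y)) x + a)
    (hG : BddMeas (opG P R₀ S)) (hS : IsAffineSolution c (opG P R₀ S) (S, η)) :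
    SolvesIntegratedTW c P (R₀ + S) (η - a) := by
  intro x
  have hs : BddMeas fun y => Real.sign (R₀ y) :=
    ⟨measurable_sign.comp hR.meas, 1, fun x => abs_sign_le _⟩
  have hSm := hS.1.bddMeas
  have h1 := ha x
  have h2 := hS.2 x
  have e : (fun y => deriv P ((R₀ + S) y)) = fun y => opG P R₀ S y + Real.sign (R₀ y) := by
    ext y
    rw [opG, sub_add_cancel, Pi.add_apply]
  rw [opA_sub hR hs, opA_sub (bddMeas_opA hR) (bddMeas_opA hs)] at h1
  rw [e, opA_add hG hs, opA_add (bddMeas_opA hG) (bddMeas_opA hs)]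
  rw [opM] at h2 ⊢
  rw [show (R₀ + S) = fun y => R₀ y + S y from rfl, opA_add hR hSm,
    opA_add (bddMeas_opA hR) (bddMeas_opA hSm)]
  simp only at h1 h2 ⊢
  linear_combination h2 - h1

end

/-! ### Choice of `δ₀` and conclusion -/

/-- All smallness conditions hold for sufficiently small `δ`. -/
lemma exists_smallParam {r₀ d₀ M₀ C₀ C₁ : ℝ} (hr₀ : 0 < r₀) (hd₀ : 0 < d₀)
    (Q : ℝ) :
    ∃ δ₀ > 0, ∀ δ, 0 < δ → δ < δ₀ → SmallParam r₀ d₀ M₀ C₀ C₁ δ ∧ Q * δ ≤ 1 / 2 := by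
  have ev : ∀ A B : ℝ, 0 < B → ∀ᶠ δ in 𝓝 (0 : ℝ), A * δ < B := fun A B hB => by
    have : Tendsto (fun δ => A * δ) (𝓝 0) (𝓝 (A * 0)) := tendsto_id.const_mul A
    exact this.eventually_lt_const (by rwa [mul_zero])
  obtain ⟨δ₀, h0, h⟩ := Metric.eventually_nhds_iff.1
    ((ev (2 / d₀) 1 one_pos).and <| (ev C₀ 1 one_pos).and <|
      (ev 2 r₀ hr₀).and <| (ev (M₀ * (2 / d₀) + C₁) (d₀ / 2) (by positivity)).and
      (ev Q (1 / 2) (by norm_num)))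
  refine ⟨δ₀, h0, fun δ hδ hlt => ?_⟩
  obtain ⟨h1, h3, h4, h5, h6⟩ := h (y := δ)
    (by rwa [Real.dist_eq, sub_zero, abs_of_pos hδ])
  have e : 2 * δ / d₀ = 2 / d₀ * δ := by ring
  refine ⟨⟨hδ, e ▸ h1.le, h3, h4, ?_⟩, h6.le⟩
  rw [e]
  linarith

end PhaseTransition

theorem mainTheorem2
    (c₀ c₁ : ℝ) (hc₀ : 0 < c₀) (hc₀₁ : c₀ < c₁) (hc₁ : c₁ < 1)
    -- near sonic speeds: the symbol `a² - c²` has exactly one positive root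
    (hroot : ∀ c ∈ Set.Icc c₀ c₁, ∃! k : ℝ, 0 < k ∧ PhaseTransition.symM c k = 0)
    (x₀ r₀ d₀ D₀ : ℝ) (hx₀ : 0 < x₀) (hr₀ : 0 < r₀) (hd₀ : 0 < d₀) (hD₀ : 0 < D₀)
    (Ψ : ℝ → ℝ → ℝ) (CΨ : ℝ) (hΨ : PhaseTransition.IsPotentialFamily Ψ CΨ)
    (hI : ∀ δ > 0, PhaseTransition.energyGap (Ψ δ) = 0) :
    ∃ δ₀ > 0, ∃ C₀ > 0, ∃ C₁ > 0, ∃ C₂ > 0, ∃ C > 0,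
      ∀ δ : ℝ, 0 < δ → δ < δ₀ → ∀ c ∈ Set.Icc c₀ c₁,
      ∀ k : ℝ, 0 < k → PhaseTransition.symA k = c →
      ∀ R₀ : ℝ → ℝ, PhaseTransition.IsAnchorWave c k x₀ r₀ d₀ D₀ R₀ →
      -- the operator `T` is well defined on `X_δ`, maps it into itself and is a contraction
      (∀ V, PhaseTransition.MemXdelta C₀ C₁ C₂ δ V →
        ∃! p, PhaseTransition.IsAffineSolution c (PhaseTransition.opG (Ψ δ) R₀ V) p) ∧
      (∀ V, PhaseTransition.MemXdelta C₀ C₁ C₂ δ V →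
        PhaseTransition.MemXdelta C₀ C₁ C₂ δ (PhaseTransition.opT c (Ψ δ) R₀ V)) ∧
      (∃ q : ℝ, 0 ≤ q ∧ q < 1 ∧
        ∀ V W, PhaseTransition.MemXdelta C₀ C₁ C₂ δ V → PhaseTransition.MemXdelta C₀ C₁ C₂ δ W →
          PhaseTransition.hashNorm δ
              (PhaseTransition.opT c (Ψ δ) R₀ V - PhaseTransition.opT c (Ψ δ) R₀ W) ≤
            ENNReal.ofReal q * PhaseTransition.hashNorm δ (V - W)) ∧
      ∃ S : ℝ → ℝ,
        PhaseTransition.opT c (Ψ δ) R₀ S = S ∧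
        PhaseTransition.IsAdmissible R₀ δ S ∧
        PhaseTransition.MemXdelta C₀ C₁ C₂ δ S ∧
        PhaseTransition.MemTailSpace c k S ∧
        (∃ μ : ℝ, PhaseTransition.SolvesIntegratedTW c (Ψ δ) (R₀ + S) μ) ∧
        (R₀ + S) 0 = 0 ∧
        (∃ α β l : ℝ, Filter.Tendsto
          (fun x => (R₀ + S) x - α * Real.cos (k * x) - β * Real.sin (k * x))
          Filter.atBot (nhds l)) ∧
        (∃ l : ℝ, Filter.Tendsto (fun x => (R₀ + S) x - R₀ x) Filter.atTop (nhds l)) ∧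
        (∀ x, x ≤ -(C * δ) → (R₀ + S) x ≤ -δ) ∧
        (∀ x, C * δ ≤ x → δ ≤ (R₀ + S) x) := by
  obtain ⟨Λ, hΛ, hlin⟩ := PhaseTransition.exists_linear_theory hc₀ hc₁ hroot
  have hb := hΨ.nonneg
  have hc₁' : 0 < 1 - c₁ ^ 2 := by nlinarith
  set M₀ := 4 / c₀ ^ 2 * (D₀ * (1 - c₁ ^ 2)⁻¹ + 1) with hM₀
  have hM₀p : 0 < M₀ := by positivity
  set C₁ := 2 * Λ * (CΨ + 1) / d₀ with hC₁
  have hC₁p : 0 < C₁ := by positivity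
  set C₀ := Λ * (4 * (CΨ + 1) / d₀ ^ 2 * (2 * M₀ / d₀ + C₁) + 4 * (CΨ + 1) / d₀ ^ 2) with hC₀
  have hC₀p : 0 < C₀ := by positivity
  obtain ⟨δ₀, hδ₀, hsmall⟩ := PhaseTransition.exists_smallParam (M₀ := M₀) (C₀ := C₀) (C₁ := C₁)
    hr₀ hd₀ (Λ * (2 * CΨ / d₀) * (8 / d₀ + 1))
  -- `Λ * (CΨ + 1)` is the second-derivative bound for a source of height `CΨ + 1`; `2 / d₀` gives
  -- the half-width `2δ/d₀` outside which the wave has left `(-δ, δ)`.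
  refine ⟨δ₀, hδ₀, C₀, hC₀p, C₁, hC₁p, Λ * (CΨ + 1), by positivity, 2 / d₀, by positivity, ?_⟩
  intro δ hδ hδlt c hc k hk hkc R₀ hR₀
  have honly := PhaseTransition.isOnlyRoot_of_existsUnique (hc₀.trans_le hc.1)
    (hc.2.trans_lt hc₁) (hroot c hc) hk hkc
  subst hkc
  obtain ⟨hs, hcontr⟩ := hsmall δ hδ hδlt
  obtain ⟨hA, a, ha⟩ := hR₀.anchorData hx₀ hr₀ hd₀ hD₀ hc₀ hc₁ hc
  obtain ⟨huniq, hex⟩ := hlin k hk hc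
  have hF : PhaseTransition.FixedPointSetting k Λ x₀ r₀ d₀ M₀ C₀ C₁ CΨ δ (Ψ δ) R₀ :=
    ⟨⟨hΛ, huniq, hex⟩, hA, hs, hΨ.potentialData hδ (hI δ hδ), rfl, rfl, hcontr⟩
  have hpert : ∀ V, PhaseTransition.MemXdelta C₀ C₁ (Λ * (CΨ + 1)) δ V →
      PhaseTransition.SmallPert C₀ C₁ δ V := fun V hV => hV.smallPert hC₀p.le hC₁p.le hδ.le
  have hcont : ∀ V, PhaseTransition.MemXdelta C₀ C₁ (Λ * (CΨ + 1)) δ V →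
      Continuous (deriv V) := fun V hV =>
    let ⟨_, hK⟩ := hV.memX.memW2inf.deriv_lipschitz
    hK.continuous
  refine ⟨fun V hV => ⟨_, (hF.opT_spec (hpert V hV)).1, fun p hp =>
      huniq _ _ _ hp (hF.opT_spec (hpert V hV)).1⟩,
    fun V hV => hF.memXdelta_opT (hpert V hV),
    ⟨1 / 2, by norm_num, by norm_num, fun V W hV hW =>
      hF.hashNorm_opT_sub_le (hpert V hV) (hpert W hW) (hcont V hV) (hcont W hW)⟩, ?_⟩
  obtain ⟨S, hS, hfix⟩ := hF.exists_fixedPoint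
  -- Stated for the image of `S` and then rewritten by `hfix`: in this way `S` acquires the
  -- second-derivative bound, the limit at `+∞` and the tail asymptotics.
  have hmem := hF.memXdelta_opT hS
  obtain ⟨hsol, hbd⟩ := hF.opT_spec hS
  rw [hfix] at hmem hbd
  have hsol' : PhaseTransition.IsAffineSolution (PhaseTransition.symA k)
      (PhaseTransition.opG (Ψ δ) R₀ S)
      (S, (PhaseTransition.opL (PhaseTransition.symA k) (PhaseTransition.opG (Ψ δ) R₀ S)).2) := by
    have e := hsol
    rw [← Prod.mk.eta (p := PhaseTransition.opL _ _)] at e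
    rwa [show (PhaseTransition.opL (PhaseTransition.symA k)
      (PhaseTransition.opG (Ψ δ) R₀ S)).1 = S from hfix] at e
  obtain ⟨l, α, β, C, hr, hl⟩ := hbd.asymptotics
  obtain ⟨Rbar, α', β', -, -, -, ⟨αm, βm, rm, hlim⟩, hR₀eq⟩ := hR₀.family
  refine ⟨S, hfix, hA.isAdmissible hs hS hmem.memX, hmem,
    PhaseTransition.memTailSpace_of_asymptotics (PhaseTransition.poleCoeff_ne_zero honly hk)
      hmem.memX.continuous.measurable hr hl,
    ⟨_, PhaseTransition.solvesIntegratedTW_add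
      (.of_continuous hA.diff.continuous hR₀.wave.1.bounded) ha
      (hA.isSource hs hF.potential hS).contOffZero.bddMeas hsol'⟩, ?_,
    -- The tail adds the oscillations of `R̄₀`, of the harmonic correction in `R₀`, and of `S`. The
    -- constants `-αm - α'` come from the normalisation `cos - 1` in the first two.
    ⟨αm + α' + α, βm + β' + β, rm - αm - α' + (0 + l), ?_⟩, ⟨l, ?_⟩, fun x hx => ?_, fun x hx => ?_⟩
  · rw [Pi.add_apply, hA.map_zero, hS.map_zero, add_zero]
  · have h1 := (PhaseTransition.tendsto_zero_of_abs_le_div' hl).add_const l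
    have h2 := ((hlim.sub_const αm).sub_const α').add h1
    refine h2.congr fun x => ?_
    rw [Pi.add_apply, hR₀eq]
    ring
  · have h1 := (PhaseTransition.tendsto_zero_of_abs_le_div hr).add_const l
    rw [zero_add] at h1
    refine h1.congr fun x => ?_
    rw [Pi.add_apply]
    ring
  · exact (hA.lt_left hs hS (by rw [show 2 * δ / d₀ = 2 / d₀ * δ by ring]; exact hx)).le
  · exact (hA.gt_right hs hS (by rw [show 2 * δ / d₀ = 2 / d₀ * δ by ring]; exact hx)).le
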